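/- Let $n\ge 1$, $z_1<z_2$, and let $h:[z_1,z_2]\to(0,\infty)$ be a $C^\infty$ function generating an axially symmetric equilibrium hypersurface $X=\{(z,y)\in\mathbb R\times\mathbb R^{n+1}: z_1\le z\le z_2,\ |y|=h(z)\}$ between the hyperplanes $\{z=z_1\}$ and $\{z=z_2\}$ of $\mathbb R^{n+2}$; that is, its mean curvature $$H=\frac1{n+1}\Big[\frac{h''}{(1+h'^2)^{3/2}}-\frac{n}{h\sqrt{1+h'^2}}\Big]$$ is constant and $h'(z_1)=h'(z_2)=0$. A volume-preserving variation of $X$ is a smooth one-parameter family of hypersurfaces $X(\epsilon)=\{(z,\rho(\epsilon,z,\theta)\,\theta): z_1\le z\le z_2,\ \theta\in S^n\}$, $|\epsilon|<\delta$ (not necessarily axially symmetric), with $\rho>0$ and $\rho(0,z,\theta)=h(z)$, such that the volume enclosed by $X(\epsilon)$ and the two hyperplanes does not depend on $\epsilon$. $X$ is called stable if the second derivative at $\epsilon=0$ of the area of $X(\epsilon)$ is non-negative for every volume-preserving variation, and unstable if it is negative for some volume-preserving variation. Let $$\mathcal L f=\frac{d}{dz}\Big(\frac{h^n}{(1+h'^2)^{3/2}}\frac{df}{dz}\Big)+\frac{n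 h^{n-2}}{\sqrt{1+h'^2}}\,f,$$ and let $\lambda_1<\lambda_2<\cdots$ be the eigenvalues of $\mathcal L\varphi=-\lambda\varphi$ on $[z_1,z_2]$, $\varphi'(z_1)=\varphi'(z_2)=0$. Then the following hold. (I) If $\lambda_1\ge 0$, then $X$ is stable. (II) If $\lambda_1<0<\lambda_2$, then there is a unique $C^\infty$ function $u:[z_1,z_2]\to\mathbb R$ with $\mathcal L u=h^n$ and $u'(z_1)=u'(z_2)=0$. If $\int_{z_1}^{z_2}u h^n\,dz\ge 0$, then $X$ is stable; if $\int_{z_1}^{z_2}u h^n\,dz<0$, then $X$ is unstable. (III) Suppose $\lambda_1<0=\lambda_2$. (III-A) If some $\lambda_2$-eigenfunction $e$ satisfies $\int_{z_1}^{z_2}e h^n\,dz\ne 0$, then $X$ is unstable. (III-B) If $\int_{z_1}^{z_2}e h^n\,dz=0$ for every $\lambda_2$-eigenfunction $e$, then there is a unique $C^\infty$ function $u:[z_1,z_2]\to\mathbb R$ with $\mathcal L u=h^n$, $u'(z_1)=u'(z_2)=0$, and $\int_{z_1}^{z_2}e u h^n\,dz=0$ for every $\lambda_2$-eigenfunction $e$.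 If $\int_{z_1}^{z_2}u h^n\,dz\ge 0$, then $X$ is stable; if $\int_{z_1}^{z_2}u h^n\,dz<0$, then $X$ is unstable. (IV) If $\lambda_2<0$, then $X$ is unstable. -/

import Mathlib

open Set MeasureTheory
open scoped ContDiff

noncomputable section

namespace LiquidBridge

/-- The cross-section space `ℝ^{n+1}`; the ambient space is `ℝ × ℝ^{n+1}`, with points `(z, y)`. -/
abbrev Cross (n : ℕ) : Type := EuclideanSpace ℝ (Fin (n + 1))

/-- The unit sphere `S^n` of `ℝ^{n+1}`. -/
abbrev UnitSphere (n : ℕ) : Type := Metric.sphere (0 : Cross n) 1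

/-! ### Axially symmetric equilibrium hypersurfaces -/

/-- Derivative of a function on the closed interval `[z₁, z₂]` (one-sided at the end points). -/
def D (z₁ z₂ : ℝ) (f : ℝ → ℝ) : ℝ → ℝ := derivWithin f (Icc z₁ z₂)

/-- Mean curvature of the hypersurface of revolution `|y| = h z`. -/
def meanCurvature (n : ℕ) (z₁ z₂ : ℝ) (h : ℝ → ℝ) (z : ℝ) : ℝ :=
  1 / ((n : ℝ) + 1) *
    (D z₁ z₂ (D z₁ z₂ h) z / (1 + D z₁ z₂ h z ^ 2) ^ (3 / 2 : ℝ)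
      - n / (h z * Real.sqrt (1 + D z₁ z₂ h z ^ 2)))

/-- `h` generates an axially symmetric equilibrium hypersurface between the hyperplanes
`{z = z₁}` and `{z = z₂}`: it is smooth and positive on `[z₁, z₂]`, the surface of revolution has
constant mean curvature, and it meets both hyperplanes perpendicularly. -/
structure IsEquilibrium (n : ℕ) (z₁ z₂ : ℝ) (h : ℝ → ℝ) : Prop where
  smooth : ContDiffOn ℝ ∞ h (Icc z₁ z₂)
  pos : ∀ z ∈ Icc z₁ z₂, 0 < h z
  cmc : ∃ H₀ : ℝ, ∀ z ∈ Icc z₁ z₂, meanCurvature n z₁ z₂ h z = H₀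
  perp_left : D z₁ z₂ h z₁ = 0
  perp_right : D z₁ z₂ h z₂ = 0

/-! ### Area, volume, variations and stability -/

/-- Squared norm of the gradient along `S^n` at `θ` of (the restriction to `S^n` of) `f`:
the squared norm of the part of the ambient gradient tangent to the sphere. -/
def sphereGradSq (n : ℕ) (f : Cross n → ℝ) (θ : Cross n) : ℝ :=
  ‖gradient f θ - inner ℝ (gradient f θ) θ • θ‖ ^ 2

/-- Area of the hypersurface `{(z, r(z, θ) θ) : z₁ ≤ z ≤ z₂, θ ∈ S^n}`. The metric induced on it is
`dz² + dr² + r² dθ²`, with area element `r^n √(1 + r_z² + |∇_θ r|² / r²) dθ dz`. -/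
def area (n : ℕ) (z₁ z₂ : ℝ) (r : ℝ → Cross n → ℝ) : ℝ :=
  ∫ z in z₁..z₂, ∫ θ : UnitSphere n,
    r z θ ^ n * Real.sqrt (1 + D z₁ z₂ (fun s => r s θ) z ^ 2
      + sphereGradSq n (r z) θ / r z θ ^ 2) ∂(volume : Measure (Cross n)).toSphere

/-- Volume of the domain `{(z, t θ) : z₁ ≤ z ≤ z₂, θ ∈ S^n, 0 ≤ t ≤ r(z, θ)}` enclosed by that
hypersurface and the two hyperplanes, in polar coordinates. -/
def enclosedVolume (n : ℕ) (z₁ z₂ : ℝ) (r : ℝ → Cross n → ℝ) : ℝ :=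
  ∫ z in z₁..z₂, ∫ θ : UnitSphere n,
    r z θ ^ (n + 1) / ((n : ℝ) + 1) ∂(volume : Measure (Cross n)).toSphere

/-- A smooth volume-preserving variation of the hypersurface of revolution `|y| = h z`, by
hypersurfaces in the slab with boundary on the two hyperplanes. It need not be axially symmetric.
A hypersurface of this kind close to the original one is a radial graph `{(z, r(z, θ) θ)}` over
`[z₁, z₂] × S^n`, so the variation is a smooth family `ρ ε` of positive functions `r`. A smooth
function on `S^n` is given by a smooth function on `ℝ^{n+1}`, of which only the restriction to
`S^n` matters. -/
structure IsVolumePreservingVariation (n : ℕ) (z₁ z₂ : ℝ) (h : ℝ → ℝ)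
    (δ : ℝ) (ρ : ℝ → ℝ → Cross n → ℝ) : Prop where
  smooth : ContDiffOn ℝ ∞ (fun p : ℝ × ℝ × Cross n => ρ p.1 p.2.1 p.2.2)
    (Ioo (-δ) δ ×ˢ Icc z₁ z₂ ×ˢ univ)
  pos : ∀ ε ∈ Ioo (-δ) δ, ∀ z ∈ Icc z₁ z₂, ∀ θ : UnitSphere n, 0 < ρ ε z θ
  start : ∀ z ∈ Icc z₁ z₂, ∀ θ : UnitSphere n, ρ 0 z θ = h z
  volume_eq : ∀ ε ∈ Ioo (-δ) δ,
    enclosedVolume n z₁ z₂ (ρ ε) = enclosedVolume n z₁ z₂ (ρ 0)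

/-- Stability: the second variation of area is non-negative for every volume-preserving
variation. -/
def Stable (n : ℕ) (z₁ z₂ : ℝ) (h : ℝ → ℝ) : Prop :=
  ∀ (δ : ℝ) (ρ : ℝ → ℝ → Cross n → ℝ), 0 < δ →
    IsVolumePreservingVariation n z₁ z₂ h δ ρ →
      0 ≤ iteratedDeriv 2 (fun ε => area n z₁ z₂ (ρ ε)) 0

/-- Instability: the second variation of area is negative for some volume-preserving variation. -/
def Unstable (n : ℕ) (z₁ z₂ : ℝ) (h : ℝ → ℝ) : Prop :=
  ∃ (δ : ℝ) (ρ : ℝ → ℝ → Cross n → ℝ), 0 < δ ∧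
    IsVolumePreservingVariation n z₁ z₂ h δ ρ ∧
      iteratedDeriv 2 (fun ε => area n z₁ z₂ (ρ ε)) 0 < 0

/-! ### The Sturm–Liouville problem -/

/-- `σ = h^n / (1 + h_z²)^{3/2}`. -/
def sigma (n : ℕ) (z₁ z₂ : ℝ) (h : ℝ → ℝ) (z : ℝ) : ℝ :=
  h z ^ n / (1 + D z₁ z₂ h z ^ 2) ^ (3 / 2 : ℝ)

/-- `𝓛 f = (σ f')' + n h^{n-2} / √(1 + h_z²) f`; the exponent `n - 2` is an integer. -/
def jacobiOp (n : ℕ) (z₁ z₂ : ℝ) (h f : ℝ → ℝ) (z : ℝ) : ℝ :=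
  D z₁ z₂ (fun s => sigma n z₁ z₂ h s * D z₁ z₂ f s) z
    + n * h z ^ ((n : ℤ) - 2) / Real.sqrt (1 + D z₁ z₂ h z ^ 2) * f z

/-- `φ` is an eigenfunction, with eigenvalue `l`, of `𝓛 φ = -l φ`, `φ'(z₁) = φ'(z₂) = 0`. -/
structure IsEigenfunction (n : ℕ) (z₁ z₂ : ℝ) (h : ℝ → ℝ) (l : ℝ) (φ : ℝ → ℝ) : Prop where
  smooth : ContDiffOn ℝ ∞ φ (Icc z₁ z₂)
  ne_zero : ∃ z ∈ Icc z₁ z₂, φ z ≠ 0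
  eqn : ∀ z ∈ Icc z₁ z₂, jacobiOp n z₁ z₂ h φ z = -l * φ z
  neumann_left : D z₁ z₂ φ z₁ = 0
  neumann_right : D z₁ z₂ φ z₂ = 0

/-- The set of eigenvalues. -/
def eigenvalues (n : ℕ) (z₁ z₂ : ℝ) (h : ℝ → ℝ) : Set ℝ :=
  {l | ∃ φ, IsEigenfunction n z₁ z₂ h l φ}

/-- The smallest eigenvalue. -/
def lambda₁ (n : ℕ) (z₁ z₂ : ℝ) (h : ℝ → ℝ) : ℝ := sInf (eigenvalues n z₁ z₂ h)

/-- The second eigenvalue: the smallest one above `lambda₁` (all eigenvalues are simple). -/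
def lambda₂ (n : ℕ) (z₁ z₂ : ℝ) (h : ℝ → ℝ) : ℝ :=
  sInf {l ∈ eigenvalues n z₁ z₂ h | lambda₁ n z₁ z₂ h < l}

/-- `u` is a smooth function on `[z₁, z₂]` with `𝓛 u = h^n`, `u'(z₁) = u'(z₂) = 0`. -/
structure IsNeumannSolution (n : ℕ) (z₁ z₂ : ℝ) (h u : ℝ → ℝ) : Prop where
  smooth : ContDiffOn ℝ ∞ u (Icc z₁ z₂)
  eqn : ∀ z ∈ Icc z₁ z₂, jacobiOp n z₁ z₂ h u z = h z ^ n
  neumann_left : D z₁ z₂ u z₁ = 0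
  neumann_right : D z₁ z₂ u z₂ = 0

end LiquidBridge

end

/-!
Let `f` be the initial velocity of a volume-preserving variation. The mean curvature is constant,
so it acts as a Lagrange multiplier: after subtraction of a multiple of the second variation of
volume, which is zero, and of an exact `z`-derivative, which integrates to zero because `h'`
vanishes at both ends, the second variation of area is
`∫∫ σ f_z² + (h^{n-2}/√(1+h'²)) (|∇_θ f|² - n f²)` (`second_variation`). It no longer involves the
second-order part of the variation, and the volume constraint becomes `∫∫ h^n f = 0`.

On the part of `f(z, ·)` of mean zero the last bracket has nonnegative integral over the sphere,
since the first nonzero eigenvalue of `S^n` is `n`. So the second variation is at least that of the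
spherical mean of `f` (`form_mean_le`). The eigenvalue bound (`sphere_poincare`) is obtained from
the Gaussian Poincaré inequality applied to the 1-homogeneous extension of a function on the
sphere; the Gaussian inequality in turn follows from the one-dimensional one by tensorization.
Conversely every function `f(z)` with `∫ h^n f = 0` is the velocity of an axially symmetric
variation of constant volume, so stability is equivalent to nonnegativity of the quadratic form
`∫ σ f'² - q f²` of `𝓛` on the orthogonal complement of `h^n`
(`stable_of_form_nonneg`, `unstable_of_form_neg`).

What remains is linear algebra for this form, given the spectral facts of `exists_two_eigenvalues`:
it is bounded below by `λ₁` everywhere and by `λ₂` on the complement of the first eigenfunction.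
The solution `u` of `𝓛 u = h^n` is orthogonal, for the form, to the complement of `h^n`, and the
form takes the value `-∫ u h^n` at `u`. As the form has at most one negative direction when
`λ₂ ≥ 0`, the sign of this number decides whether that direction is used up by `u`
(`form_nonneg_of_solution`, `exists_neg_of_solution`). The spectral facts are proved without
compactness of the resolvent: the Neumann problem is solved by shooting, with an `L²` bound
(`exists_neumann_solution`), and the bound shows that the infimum of the Rayleigh quotient is an
eigenvalue, since otherwise the form shifted by the infimum would be coercive (`form_coercive`).
-/

noncomputable section

namespace LiquidBridge

/-! ### Linear second-order equations on an interval -/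

/-- Truncation of a real number to `[-ρ, ρ]`. -/
def clip (ρ x : ℝ) : ℝ := max (-ρ) (min ρ x)

lemma abs_clip_le {ρ x : ℝ} (hρ : 0 ≤ ρ) : |clip ρ x| ≤ ρ := by
  unfold clip
  rw [abs_le]
  exact ⟨le_max_left _ _, max_le (by linarith) (min_le_left _ _)⟩

lemma clip_eq_self {ρ x : ℝ} (hx : |x| ≤ ρ) : clip ρ x = x := by
  rw [abs_le] at hx
  unfold clip
  rw [min_eq_right hx.2, max_eq_right hx.1]

lemma abs_clip_le_abs {ρ x : ℝ} (hρ : 0 ≤ ρ) : |clip ρ x| ≤ |x| := by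
  rcases le_total |x| ρ with hx | hx
  · rw [clip_eq_self hx]
  · exact (abs_clip_le hρ).trans hx

lemma abs_clip_sub_le (ρ x y : ℝ) : |clip ρ x - clip ρ y| ≤ |x - y| := by
  have h : LipschitzWith 1 (clip ρ) := (LipschitzWith.id.const_min ρ).const_max (-ρ)
  simpa [Real.dist_eq] using h.dist_le_mul x y

/-- The first-order system `y' = r v`, `v' = g - q y` with continuous coefficients has solutions on
the whole interval. The vector field is truncated outside a large ball, so that a single
application of the Picard–Lindelöf theorem covers the interval, and Grönwall's inequality shows
that the solution stays in the ball. -/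
lemma exists_linear_system {a b : ℝ} (hab : a ≤ b) {r q g : ℝ → ℝ}
    (hr : ContinuousOn r (Icc a b)) (hq : ContinuousOn q (Icc a b))
    (hg : ContinuousOn g (Icc a b)) (x₀ : ℝ × ℝ) :
    ∃ x : ℝ → ℝ × ℝ, x a = x₀ ∧ ∀ t ∈ Icc a b,
      HasDerivWithinAt x (r t * (x t).2, g t - q t * (x t).1) (Icc a b) t := by
  obtain ⟨M₁, hM₁⟩ := isCompact_Icc.exists_bound_of_continuousOn hr
  obtain ⟨M₂, hM₂⟩ := isCompact_Icc.exists_bound_of_continuousOn hq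
  obtain ⟨M₃, hM₃⟩ := isCompact_Icc.exists_bound_of_continuousOn hg
  set M : ℝ := max (max M₁ M₂) (max M₃ 0) with hM
  have hM0 : 0 ≤ M := (le_max_right _ _).trans (le_max_right _ _)
  have br : ∀ t ∈ Icc a b, |r t| ≤ M := fun t ht =>
    (hM₁ t ht).trans ((le_max_left _ _).trans (le_max_left _ _))
  have bq : ∀ t ∈ Icc a b, |q t| ≤ M := fun t ht =>
    (hM₂ t ht).trans ((le_max_right _ _).trans (le_max_left _ _))
  have bg : ∀ t ∈ Icc a b, |g t| ≤ M := fun t ht =>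
    (hM₃ t ht).trans ((le_max_left _ _).trans (le_max_right _ _))
  set ρ : ℝ := gronwallBound ‖x₀‖ M M (b - a) with hρdef
  have hmono := gronwallBound_mono (norm_nonneg x₀) hM0 hM0
  have hρ : 0 ≤ ρ := by
    have := hmono (sub_nonneg.2 hab)
    rw [gronwallBound_x0] at this
    exact (norm_nonneg _).trans this
  set F : ℝ → ℝ × ℝ → ℝ × ℝ := fun t x => (r t * clip ρ x.2, g t - q t * clip ρ x.1) with hF
  have hFlip : ∀ t ∈ Icc a b, ∀ x y : ℝ × ℝ, ‖F t x - F t y‖ ≤ M * ‖x - y‖ := by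
    intro t ht x y
    rw [Prod.norm_def]
    refine max_le ?_ ?_
    · have : (F t x - F t y).1 = r t * (clip ρ x.2 - clip ρ y.2) := by simp [hF]; ring
      rw [this, norm_mul]
      refine mul_le_mul (br t ht) ((abs_clip_sub_le _ _ _).trans ?_) (norm_nonneg _) hM0
      exact norm_snd_le (x - y)
    · have : (F t x - F t y).2 = -(q t * (clip ρ x.1 - clip ρ y.1)) := by simp [hF]; ring
      rw [this, norm_neg, norm_mul]
      refine mul_le_mul (bq t ht) ((abs_clip_sub_le _ _ _).trans ?_) (norm_nonneg _) hM0
      exact norm_fst_le (x - y)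
  have hFgrow : ∀ t ∈ Icc a b, ∀ x : ℝ × ℝ, ‖F t x‖ ≤ M * ‖x‖ + M := by
    intro t ht x
    rw [Prod.norm_def]
    refine max_le ?_ ?_
    · have h1 : |r t * clip ρ x.2| ≤ M * ‖x‖ := by
        rw [abs_mul]
        exact mul_le_mul (br t ht) ((abs_clip_le_abs hρ).trans (norm_snd_le x)) (abs_nonneg _) hM0
      exact h1.trans (by linarith)
    · have h1 : |q t * clip ρ x.1| ≤ M * ‖x‖ := by
        rw [abs_mul]
        exact mul_le_mul (bq t ht) ((abs_clip_le_abs hρ).trans (norm_fst_le x)) (abs_nonneg _) hM0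
      have h2 : |g t - q t * clip ρ x.1| ≤ |g t| + |q t * clip ρ x.1| := abs_sub _ _
      exact h2.trans (by linarith [bg t ht])
  have hFbdd : ∀ t ∈ Icc a b, ∀ x : ℝ × ℝ, ‖F t x‖ ≤ M * ρ + M := by
    intro t ht x
    have h0 : F t x = F t (clip ρ x.1, clip ρ x.2) := by
      simp only [hF]
      rw [clip_eq_self (abs_clip_le hρ), clip_eq_self (abs_clip_le hρ)]
    rw [h0]
    refine (hFgrow t ht _).trans ?_
    have : ‖((clip ρ x.1, clip ρ x.2) : ℝ × ℝ)‖ ≤ ρ := by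
      rw [Prod.norm_def]
      exact max_le (abs_clip_le hρ) (abs_clip_le hρ)
    nlinarith
  have hLnn : 0 ≤ M * ρ + M := by positivity
  have hPL : IsPicardLindelof F (⟨a, left_mem_Icc.2 hab⟩ : Icc a b) x₀
      ⟨(M * ρ + M) * (b - a), mul_nonneg hLnn (sub_nonneg.2 hab)⟩ 0 ⟨M * ρ + M, hLnn⟩
      ⟨M, hM0⟩ := by
    refine ⟨fun t ht => ?_, fun x _ => ?_, fun t ht x _ => hFbdd t ht x, ?_⟩
    · refine LipschitzOnWith.of_dist_le_mul fun x _ y _ => ?_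
      rw [dist_eq_norm, dist_eq_norm]
      exact hFlip t ht x y
    · simp only [hF]
      fun_prop
    · change (M * ρ + M) * max (b - a) (a - a) ≤ (M * ρ + M) * (b - a) - 0
      rw [sub_self, max_eq_left (sub_nonneg.2 hab), sub_zero]
  obtain ⟨x, hx0, hx⟩ := hPL.exists_eq_forall_mem_Icc_hasDerivWithinAt₀
  have hx0' : x a = x₀ := hx0
  refine ⟨x, hx0', fun t ht => ?_⟩
  have hxc : ContinuousOn x (Icc a b) := fun t ht => (hx t ht).continuousWithinAt
  have hgr := norm_le_gronwallBound_of_norm_deriv_right_le (f := x) (f' := fun t => F t (x t))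
    (δ := ‖x₀‖) (K := M) (ε := M) hxc
    (fun s hs => (hx s (Ico_subset_Icc_self hs)).mono_of_mem_nhdsWithin
      (Icc_mem_nhdsGE_of_mem hs)) (by rw [hx0'])
    (fun s hs => hFgrow s (Ico_subset_Icc_self hs) _) t ht
  have hle : ‖x t‖ ≤ ρ := hgr.trans (hmono (by linarith [ht.2]))
  have := hx t ht
  simp only [hF] at this
  rwa [clip_eq_self ((norm_snd_le (x t)).trans hle), clip_eq_self ((norm_fst_le (x t)).trans hle)]
    at this

/-- Solutions of the first-order system that vanish at `a` are controlled by the right-hand side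
in `L²`, by a Grönwall argument for `y² + v²`. -/
lemma energy_estimate {a b : ℝ} (hab : a ≤ b) {r q : ℝ → ℝ}
    (hr : ContinuousOn r (Icc a b)) (hq : ContinuousOn q (Icc a b)) :
    ∃ C : ℝ, 0 ≤ C ∧ ∀ (g y v : ℝ → ℝ), ContinuousOn g (Icc a b) → y a = 0 → v a = 0 →
      (∀ t ∈ Icc a b, HasDerivWithinAt y (r t * v t) (Icc a b) t) →
      (∀ t ∈ Icc a b, HasDerivWithinAt v (g t - q t * y t) (Icc a b) t) →
      ∀ t ∈ Icc a b, y t ^ 2 + v t ^ 2 ≤ C * ∫ s in a..b, g s ^ 2 := by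
  obtain ⟨M₁, hM₁⟩ := isCompact_Icc.exists_bound_of_continuousOn hr
  obtain ⟨M₂, hM₂⟩ := isCompact_Icc.exists_bound_of_continuousOn hq
  set K : ℝ := M₁ + M₂ + 1 with hK
  have haI : a ∈ Icc a b := left_mem_Icc.2 hab
  have hK0 : 0 ≤ K := by
    have h1 := (norm_nonneg _).trans (hM₁ a haI)
    have h2 := (norm_nonneg _).trans (hM₂ a haI)
    positivity
  refine ⟨Real.exp (K * (b - a)), (Real.exp_pos _).le, fun g y v hg hya hva hy hv t ht => ?_⟩
  set Ψ : ℝ → ℝ := fun z => Real.exp (-(K * (z - a))) * (y z ^ 2 + v z ^ 2) -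
    ∫ s in a..z, g s ^ 2 with hΨ
  have hg2 : ContinuousOn (fun s => g s ^ 2) (Icc a b) := hg.pow 2
  have hder : ∀ z ∈ Icc a b, HasDerivWithinAt Ψ
      (Real.exp (-(K * (z - a))) * (-(K * 1)) * (y z ^ 2 + v z ^ 2) +
        Real.exp (-(K * (z - a))) * (2 * y z * (r z * v z) + 2 * v z * (g z - q z * y z))
        - g z ^ 2) (Icc a b) z := by
    intro z hz
    have h1 : HasDerivWithinAt (fun z => Real.exp (-(K * (z - a))))
        (Real.exp (-(K * (z - a))) * (-(K * 1))) (Icc a b) z :=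
      ((((hasDerivAt_id z).sub_const a).const_mul K).neg.exp).hasDerivWithinAt
    have h2 : HasDerivWithinAt (fun z => y z ^ 2 + v z ^ 2)
        (2 * y z * (r z * v z) + 2 * v z * (g z - q z * y z)) (Icc a b) z := by
      refine (((hy z hz).fun_pow 2).fun_add ((hv z hz).fun_pow 2)).congr_deriv ?_
      simp
    have h3 : HasDerivWithinAt (fun z => ∫ s in a..z, g s ^ 2) (g z ^ 2) (Icc a b) z := by
      have : Fact (z ∈ Icc a b) := ⟨hz⟩
      refine intervalIntegral.integral_hasDerivWithinAt_right ?_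
        (hg2.stronglyMeasurableAtFilter_nhdsWithin measurableSet_Icc z) (hg2 z hz)
      exact (hg2.mono (uIcc_subset_Icc haI hz)).intervalIntegrable
    exact (h1.mul h2).sub h3
  have hanti : AntitoneOn Ψ (Icc a b) := by
    refine antitoneOn_of_hasDerivWithinAt_nonpos (convex_Icc a b)
      (fun z hz => (hder z hz).continuousWithinAt)
      (fun z hz => (hder z (interior_subset hz)).mono interior_subset) (fun z hz => ?_)
    have hz' := interior_subset hz
    set e := Real.exp (-(K * (z - a))) with he
    have he0 : 0 < e := Real.exp_pos _
    have he1 : e ≤ 1 := by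
      rw [he, Real.exp_le_one_iff]
      have : 0 ≤ K * (z - a) := mul_nonneg hK0 (by linarith [hz'.1])
      linarith
    have b1 : 2 * y z * (r z * v z) ≤ M₁ * (y z ^ 2 + v z ^ 2) := by
      have hr1 := abs_le.1 (hM₁ z hz')
      nlinarith [sq_nonneg (y z - v z), sq_nonneg (y z + v z)]
    have b2 : -(2 * v z * (q z * y z)) ≤ M₂ * (y z ^ 2 + v z ^ 2) := by
      have hr1 := abs_le.1 (hM₂ z hz')
      nlinarith [sq_nonneg (y z - v z), sq_nonneg (y z + v z)]
    have b3 : 2 * y z * (r z * v z) + 2 * v z * (g z - q z * y z) - K * (y z ^ 2 + v z ^ 2)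
        ≤ g z ^ 2 := by
      nlinarith [sq_nonneg (v z - g z), sq_nonneg (y z)]
    have b4 : e * (2 * y z * (r z * v z) + 2 * v z * (g z - q z * y z)
        - K * (y z ^ 2 + v z ^ 2)) ≤ e * g z ^ 2 := mul_le_mul_of_nonneg_left b3 he0.le
    have b5 : e * g z ^ 2 ≤ g z ^ 2 := by nlinarith [sq_nonneg (g z)]
    nlinarith
  have h0 : Ψ a = 0 := by simp [hΨ, hya, hva]
  have h1 := hanti haI ht ht.1
  rw [h0] at h1
  have h2 : ∫ s in a..t, g s ^ 2 ≤ ∫ s in a..b, g s ^ 2 := by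
    refine intervalIntegral.integral_mono_interval le_rfl ht.1 ht.2
      (Filter.Eventually.of_forall fun s => sq_nonneg _) ?_
    exact (hg2.mono (uIcc_of_le hab).subset).intervalIntegrable
  have h3 : Real.exp (-(K * (t - a))) * (y t ^ 2 + v t ^ 2) ≤ ∫ s in a..b, g s ^ 2 := by
    simp only [hΨ] at h1
    linarith
  have h4 : y t ^ 2 + v t ^ 2 ≤ Real.exp (K * (t - a)) * ∫ s in a..b, g s ^ 2 := by
    have h5 := mul_le_mul_of_nonneg_left h3 (Real.exp_pos (K * (t - a))).le
    rwa [← mul_assoc, ← Real.exp_add, add_neg_cancel, Real.exp_zero, one_mul] at h5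
  have hint : 0 ≤ ∫ s in a..b, g s ^ 2 :=
    intervalIntegral.integral_nonneg hab fun s _ => sq_nonneg _
  refine h4.trans (mul_le_mul_of_nonneg_right (Real.exp_le_exp.2 ?_) hint)
  exact mul_le_mul_of_nonneg_left (by linarith [ht.2]) hK0

/-! ### Calculus of smooth functions on a closed interval -/

section Calculus

variable {a b : ℝ}

lemma D_smooth (hab : a < b) {f : ℝ → ℝ} (hf : ContDiffOn ℝ ∞ f (Icc a b)) :
    ContDiffOn ℝ ∞ (D a b f) (Icc a b) :=
  ((contDiffOn_infty_iff_derivWithin (uniqueDiffOn_Icc hab)).1 hf).2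

lemma D_hasDeriv {f : ℝ → ℝ} (hf : ContDiffOn ℝ ∞ f (Icc a b)) {z : ℝ} (hz : z ∈ Icc a b) :
    HasDerivWithinAt f (D a b f z) (Icc a b) z :=
  ((hf.differentiableOn (by simp)) z hz).hasDerivWithinAt

lemma D_eq (hab : a < b) {f : ℝ → ℝ} {f' z : ℝ} (hz : z ∈ Icc a b)
    (h : HasDerivWithinAt f f' (Icc a b) z) : D a b f z = f' :=
  h.derivWithin (uniqueDiffOn_Icc hab z hz)

lemma D_congr {f g : ℝ → ℝ} (h : EqOn f g (Icc a b)) {z : ℝ} (hz : z ∈ Icc a b) :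
    D a b f z = D a b g z :=
  derivWithin_congr h (h hz)

lemma D_mul (hab : a < b) {f g : ℝ → ℝ} (hf : ContDiffOn ℝ ∞ f (Icc a b))
    (hg : ContDiffOn ℝ ∞ g (Icc a b)) {z : ℝ} (hz : z ∈ Icc a b) :
    D a b (fun s => f s * g s) z = D a b f z * g z + f z * D a b g z :=
  D_eq hab hz ((D_hasDeriv hf hz).mul (D_hasDeriv hg hz))

lemma D_add (hab : a < b) {f g : ℝ → ℝ} (hf : ContDiffOn ℝ ∞ f (Icc a b))
    (hg : ContDiffOn ℝ ∞ g (Icc a b)) {z : ℝ} (hz : z ∈ Icc a b) :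
    D a b (fun s => f s + g s) z = D a b f z + D a b g z :=
  D_eq hab hz ((D_hasDeriv hf hz).add (D_hasDeriv hg hz))

lemma D_const_mul (hab : a < b) (c : ℝ) {f : ℝ → ℝ} (hf : ContDiffOn ℝ ∞ f (Icc a b))
    {z : ℝ} (hz : z ∈ Icc a b) :
    D a b (fun s => c * f s) z = c * D a b f z :=
  D_eq hab hz ((D_hasDeriv hf hz).const_mul c)

lemma integral_D (hab : a < b) {f : ℝ → ℝ} (hf : ContDiffOn ℝ ∞ f (Icc a b)) :
    ∫ z in a..b, D a b f z = f b - f a :=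
  intervalIntegral.integral_derivWithin_Icc_of_contDiffOn_Icc (hf.of_le (by simp)) hab.le

lemma intervalIntegrable_of_contOn (hab : a ≤ b) {f : ℝ → ℝ} (hf : ContinuousOn f (Icc a b)) :
    IntervalIntegrable f volume a b :=
  ContinuousOn.intervalIntegrable (by rwa [uIcc_of_le hab])

lemma integral_congr_Icc (hab : a ≤ b) {f g : ℝ → ℝ} (h : ∀ z ∈ Icc a b, f z = g z) :
    ∫ z in a..b, f z = ∫ z in a..b, g z :=
  intervalIntegral.integral_congr fun z hz => h z (by rwa [uIcc_of_le hab] at hz)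

/-- A continuous function whose square has vanishing integral is zero. -/
lemma eq_zero_of_integral_sq_le (hab : a < b) {f : ℝ → ℝ} (hf : ContinuousOn f (Icc a b))
    (h : ∫ z in a..b, f z * f z ≤ 0) : ∀ z ∈ Icc a b, f z = 0 := by
  intro z hz
  by_contra hne
  have : 0 < ∫ z in a..b, f z * f z :=
    intervalIntegral.integral_pos hab (hf.mul hf) (fun x _ => mul_self_nonneg _)
      ⟨z, hz, mul_self_pos.2 hne⟩
  linarith

end Calculus

/-! ### The Neumann problem for a Sturm–Liouville operator -/

/-- The Sturm–Liouville operator `f ↦ (p f')' + q f` on `[a, b]`. -/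
def slOp (a b : ℝ) (p q f : ℝ → ℝ) (z : ℝ) : ℝ :=
  D a b (fun s => p s * D a b f s) z + q z * f z

/-- Regular smooth coefficients on a nondegenerate interval. -/
structure IsRegular (a b : ℝ) (p q : ℝ → ℝ) : Prop where
  lt : a < b
  smooth_p : ContDiffOn ℝ ∞ p (Icc a b)
  smooth_q : ContDiffOn ℝ ∞ q (Icc a b)
  pos : ∀ z ∈ Icc a b, 0 < p z

/-- The space of functions that are smooth on `[a, b]`. Values outside the interval are arbitrary,
so the `L²` product below is only positive semidefinite on it. -/
def Smooth (a b : ℝ) : Submodule ℝ (ℝ → ℝ) where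
  carrier := {f | ContDiffOn ℝ ∞ f (Icc a b)}
  add_mem' := fun hf hg => ContDiffOn.add hf hg
  zero_mem' := contDiffOn_const
  smul_mem' := fun _ _ hf => contDiffOn_const.smul hf

section SL

variable {a b : ℝ} {p q : ℝ → ℝ}

lemma Smooth.contOn (f : Smooth a b) : ContinuousOn (f : ℝ → ℝ) (Icc a b) := f.2.continuousOn

lemma Smooth.D_contOn (hab : a < b) (f : Smooth a b) : ContinuousOn (D a b f) (Icc a b) :=
  (D_smooth hab f.2).continuousOn

lemma Smooth.D_add (hab : a < b) (f g : Smooth a b) {z : ℝ} (hz : z ∈ Icc a b) :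
    D a b (f + g : Smooth a b) z = D a b f z + D a b g z :=
  LiquidBridge.D_add hab f.2 g.2 hz

lemma Smooth.D_smul (hab : a < b) (c : ℝ) (f : Smooth a b) {z : ℝ} (hz : z ∈ Icc a b) :
    D a b (c • f : Smooth a b) z = c * D a b f z :=
  LiquidBridge.D_const_mul hab c f.2 hz

/-- The `L²` product `∫ f g` on `[a, b]`. -/
def ip (hab : a < b) : LinearMap.BilinForm ℝ (Smooth a b) :=
  LinearMap.mk₂ ℝ (fun f g => ∫ z in a..b, (f : ℝ → ℝ) z * (g : ℝ → ℝ) z)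
    (fun f₁ f₂ g => by
      have h₁ := intervalIntegrable_of_contOn hab.le (ContinuousOn.fun_mul (Smooth.contOn f₁) (Smooth.contOn g))
      have h₂ := intervalIntegrable_of_contOn hab.le (ContinuousOn.fun_mul (Smooth.contOn f₂) (Smooth.contOn g))
      rw [← intervalIntegral.integral_add h₁ h₂]
      exact integral_congr_Icc hab.le fun z _ => by simp [add_mul])
    (fun c f g => by
      rw [smul_eq_mul, ← intervalIntegral.integral_const_mul]
      exact integral_congr_Icc hab.le fun z _ => by simp [mul_assoc])
    (fun f g₁ g₂ => by
      have h₁ := intervalIntegrable_of_contOn hab.le (ContinuousOn.fun_mul (Smooth.contOn f) (Smooth.contOn g₁))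
      have h₂ := intervalIntegrable_of_contOn hab.le (ContinuousOn.fun_mul (Smooth.contOn f) (Smooth.contOn g₂))
      rw [← intervalIntegral.integral_add h₁ h₂]
      exact integral_congr_Icc hab.le fun z _ => by simp [mul_add])
    (fun c f g => by
      rw [smul_eq_mul, ← intervalIntegral.integral_const_mul]
      exact integral_congr_Icc hab.le fun z _ => by simp [mul_left_comm])

lemma ip_apply (hab : a < b) (f g : Smooth a b) :
    ip hab f g = ∫ z in a..b, (f : ℝ → ℝ) z * (g : ℝ → ℝ) z := rfl

lemma ip_comm (hab : a < b) (f g : Smooth a b) : ip hab f g = ip hab g f := by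
  simp only [ip_apply, mul_comm]

lemma ip_self_nonneg (hab : a < b) (f : Smooth a b) : 0 ≤ ip hab f f :=
  intervalIntegral.integral_nonneg hab.le fun _ _ => mul_self_nonneg _

lemma ip_self_pos (hab : a < b) {f : Smooth a b} {z : ℝ} (hz : z ∈ Icc a b)
    (h : (f : ℝ → ℝ) z ≠ 0) : 0 < ip hab f f := by
  by_contra hle
  exact h (eq_zero_of_integral_sq_le hab (Smooth.contOn f) (not_lt.1 hle) z hz)

lemma ip_congr_left (hab : a < b) {f f' : Smooth a b}
    (h : ∀ z ∈ Icc a b, (f : ℝ → ℝ) z = (f' : ℝ → ℝ) z) (g : Smooth a b) :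
    ip hab f g = ip hab f' g :=
  integral_congr_Icc hab.le fun z hz => by rw [h z hz]

/-- The quadratic form `∫ p f' g' - q f g` of the operator `f ↦ (p f')' + q f`. -/
def form (h : IsRegular a b p q) : LinearMap.BilinForm ℝ (Smooth a b) :=
  have hint : ∀ f g : Smooth a b, IntervalIntegrable
      (fun z => p z * D a b f z * D a b g z - q z * (f : ℝ → ℝ) z * (g : ℝ → ℝ) z) volume a b :=
    fun f g => intervalIntegrable_of_contOn h.lt.le
      (((h.smooth_p.continuousOn.mul (Smooth.D_contOn h.lt f)).mul (Smooth.D_contOn h.lt g)).sub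
        ((h.smooth_q.continuousOn.mul (Smooth.contOn f)).mul (Smooth.contOn g)))
  LinearMap.mk₂ ℝ (fun f g => ∫ z in a..b,
      (p z * D a b f z * D a b g z - q z * (f : ℝ → ℝ) z * (g : ℝ → ℝ) z))
    (fun f₁ f₂ g => by
      rw [← intervalIntegral.integral_add (hint f₁ g) (hint f₂ g)]
      refine integral_congr_Icc h.lt.le fun z hz => ?_
      rw [Smooth.D_add h.lt f₁ f₂ hz]
      simp only [Submodule.coe_add, Pi.add_apply]
      ring)
    (fun c f g => by
      rw [smul_eq_mul, ← intervalIntegral.integral_const_mul]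
      refine integral_congr_Icc h.lt.le fun z hz => ?_
      rw [Smooth.D_smul h.lt c f hz]
      simp only [Submodule.coe_smul, Pi.smul_apply, smul_eq_mul]
      ring)
    (fun f g₁ g₂ => by
      rw [← intervalIntegral.integral_add (hint f g₁) (hint f g₂)]
      refine integral_congr_Icc h.lt.le fun z hz => ?_
      rw [Smooth.D_add h.lt g₁ g₂ hz]
      simp only [Submodule.coe_add, Pi.add_apply]
      ring)
    (fun c f g => by
      rw [smul_eq_mul, ← intervalIntegral.integral_const_mul]
      refine integral_congr_Icc h.lt.le fun z hz => ?_
      rw [Smooth.D_smul h.lt c g hz]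
      simp only [Submodule.coe_smul, Pi.smul_apply, smul_eq_mul]
      ring)

lemma form_apply (h : IsRegular a b p q) (f g : Smooth a b) :
    form h f g = ∫ z in a..b,
      (p z * D a b f z * D a b g z - q z * (f : ℝ → ℝ) z * (g : ℝ → ℝ) z) := rfl

lemma form_comm (h : IsRegular a b p q) (f g : Smooth a b) : form h f g = form h g f := by
  simp only [form_apply, mul_right_comm]

lemma flux_smooth (h : IsRegular a b p q) (f : Smooth a b) :
    ContDiffOn ℝ ∞ (fun s => p s * D a b f s) (Icc a b) :=
  h.smooth_p.mul (D_smooth h.lt f.2)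

lemma slOp_smooth (h : IsRegular a b p q) (f : Smooth a b) :
    ContDiffOn ℝ ∞ (slOp a b p q f) (Icc a b) :=
  (D_smooth h.lt (flux_smooth h f)).add (h.smooth_q.mul f.2)

lemma slOp_add (h : IsRegular a b p q) (f g : Smooth a b) {z : ℝ} (hz : z ∈ Icc a b) :
    slOp a b p q (f + g : Smooth a b) z = slOp a b p q f z + slOp a b p q g z := by
  have h1 : D a b (fun s => p s * D a b (f + g : Smooth a b) s) z =
      D a b (fun s => p s * D a b f s + p s * D a b g s) z :=
    D_congr (fun s hs => by rw [Smooth.D_add h.lt f g hs, mul_add]) hz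
  unfold slOp
  rw [h1, LiquidBridge.D_add h.lt (flux_smooth h f) (flux_smooth h g) hz]
  simp only [Submodule.coe_add, Pi.add_apply]
  ring

lemma slOp_smul (h : IsRegular a b p q) (c : ℝ) (f : Smooth a b) {z : ℝ} (hz : z ∈ Icc a b) :
    slOp a b p q (c • f : Smooth a b) z = c * slOp a b p q f z := by
  have h1 : D a b (fun s => p s * D a b (c • f : Smooth a b) s) z =
      D a b (fun s => c * (p s * D a b f s)) z :=
    D_congr (fun s hs => by rw [Smooth.D_smul h.lt c f hs, mul_left_comm]) hz
  unfold slOp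
  rw [h1, LiquidBridge.D_const_mul h.lt c (flux_smooth h f) hz]
  simp only [Submodule.coe_smul, Pi.smul_apply, smul_eq_mul]
  ring

/-- Green's formula. -/
lemma form_eq (h : IsRegular a b p q) (f g : Smooth a b) :
    form h f g = p b * D a b f b * (g : ℝ → ℝ) b - p a * D a b f a * (g : ℝ → ℝ) a
      - ∫ z in a..b, (g : ℝ → ℝ) z * slOp a b p q f z := by
  have h1 := integral_D h.lt ((flux_smooth h f).mul g.2)
  rw [form_apply, ← h1, ← intervalIntegral.integral_sub]
  · refine integral_congr_Icc h.lt.le fun z hz => ?_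
    have := D_mul h.lt (flux_smooth h f) g.2 hz
    change _ = D a b (fun s => p s * D a b f s * (g : ℝ → ℝ) s) z - _
    rw [this]
    unfold slOp
    ring
  · exact intervalIntegrable_of_contOn h.lt.le
      (D_smooth h.lt ((flux_smooth h f).mul g.2)).continuousOn
  · exact intervalIntegrable_of_contOn h.lt.le
      ((Smooth.contOn g).mul (slOp_smooth h f).continuousOn)

/-- The Neumann boundary conditions at both ends. -/
def IsNeumann (a b : ℝ) (f : ℝ → ℝ) : Prop := D a b f a = 0 ∧ D a b f b = 0

lemma IsNeumann.add (hab : a < b) {f g : Smooth a b} (hf : IsNeumann a b f)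
    (hg : IsNeumann a b g) : IsNeumann a b (f + g : Smooth a b) := by
  constructor
  · rw [Smooth.D_add hab f g (left_mem_Icc.2 hab.le), hf.1, hg.1, add_zero]
  · rw [Smooth.D_add hab f g (right_mem_Icc.2 hab.le), hf.2, hg.2, add_zero]

lemma IsNeumann.smul (hab : a < b) (c : ℝ) {f : Smooth a b} (hf : IsNeumann a b f) :
    IsNeumann a b (c • f : Smooth a b) := by
  constructor
  · rw [Smooth.D_smul hab c f (left_mem_Icc.2 hab.le), hf.1, mul_zero]
  · rw [Smooth.D_smul hab c f (right_mem_Icc.2 hab.le), hf.2, mul_zero]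

lemma form_of_neumann (h : IsRegular a b p q) {f g : Smooth a b} (hf : IsNeumann a b f)
    (heq : ∀ z ∈ Icc a b, slOp a b p q f z = (g : ℝ → ℝ) z) (k : Smooth a b) :
    form h f k = - ip h.lt g k := by
  rw [form_eq, hf.1, hf.2, ip_apply]
  have : ∫ z in a..b, (k : ℝ → ℝ) z * slOp a b p q f z =
      ∫ z in a..b, (g : ℝ → ℝ) z * (k : ℝ → ℝ) z :=
    integral_congr_Icc h.lt.le fun z hz => by rw [heq z hz, mul_comm]
  rw [this]
  ring

/-- The initial value problem at the left end point. -/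
lemma exists_ivp (h : IsRegular a b p q) (g : Smooth a b) (α β : ℝ) :
    ∃ y : Smooth a b, (y : ℝ → ℝ) a = α ∧ p a * D a b y a = β ∧
      ∀ z ∈ Icc a b, slOp a b p q y z = (g : ℝ → ℝ) z := by
  have hp0 : ∀ z ∈ Icc a b, p z ≠ 0 := fun z hz => (h.pos z hz).ne'
  have hr : ContDiffOn ℝ ∞ (fun z => (p z)⁻¹) (Icc a b) := h.smooth_p.inv hp0
  obtain ⟨x, hx0, hx⟩ := exists_linear_system h.lt.le hr.continuousOn h.smooth_q.continuousOn
    (Smooth.contOn g) (α, β)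
  have hxs : ContDiffOn ℝ ∞ x (Icc a b) := by
    refine ODE.contDiffOn_enat_Icc_of_hasDerivWithinAt (n := ⊤) (u := univ)
      (f := fun t x => ((p t)⁻¹ * x.2, (g : ℝ → ℝ) t - q t * x.1)) ?_ hx (mapsTo_univ _ _)
    have hm : MapsTo (Prod.fst : ℝ × ℝ × ℝ → ℝ) (Icc a b ×ˢ univ) (Icc a b) := fun t ht => ht.1
    have h1 := hr.comp contDiffOn_fst hm
    have h2 := h.smooth_q.comp contDiffOn_fst hm
    have h3 := g.2.comp contDiffOn_fst hm
    have h4 : ContDiffOn ℝ ∞ (fun t : ℝ × ℝ × ℝ => t.2.1) (Icc a b ×ˢ univ) :=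
      (contDiff_fst.comp contDiff_snd).contDiffOn
    have h5 : ContDiffOn ℝ ∞ (fun t : ℝ × ℝ × ℝ => t.2.2) (Icc a b ×ˢ univ) :=
      (contDiff_snd.comp contDiff_snd).contDiffOn
    exact (h1.mul h5).prodMk (h3.sub (h2.mul h4))
  have hy : ∀ z ∈ Icc a b, HasDerivWithinAt (fun t => (x t).1) ((p z)⁻¹ * (x z).2) (Icc a b) z :=
    fun z hz => (ContinuousLinearMap.fst ℝ ℝ ℝ).hasFDerivAt.comp_hasDerivWithinAt z (hx z hz)
  have hv : ∀ z ∈ Icc a b, HasDerivWithinAt (fun t => (x t).2)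
      ((g : ℝ → ℝ) z - q z * (x z).1) (Icc a b) z :=
    fun z hz => (ContinuousLinearMap.snd ℝ ℝ ℝ).hasFDerivAt.comp_hasDerivWithinAt z (hx z hz)
  have hpD : ∀ z ∈ Icc a b, p z * D a b (fun t => (x t).1) z = (x z).2 := fun z hz => by
    rw [D_eq h.lt hz (hy z hz), mul_inv_cancel_left₀ (hp0 z hz)]
  have haI := left_mem_Icc.2 h.lt.le
  refine ⟨⟨fun t => (x t).1, contDiff_fst.comp_contDiffOn hxs⟩, by simp [hx0], ?_, fun z hz => ?_⟩
  · rw [hpD a haI, hx0]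
  · change D a b (fun s => p s * D a b (fun t => (x t).1) s) z + q z * (x z).1 = _
    rw [D_congr hpD hz, D_eq h.lt hz (hv z hz)]
    ring

lemma ivp_estimate (h : IsRegular a b p q) :
    ∃ C : ℝ, 0 ≤ C ∧ ∀ y g : Smooth a b, (y : ℝ → ℝ) a = 0 → D a b y a = 0 →
      (∀ z ∈ Icc a b, slOp a b p q y z = (g : ℝ → ℝ) z) →
      ∀ z ∈ Icc a b, (y : ℝ → ℝ) z ^ 2 + (p z * D a b y z) ^ 2 ≤ C * ip h.lt g g := by
  have hp0 : ∀ z ∈ Icc a b, p z ≠ 0 := fun z hz => (h.pos z hz).ne'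
  obtain ⟨C, hC0, hC⟩ := energy_estimate h.lt.le (h.smooth_p.inv hp0).continuousOn
    h.smooth_q.continuousOn
  refine ⟨C, hC0, fun y g hya hDa hy z hz => ?_⟩
  have := hC g y (fun s => p s * D a b y s) (Smooth.contOn g) hya (by simp [hDa])
    (fun t ht => by
      refine (D_hasDeriv y.2 ht).congr_deriv ?_
      rw [Pi.inv_apply, inv_mul_cancel_left₀ (hp0 t ht)])
    (fun t ht => by
      refine (D_hasDeriv (flux_smooth h y) ht).congr_deriv ?_
      rw [← hy t ht]
      unfold slOp
      ring) z hz
  simpa only [ip_apply, ← pow_two] using this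

lemma ivp_unique (h : IsRegular a b p q) {y : Smooth a b} (hya : (y : ℝ → ℝ) a = 0)
    (hDa : D a b y a = 0) (hy : ∀ z ∈ Icc a b, slOp a b p q y z = 0) :
    ∀ z ∈ Icc a b, (y : ℝ → ℝ) z = 0 := by
  obtain ⟨C, -, hC⟩ := ivp_estimate h
  intro z hz
  have := hC y 0 hya hDa hy z hz
  rw [map_zero, mul_zero] at this
  nlinarith [sq_nonneg ((y : ℝ → ℝ) z), sq_nonneg (p z * D a b y z)]

/-- Solutions of the homogeneous Neumann problem. -/
def IsNull (a b : ℝ) (p q f : ℝ → ℝ) : Prop :=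
  IsNeumann a b f ∧ ∀ z ∈ Icc a b, slOp a b p q f z = 0

/-- A solution with vanishing derivative at `a` is a multiple of any other one that does not vanish
at `a`. -/
lemma ivp_proportional (h : IsRegular a b p q) {e y : Smooth a b}
    (he : D a b e a = 0) (he' : ∀ z ∈ Icc a b, slOp a b p q e z = 0)
    (hy : D a b y a = 0) (hy' : ∀ z ∈ Icc a b, slOp a b p q y z = 0) (hy1 : (y : ℝ → ℝ) a ≠ 0) :
    ∀ z ∈ Icc a b, (e : ℝ → ℝ) z = ((e : ℝ → ℝ) a / (y : ℝ → ℝ) a) * (y : ℝ → ℝ) z := by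
  set c := (e : ℝ → ℝ) a / (y : ℝ → ℝ) a with hc
  have haI := left_mem_Icc.2 h.lt.le
  intro z hz
  have := ivp_unique h (y := e + (-c) • y)
    (by simp [hc, div_mul_cancel₀ _ hy1])
    (by rw [Smooth.D_add h.lt _ _ haI, Smooth.D_smul h.lt _ _ haI, he, hy]; ring)
    (fun z hz => by rw [slOp_add h _ _ hz, slOp_smul h _ _ hz, he' z hz, hy' z hz]; ring) z hz
  simp only [Submodule.coe_add, Submodule.coe_smul, Pi.add_apply, Pi.smul_apply, smul_eq_mul]
    at this
  linarith

/-- The Fredholm alternative for the Neumann problem with a uniform `L²` bound on the solution. The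
problem is solved by shooting from the left end point. -/
lemma exists_neumann_solution (h : IsRegular a b p q) :
    ∃ C : ℝ, 0 ≤ C ∧ ∀ g : Smooth a b, (∀ e : Smooth a b, IsNull a b p q e → ip h.lt g e = 0) →
      ∃ w : Smooth a b, IsNeumann a b w ∧ (∀ z ∈ Icc a b, slOp a b p q w z = (g : ℝ → ℝ) z) ∧
        (∀ e : Smooth a b, IsNull a b p q e → ip h.lt w e = 0) ∧
        ip h.lt w w ≤ C * ip h.lt g g := by
  have hab := h.lt
  have haI := left_mem_Icc.2 hab.le
  have hbI := right_mem_Icc.2 hab.le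
  have hpa := (h.pos a haI).ne'
  have hpb := (h.pos b hbI).ne'
  obtain ⟨C, hC0, hC⟩ := ivp_estimate h
  obtain ⟨y, hya, hDya, hy⟩ := exists_ivp h 0 1 0
  have hDy : D a b y a = 0 := (mul_eq_zero.1 hDya).resolve_left hpa
  have hyL : ∀ z ∈ Icc a b, slOp a b p q y z = 0 := hy
  have hprop : ∀ e : Smooth a b, IsNull a b p q e →
      ∀ z ∈ Icc a b, (e : ℝ → ℝ) z = ((e : ℝ → ℝ) a • y : Smooth a b).1 z := by
    intro e he z hz
    have := ivp_proportional h he.1.1 he.2 hDy hyL (by rw [hya]; exact one_ne_zero) z hz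
    rwa [hya, div_one] at this
  have hvv : ∀ v g : Smooth a b, (v : ℝ → ℝ) a = 0 → D a b v a = 0 →
      (∀ z ∈ Icc a b, slOp a b p q v z = (g : ℝ → ℝ) z) →
      ip hab v v ≤ (b - a) * C * ip hab g g := by
    intro v g hva hDv hv
    have h1 : ip hab v v ≤ ∫ z in a..b, C * ip hab g g := by
      rw [ip_apply]
      refine intervalIntegral.integral_mono_on hab.le
        (intervalIntegrable_of_contOn hab.le ((Smooth.contOn v).mul (Smooth.contOn v))) intervalIntegrable_const
        fun z hz => ?_
      have := hC v g hva hDv hv z hz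
      nlinarith [sq_nonneg (p z * D a b v z)]
    rw [intervalIntegral.integral_const, smul_eq_mul] at h1
    linarith
  by_cases hyb : D a b y b = 0
  · -- `y` spans the null space; solvability comes from Lagrange's identity
    have hyN : IsNull a b p q y := ⟨⟨hDy, hyb⟩, hyL⟩
    have hyb0 : (y : ℝ → ℝ) b ≠ 0 := by
      intro h0
      obtain ⟨y₂, hy₂a, hDy₂a, hy₂⟩ := exists_ivp h 0 0 1
      have h1 := form_eq h y₂ y
      have h2 := form_of_neumann h (g := 0) hyN.1 hyL y₂
      rw [form_comm, h2, map_zero, hDy₂a, hya, h0] at h1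
      have h3 : ∫ z in a..b, (y : ℝ → ℝ) z * slOp a b p q y₂ z = 0 := by
        rw [integral_congr_Icc (g := fun _ => 0) hab.le fun z hz => by rw [hy₂ z hz]; simp]
        simp
      rw [h3] at h1
      simp at h1
    have hyy : 0 < ip hab y y := ip_self_pos hab hbI hyb0
    refine ⟨(b - a) * C, mul_nonneg (sub_nonneg.2 hab.le) hC0, fun g hg => ?_⟩
    obtain ⟨v, hva, hDva, hv⟩ := exists_ivp h g 0 0
    have hDv : D a b v a = 0 := (mul_eq_zero.1 hDva).resolve_left hpa
    have hDvb : D a b v b = 0 := by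
      have h1 := form_eq h v y
      have h2 := form_of_neumann h (g := 0) hyN.1 hyL v
      have h3 : ∫ z in a..b, (y : ℝ → ℝ) z * slOp a b p q v z = ip hab g y :=
        integral_congr_Icc hab.le fun z hz => by rw [hv z hz, mul_comm]
      rw [form_comm, h2, h3, hg y hyN, hDv] at h1
      simp only [map_zero, LinearMap.zero_apply, mul_zero, zero_mul, sub_zero, neg_zero] at h1
      rcases mul_eq_zero.1 h1.symm with h4 | h4
      · exact (mul_eq_zero.1 h4).resolve_left hpb
      · exact absurd h4 hyb0
    set t := -(ip hab v y / ip hab y y) with ht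
    have hty : ip hab (v + t • y) y = 0 := by
      simp only [map_add, map_smul, LinearMap.add_apply, LinearMap.smul_apply, smul_eq_mul, ht]
      field_simp
      ring
    refine ⟨v + t • y, IsNeumann.add hab ⟨hDv, hDvb⟩ (IsNeumann.smul hab t ⟨hDy, hyb⟩),
      fun z hz => ?_, fun e he => ?_, ?_⟩
    · rw [slOp_add h _ _ hz, slOp_smul h _ _ hz, hyL z hz, hv z hz]; ring
    · rw [ip_comm, ip_congr_left hab (hprop e he), ip_comm, map_smul, hty, smul_zero]
    · have h1 : ip hab (v + t • y) (v + t • y) = ip hab (v + t • y) v := by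
        rw [map_add, map_smul, hty, smul_zero, add_zero]
      have h2 : ip hab (v + t • y) v = ip hab v v - ip hab v y ^ 2 / ip hab y y := by
        simp only [map_add, map_smul, LinearMap.add_apply, LinearMap.smul_apply, smul_eq_mul, ht]
        rw [ip_comm hab y v]
        ring
      have h3 : 0 ≤ ip hab v y ^ 2 / ip hab y y := by positivity
      rw [h1, h2]
      linarith [hvv v g hva hDv hv]
  · -- there is no null solution, and the derivative at `b` can be corrected by a multiple of `y`
    set d := p b * D a b y b with hd
    have hd0 : d ≠ 0 := mul_ne_zero hpb hyb
    have hyy := ip_self_nonneg hab y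
    refine ⟨2 * ((b - a) * C) + 2 * (C / d ^ 2) * ip hab y y, ?_, fun g _ => ?_⟩
    · have := sub_nonneg.2 hab.le
      positivity
    obtain ⟨v, hva, hDva, hv⟩ := exists_ivp h g 0 0
    have hDv : D a b v a = 0 := (mul_eq_zero.1 hDva).resolve_left hpa
    set t := -((p b * D a b v b) / d) with ht
    have hNb : D a b (v + t • y : Smooth a b) b = 0 := by
      rw [Smooth.D_add hab _ _ hbI, Smooth.D_smul hab _ _ hbI, ht, hd]
      field_simp
      ring
    refine ⟨v + t • y, ⟨?_, hNb⟩, fun z hz => ?_, fun e he => ?_, ?_⟩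
    · rw [Smooth.D_add hab _ _ haI, Smooth.D_smul hab _ _ haI, hDv, hDy]; ring
    · rw [slOp_add h _ _ hz, slOp_smul h _ _ hz, hyL z hz, hv z hz]; ring
    · have he0 : (e : ℝ → ℝ) a = 0 := by
        have h1 : D a b e b = (e : ℝ → ℝ) a * D a b y b := by
          rw [D_congr (hprop e he) hbI]
          exact Smooth.D_smul hab _ _ hbI
        rw [he.1.2] at h1
        exact (mul_eq_zero.1 h1.symm).resolve_right hyb
      rw [ip_comm, ip_congr_left hab (hprop e he), he0, zero_smul, map_zero, LinearMap.zero_apply]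
    · have h1 : ip hab (v + t • y) (v + t • y) + ip hab (v - t • y) (v - t • y) =
          2 * ip hab v v + 2 * t ^ 2 * ip hab y y := by
        simp only [map_add, map_sub, map_smul, LinearMap.add_apply, LinearMap.sub_apply,
          LinearMap.smul_apply, smul_eq_mul]
        ring
      have h2 := ip_self_nonneg hab (v - t • y)
      have h3 := hvv v g hva hDv hv
      have h4 : t ^ 2 ≤ C / d ^ 2 * ip hab g g := by
        have h5 := hC v g hva hDv hv b hbI
        have h6 : (p b * D a b v b) ^ 2 ≤ C * ip hab g g := by
          nlinarith [sq_nonneg ((v : ℝ → ℝ) b)]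
        rw [ht, neg_sq, div_pow, div_mul_eq_mul_div]
        exact div_le_div_of_nonneg_right h6 (sq_nonneg d)
      have h5 := mul_le_mul_of_nonneg_right h4 hyy
      nlinarith

end SL

/-! ### The two lowest eigenvalues -/

section Spectrum

variable {a b : ℝ} {p q : ℝ → ℝ}

lemma IsRegular.shift (h : IsRegular a b p q) (l : ℝ) : IsRegular a b p (fun z => q z + l) :=
  ⟨h.lt, h.smooth_p, h.smooth_q.add contDiffOn_const, h.pos⟩

lemma form_shift (h : IsRegular a b p q) (l : ℝ) (f g : Smooth a b) :
    form (h.shift l) f g = form h f g - l * ip h.lt f g := by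
  rw [form_apply, form_apply, ip_apply, ← intervalIntegral.integral_const_mul,
    ← intervalIntegral.integral_sub]
  · refine integral_congr_Icc h.lt.le fun z _ => ?_
    ring
  · exact intervalIntegrable_of_contOn h.lt.le
      (((h.smooth_p.continuousOn.mul (Smooth.D_contOn h.lt f)).mul (Smooth.D_contOn h.lt g)).sub
        ((h.smooth_q.continuousOn.mul (Smooth.contOn f)).mul (Smooth.contOn g)))
  · exact intervalIntegrable_of_contOn h.lt.le
      (continuousOn_const.mul ((Smooth.contOn f).mul (Smooth.contOn g)))

lemma form_of_null (h : IsRegular a b p q) {l : ℝ} {e : Smooth a b}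
    (he : IsNull a b p (fun z => q z + l) e) (f : Smooth a b) :
    form h e f = l * ip h.lt e f := by
  have h1 := form_of_neumann (h.shift l) (g := 0) he.1 he.2 f
  rw [form_shift h, map_zero, LinearMap.zero_apply, neg_zero] at h1
  linarith

lemma ip_eq_zero_of_null (h : IsRegular a b p q) {l m : ℝ} {e f : Smooth a b}
    (he : IsNull a b p (fun z => q z + l) e) (hf : IsNull a b p (fun z => q z + m) f)
    (hlm : l ≠ m) : ip h.lt e f = 0 := by
  have h1 := form_of_null h he f
  have h2 := form_of_null h hf e
  rw [form_comm h f e, ip_comm h.lt f e] at h2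
  have h3 : (l - m) * ip h.lt e f = 0 := by linarith
  exact (mul_eq_zero.1 h3).resolve_left (sub_ne_zero.2 hlm)

/-- A nonzero solution of the homogeneous problem does not vanish at the left end point. -/
lemma IsNull.left_ne_zero (h : IsRegular a b p q) {e : Smooth a b} (he : IsNull a b p q e)
    (hne : ∃ z ∈ Icc a b, (e : ℝ → ℝ) z ≠ 0) : (e : ℝ → ℝ) a ≠ 0 := by
  intro h0
  obtain ⟨z, hz, hz0⟩ := hne
  exact hz0 (ivp_unique h h0 he.1.1 he.2 z hz)

/-- Eigenvalues are simple. -/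
lemma IsNull.proportional (h : IsRegular a b p q) {e y : Smooth a b} (he : IsNull a b p q e)
    (hy : IsNull a b p q y) (hne : ∃ z ∈ Icc a b, (y : ℝ → ℝ) z ≠ 0) :
    ∃ c : ℝ, ∀ z ∈ Icc a b, (e : ℝ → ℝ) z = (c • y : Smooth a b).1 z :=
  ⟨_, ivp_proportional h he.1.1 he.2 hy.1.1 hy.2 (hy.left_ne_zero h hne)⟩

/-- If the quadratic form is nonnegative on a subspace and the Neumann problem is solvable there
with an `L²` bound, then the form is bounded below by a positive multiple of the `L²` norm. To see
this, evaluate the form at `f + t w`, where `w` solves the problem with right-hand side `f`. -/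
lemma form_coercive (h : IsRegular a b p q) (M : Submodule ℝ (Smooth a b))
    (hnn : ∀ f ∈ M, 0 ≤ form h f f) {C : ℝ} (hC : 0 ≤ C)
    (hsol : ∀ f ∈ M, ∃ w ∈ M, IsNeumann a b w ∧
      (∀ z ∈ Icc a b, slOp a b p q w z = (f : ℝ → ℝ) z) ∧ ip h.lt w w ≤ C * ip h.lt f f) :
    ∀ f ∈ M, 2 / (C + 1) * ip h.lt f f ≤ form h f f := by
  intro f hf
  obtain ⟨w, hwM, hwN, hw, hwC⟩ := hsol f hf
  set t := 2 / (C + 1) with ht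
  have h1 := hnn (f + t • w) (M.add_mem hf (M.smul_mem t hwM))
  have h2 : form h (f + t • w) (f + t • w) =
      form h f f + 2 * t * form h w f + t ^ 2 * form h w w := by
    simp only [map_add, map_smul, LinearMap.add_apply, LinearMap.smul_apply, smul_eq_mul]
    rw [form_comm h f w]
    ring
  have h3 := ip_self_nonneg h.lt (f + w)
  have h4 : ip h.lt (f + w) (f + w) = ip h.lt f f + 2 * ip h.lt f w + ip h.lt w w := by
    simp only [map_add, LinearMap.add_apply]
    rw [ip_comm h.lt w f]
    ring
  rw [h2, form_of_neumann h hwN hw, form_of_neumann h hwN hw] at h1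
  have h5 : -ip h.lt f w ≤ (C + 1) / 2 * ip h.lt f f := by linarith
  have h6 : t ^ 2 * -ip h.lt f w ≤ t ^ 2 * ((C + 1) / 2 * ip h.lt f f) :=
    mul_le_mul_of_nonneg_left h5 (sq_nonneg t)
  have h7 : t ^ 2 * ((C + 1) / 2 * ip h.lt f f) = t * ip h.lt f f := by
    rw [ht]
    field_simp
  linarith

/-- The complement of a single function is nontrivial, so that the infimum of the Rayleigh quotient
over it is taken over a nonempty set. -/
lemma exists_orthogonal (hab : a < b) (φ : Smooth a b) :
    ∃ f : Smooth a b, ip hab φ f = 0 ∧ 0 < ip hab f f := by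
  have haI := left_mem_Icc.2 hab.le
  have hbI := right_mem_Icc.2 hab.le
  let u : Smooth a b := ⟨fun _ => 1, contDiffOn_const⟩
  let v : Smooth a b := ⟨fun z => z, contDiffOn_id⟩
  by_cases h0 : ip hab φ u = 0
  · exact ⟨u, h0, ip_self_pos hab haI (f := u) one_ne_zero⟩
  · set f := ip hab φ v • u - ip hab φ u • v with hf
    have hfz : ∀ z, (f : ℝ → ℝ) z = ip hab φ v - ip hab φ u * z := fun z => by
      simp [hf, u, v]
    refine ⟨f, by rw [hf, map_sub, map_smul, map_smul, smul_eq_mul, smul_eq_mul]; ring, ?_⟩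
    by_cases h1 : (f : ℝ → ℝ) a = 0
    · refine ip_self_pos hab hbI fun h2 => h0 ?_
      rw [hfz] at h1 h2
      have h3 : ip hab φ u * (b - a) = 0 := by linarith
      exact (mul_eq_zero.1 h3).resolve_right (sub_ne_zero.2 hab.ne')
    · exact ip_self_pos hab haI h1

/-- Minimization of the Rayleigh quotient on the orthogonal complement of `φ`, where `φ` is either
zero or an eigenfunction: the infimum is an eigenvalue. Otherwise the Neumann problem shifted by the
infimum would be solvable on the complement, and `form_coercive` would give a larger lower bound. -/
lemma exists_lowest_eigenvalue (h : IsRegular a b p q) {φ : Smooth a b} {l : ℝ}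
    (hφ : IsNull a b p (fun z => q z + l) φ) :
    ∃ (m : ℝ) (ψ : Smooth a b), IsNull a b p (fun z => q z + m) ψ ∧
      (∃ z ∈ Icc a b, (ψ : ℝ → ℝ) z ≠ 0) ∧ ip h.lt φ ψ = 0 ∧
      ∀ f : Smooth a b, ip h.lt φ f = 0 → m * ip h.lt f f ≤ form h f f := by
  have hab := h.lt
  set M : Submodule ℝ (Smooth a b) := LinearMap.ker (ip hab φ) with hM
  have hmem : ∀ f : Smooth a b, f ∈ M ↔ ip hab φ f = 0 := fun f => LinearMap.mem_ker
  set S : Set ℝ := {m | ∀ f ∈ M, m * ip hab f f ≤ form h f f} with hS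
  have hne : S.Nonempty := by
    obtain ⟨Q, hQ⟩ := isCompact_Icc.exists_bound_of_continuousOn h.smooth_q.continuousOn
    refine ⟨-Q, fun f _ => ?_⟩
    rw [ip_apply, form_apply, ← intervalIntegral.integral_const_mul]
    refine intervalIntegral.integral_mono_on hab.le ?_ ?_ fun z hz => ?_
    · exact intervalIntegrable_of_contOn hab.le
        (continuousOn_const.mul ((Smooth.contOn f).mul (Smooth.contOn f)))
    · exact intervalIntegrable_of_contOn h.lt.le
        (((h.smooth_p.continuousOn.mul (Smooth.D_contOn h.lt f)).mul (Smooth.D_contOn h.lt f)).sub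
          ((h.smooth_q.continuousOn.mul (Smooth.contOn f)).mul (Smooth.contOn f)))
    · have h1 := abs_le.1 (hQ z hz)
      have h2 : 0 ≤ p z * D a b f z * D a b f z := by
        rw [mul_assoc]
        exact mul_nonneg (h.pos z hz).le (mul_self_nonneg _)
      nlinarith [mul_self_nonneg ((f : ℝ → ℝ) z)]
  have hbdd : BddAbove S := by
    obtain ⟨f₀, hf₀, hpos⟩ := exists_orthogonal hab φ
    exact ⟨form h f₀ f₀ / ip hab f₀ f₀, fun m hm => (le_div_iff₀ hpos).2 (hm f₀ ((hmem _).2 hf₀))⟩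
  set m := sSup S with hm
  have hmS : m ∈ S := by
    intro f hf
    rcases (ip_self_nonneg hab f).eq_or_lt with h0 | h0
    · obtain ⟨m', hm'⟩ := hne
      have := hm' f hf
      rw [← h0, mul_zero] at this ⊢
      exact this
    · rw [← le_div_iff₀ h0]
      exact csSup_le hne fun m' hm' => (le_div_iff₀ h0).2 (hm' f hf)
  by_contra hcon
  have hno : ∀ ψ : Smooth a b, IsNull a b p (fun z => q z + m) ψ → ip hab φ ψ = 0 →
      ∀ z ∈ Icc a b, (ψ : ℝ → ℝ) z = 0 := by
    intro ψ hψ hψφ z hz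
    by_contra hz0
    exact hcon ⟨m, ψ, hψ, ⟨z, hz, hz0⟩, hψφ, fun f hf => hmS f ((hmem f).2 hf)⟩
  have hnull : ∀ f ∈ M, ∀ e : Smooth a b, IsNull a b p (fun z => q z + m) e → ip hab f e = 0 := by
    intro f hf e he
    by_cases h0 : ip hab φ e = 0
    · rw [ip_comm, ip_congr_left hab (f' := 0) (hno e he h0), map_zero, LinearMap.zero_apply]
    · have hlm : l = m := by
        by_contra hlm
        exact h0 (ip_eq_zero_of_null h hφ he hlm)
      have hφne : ∃ z ∈ Icc a b, (φ : ℝ → ℝ) z ≠ 0 := by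
        by_contra hall
        push Not at hall
        exact h0 (by rw [ip_congr_left hab (f' := 0) hall, map_zero, LinearMap.zero_apply])
      obtain ⟨c, hc⟩ := he.proportional (h.shift m) (hlm ▸ hφ) hφne
      rw [ip_comm, ip_congr_left hab hc, map_smul, LinearMap.smul_apply, (hmem f).1 hf, smul_zero]
  obtain ⟨C, hC0, hC⟩ := exists_neumann_solution (h.shift m)
  have hco := form_coercive (h.shift m) M
    (fun f hf => by rw [form_shift h]; exact sub_nonneg.2 (hmS f hf)) hC0
    (fun f hf => by
      obtain ⟨w, hwN, hw, hwe, hwC⟩ := hC f (hnull f hf)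
      refine ⟨w, (hmem w).2 ?_, hwN, hw, hwC⟩
      by_cases hlm : l = m
      · rw [ip_comm]
        exact hwe φ (hlm ▸ hφ)
      · have h1 := form_of_null h hφ w
        have h2 := form_of_neumann (h.shift m) hwN hw φ
        rw [form_shift h, form_comm, h1, ip_comm hab w φ, ip_comm hab f φ, (hmem f).1 hf] at h2
        have h3 : (l - m) * ip hab φ w = 0 := by linarith
        exact (mul_eq_zero.1 h3).resolve_left (sub_ne_zero.2 hlm))
  have hpos : 0 < 2 / (C + 1) := by positivity
  have hmem' : m + 2 / (C + 1) ∈ S := fun f hf => by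
    have := hco f hf
    rw [form_shift h] at this
    linarith
  linarith [le_csSup hbdd hmem']

/-- Existence and variational characterization of the two lowest eigenvalues. -/
lemma exists_two_eigenvalues (h : IsRegular a b p q) :
    ∃ (m₁ m₂ : ℝ) (φ₁ φ₂ : Smooth a b),
      IsNull a b p (fun z => q z + m₁) φ₁ ∧ (∃ z ∈ Icc a b, (φ₁ : ℝ → ℝ) z ≠ 0) ∧
      IsNull a b p (fun z => q z + m₂) φ₂ ∧ (∃ z ∈ Icc a b, (φ₂ : ℝ → ℝ) z ≠ 0) ∧
      m₁ < m₂ ∧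
      (∀ f : Smooth a b, m₁ * ip h.lt f f ≤ form h f f) ∧
      (∀ f : Smooth a b, ip h.lt φ₁ f = 0 → m₂ * ip h.lt f f ≤ form h f f) ∧
      (∀ (l : ℝ) (ψ : Smooth a b), IsNull a b p (fun z => q z + l) ψ →
        (∃ z ∈ Icc a b, (ψ : ℝ → ℝ) z ≠ 0) → l = m₁ ∨ m₂ ≤ l) := by
  have hzero : IsNull a b p (fun z => q z + 0) (0 : Smooth a b) := by
    have h0 : ∀ z ∈ Icc a b, D a b (0 : Smooth a b) z = 0 := fun z hz => by
      have := Smooth.D_smul h.lt 0 (0 : Smooth a b) hz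
      rwa [zero_smul, zero_mul] at this
    refine ⟨⟨h0 a (left_mem_Icc.2 h.lt.le), h0 b (right_mem_Icc.2 h.lt.le)⟩, fun z hz => ?_⟩
    have := slOp_smul (h.shift 0) 0 (0 : Smooth a b) hz
    rwa [zero_smul, zero_mul] at this
  obtain ⟨m₁, φ₁, hφ₁, hne₁, -, hmin₁⟩ := exists_lowest_eigenvalue h hzero
  obtain ⟨m₂, φ₂, hφ₂, hne₂, horth, hmin₂⟩ := exists_lowest_eigenvalue h hφ₁
  have hmin₁' : ∀ f : Smooth a b, m₁ * ip h.lt f f ≤ form h f f := fun f =>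
    hmin₁ f (by rw [map_zero, LinearMap.zero_apply])
  have hpos : ∀ ψ : Smooth a b, (∃ z ∈ Icc a b, (ψ : ℝ → ℝ) z ≠ 0) → 0 < ip h.lt ψ ψ :=
    fun ψ ⟨z, hz, h0⟩ => ip_self_pos h.lt hz h0
  have hlt : m₁ < m₂ := by
    refine lt_of_le_of_ne ?_ ?_
    · have h1 := hmin₁' φ₂
      rw [form_of_null h hφ₂] at h1
      exact le_of_mul_le_mul_right h1 (hpos φ₂ hne₂)
    · rintro rfl
      obtain ⟨c, hc⟩ := hφ₁.proportional (h.shift m₁) hφ₂ hne₂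
      have h1 := horth
      rw [ip_congr_left h.lt hc, map_smul, LinearMap.smul_apply, smul_eq_mul] at h1
      rcases mul_eq_zero.1 h1 with h2 | h2
      · obtain ⟨z, hz, hz0⟩ := hne₁
        apply hz0
        rw [hc z hz, h2, zero_smul]
        rfl
      · exact (hpos φ₂ hne₂).ne' h2
  refine ⟨m₁, m₂, φ₁, φ₂, hφ₁, hne₁, hφ₂, hne₂, hlt, hmin₁', hmin₂, fun l ψ hψ hne => ?_⟩
  by_cases hl : l = m₁
  · exact Or.inl hl
  · right
    have h1 := hmin₂ ψ (ip_eq_zero_of_null h hφ₁ hψ (Ne.symm hl))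
    rw [form_of_null h hψ] at h1
    exact le_of_mul_le_mul_right h1 (hpos ψ hne)

/-! ### The quadratic form on the complement of a weight -/

/-- If the form is nonnegative on the complement of the first eigenfunction and `u` solves the
Neumann problem with right-hand side `κ` and `∫ u κ ≥ 0`, then the form is nonnegative on the
complement of `κ`: a negative direction `f` there is form-orthogonal to `u`, and the plane spanned
by `u` and `f` meets the complement of the first eigenfunction. -/
lemma form_nonneg_of_solution (h : IsRegular a b p q) {m₁ : ℝ} {φ₁ u κ : Smooth a b}
    (hφ₁ : IsNull a b p (fun z => q z + m₁) φ₁)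
    (hnn : ∀ f : Smooth a b, ip h.lt φ₁ f = 0 → 0 ≤ form h f f)
    (hu : IsNeumann a b u) (hu' : ∀ z ∈ Icc a b, slOp a b p q u z = (κ : ℝ → ℝ) z)
    (hκ : 0 < ip h.lt κ κ) (huκ : 0 ≤ ip h.lt u κ) :
    ∀ f : Smooth a b, ip h.lt κ f = 0 → 0 ≤ form h f f := by
  intro f hf
  by_contra! hneg
  have huf : form h u f = 0 := by rw [form_of_neumann h hu hu', hf, neg_zero]
  have huu : form h u u ≤ 0 := by
    rw [form_of_neumann h hu hu', ip_comm]
    linarith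
  have h1 := hnn (ip h.lt φ₁ f • u - ip h.lt φ₁ u • f)
    (by simp only [map_sub, map_smul, smul_eq_mul]; ring)
  have h2 : form h (ip h.lt φ₁ f • u - ip h.lt φ₁ u • f)
      (ip h.lt φ₁ f • u - ip h.lt φ₁ u • f) =
      ip h.lt φ₁ f ^ 2 * form h u u + ip h.lt φ₁ u ^ 2 * form h f f := by
    simp only [map_sub, map_smul, LinearMap.sub_apply, LinearMap.smul_apply, smul_eq_mul]
    rw [form_comm h f u, huf]
    ring
  rw [h2] at h1
  have h3 : ip h.lt φ₁ u = 0 := by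
    by_contra h0
    have h4 : ip h.lt φ₁ u ^ 2 * form h f f < 0 :=
      mul_neg_of_pos_of_neg (by positivity) hneg
    have h5 := mul_nonpos_of_nonneg_of_nonpos (sq_nonneg (ip h.lt φ₁ f)) huu
    linarith
  -- now `κ` is orthogonal to `φ₁` too, and the form becomes negative at `u + t κ` for small `t`
  have h4 : ip h.lt φ₁ κ = 0 := by
    have h5 := form_of_neumann h hu hu' φ₁
    rw [form_comm, form_of_null h hφ₁, h3, mul_zero] at h5
    rw [ip_comm]
    linarith
  set t := ip h.lt κ κ / (|form h κ κ| + 1) with ht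
  have hden : 0 < |form h κ κ| + 1 := by positivity
  have ht0 : 0 < t := div_pos hκ hden
  have h5 := hnn (u + t • κ)
    (by rw [map_add, map_smul, h3, h4, smul_zero, add_zero])
  have h6 : form h (u + t • κ) (u + t • κ) =
      form h u u + 2 * t * form h u κ + t ^ 2 * form h κ κ := by
    simp only [map_add, map_smul, LinearMap.add_apply, LinearMap.smul_apply, smul_eq_mul]
    rw [form_comm h κ u]
    ring
  rw [h6, form_of_neumann h hu hu' κ] at h5
  have h7 : t * (|form h κ κ| + 1) = ip h.lt κ κ := div_mul_cancel₀ _ hden.ne'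
  have h8 : t ^ 2 * form h κ κ ≤ t * ip h.lt κ κ := by
    rw [← h7]
    have := le_abs_self (form h κ κ)
    nlinarith [sq_nonneg t]
  nlinarith

/-- The test function is `φ₁ - c u`, with `c` chosen to make it orthogonal to `κ`. As
`form u f = -∫ κ f` for every `f`, the form takes there the value `m₁ ∫ φ₁² + c² ∫ u κ`. -/
lemma exists_neg_of_solution (h : IsRegular a b p q) {m₁ : ℝ} {φ₁ u κ : Smooth a b}
    (hφ₁ : IsNull a b p (fun z => q z + m₁) φ₁) (hpos : 0 < ip h.lt φ₁ φ₁) (hm₁ : m₁ < 0)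
    (hu : IsNeumann a b u) (hu' : ∀ z ∈ Icc a b, slOp a b p q u z = (κ : ℝ → ℝ) z)
    (huκ : ip h.lt u κ < 0) :
    ∃ f : Smooth a b, ip h.lt κ f = 0 ∧ form h f f < 0 := by
  set c := ip h.lt κ φ₁ / ip h.lt u κ with hc
  have hcu : c * ip h.lt u κ = ip h.lt κ φ₁ := div_mul_cancel₀ _ huκ.ne
  refine ⟨φ₁ - c • u, ?_, ?_⟩
  · rw [map_sub, map_smul, smul_eq_mul, ip_comm h.lt κ u, hcu, sub_self]
  · have h1 : form h (φ₁ - c • u) (φ₁ - c • u) =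
        form h φ₁ φ₁ - 2 * c * form h u φ₁ + c ^ 2 * form h u u := by
      simp only [map_sub, map_smul, LinearMap.sub_apply, LinearMap.smul_apply, smul_eq_mul]
      rw [form_comm h φ₁ u]
      ring
    rw [h1, form_of_null h hφ₁, form_of_neumann h hu hu', form_of_neumann h hu hu', ← hcu,
      ip_comm h.lt κ u]
    nlinarith [mul_neg_of_neg_of_pos hm₁ hpos,
      mul_nonpos_of_nonneg_of_nonpos (sq_nonneg c) huκ.le]

/-- The test function is `φ₁` corrected by a multiple of the null eigenfunction `e`, which restores
orthogonality to `κ` without changing the value of the form. -/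
lemma exists_neg_of_null (h : IsRegular a b p q) {m₁ : ℝ} {φ₁ e κ : Smooth a b}
    (hφ₁ : IsNull a b p (fun z => q z + m₁) φ₁) (hpos : 0 < ip h.lt φ₁ φ₁) (hm₁ : m₁ < 0)
    (he : IsNull a b p (fun z => q z + 0) e) (heκ : ip h.lt e κ ≠ 0) :
    ∃ f : Smooth a b, ip h.lt κ f = 0 ∧ form h f f < 0 := by
  set c := ip h.lt κ φ₁ / ip h.lt e κ with hc
  have hcu : c * ip h.lt e κ = ip h.lt κ φ₁ := div_mul_cancel₀ _ heκ
  refine ⟨φ₁ - c • e, ?_, ?_⟩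
  · rw [map_sub, map_smul, smul_eq_mul, ip_comm h.lt κ e, hcu, sub_self]
  · have h1 : form h (φ₁ - c • e) (φ₁ - c • e) =
        form h φ₁ φ₁ - 2 * c * form h e φ₁ + c ^ 2 * form h e e := by
      simp only [map_sub, map_smul, LinearMap.sub_apply, LinearMap.smul_apply, smul_eq_mul]
      rw [form_comm h φ₁ e]
      ring
    rw [h1, form_of_null h hφ₁, form_of_null h he, form_of_null h he]
    nlinarith [mul_neg_of_neg_of_pos hm₁ hpos]

/-- The form is negative definite on the span of `φ₁` and `φ₂`, which meets the complement of `κ`. -/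
lemma exists_neg_of_two (h : IsRegular a b p q) {m₁ m₂ : ℝ} {φ₁ φ₂ : Smooth a b} (κ : Smooth a b)
    (hφ₁ : IsNull a b p (fun z => q z + m₁) φ₁) (hpos₁ : 0 < ip h.lt φ₁ φ₁)
    (hφ₂ : IsNull a b p (fun z => q z + m₂) φ₂) (hpos₂ : 0 < ip h.lt φ₂ φ₂)
    (hlt : m₁ < m₂) (hm₂ : m₂ < 0) :
    ∃ f : Smooth a b, ip h.lt κ f = 0 ∧ form h f f < 0 := by
  have hm₁ : m₁ < 0 := hlt.trans hm₂
  by_cases h0 : ip h.lt κ φ₁ = 0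
  · refine ⟨φ₁, h0, ?_⟩
    rw [form_of_null h hφ₁]
    exact mul_neg_of_neg_of_pos hm₁ hpos₁
  · set s := ip h.lt κ φ₁ with hs
    set r := ip h.lt κ φ₂ with hr
    refine ⟨r • φ₁ - s • φ₂, ?_, ?_⟩
    · rw [map_sub, map_smul, map_smul, ← hs, ← hr, smul_eq_mul, smul_eq_mul]
      ring
    · have h1 : form h (r • φ₁ - s • φ₂) (r • φ₁ - s • φ₂) =
          r ^ 2 * form h φ₁ φ₁ - 2 * (r * s) * form h φ₁ φ₂ + s ^ 2 * form h φ₂ φ₂ := by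
        simp only [map_sub, map_smul, LinearMap.sub_apply, LinearMap.smul_apply, smul_eq_mul]
        rw [form_comm h φ₂ φ₁]
        ring
      rw [h1, form_of_null h hφ₁, form_of_null h hφ₁, form_of_null h hφ₂,
        ip_eq_zero_of_null h hφ₁ hφ₂ hlt.ne]
      have h2 : s ^ 2 * (m₂ * ip h.lt φ₂ φ₂) < 0 :=
        mul_neg_of_pos_of_neg (by positivity) (mul_neg_of_neg_of_pos hm₂ hpos₂)
      have h3 := mul_nonpos_of_nonneg_of_nonpos (sq_nonneg r)
        (mul_neg_of_neg_of_pos hm₁ hpos₁).le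
      linarith

end Spectrum

/-! ### The Poincaré inequality for the standard Gaussian measure -/

section Gaussian

open ProbabilityTheory Filter
open scoped ENNReal

/-- The standard Gaussian measure on `ℝ`. -/
abbrev stdGauss : Measure ℝ := gaussianReal 0 1

/-- The density of the standard Gaussian measure. -/
abbrev gaussDensity : ℝ → ℝ := gaussianPDFReal 0 1

lemma hasDerivAt_gaussDensity (x : ℝ) :
    HasDerivAt gaussDensity (-(x * gaussDensity x)) x := by
  have h1 : gaussDensity = fun x => (√(2 * Real.pi * (1 : NNReal)))⁻¹ *
      Real.exp (-(x - 0) ^ 2 / (2 * (1 : NNReal))) := rfl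
  have h2 : HasDerivAt (fun x : ℝ => -(x - 0) ^ 2 / (2 * ((1 : NNReal) : ℝ))) (-x) x := by
    have := ((((hasDerivAt_id x).sub_const 0).pow 2).neg).div_const (2 * ((1 : NNReal) : ℝ))
    refine this.congr_deriv ?_
    simp
    ring
  have h3 := (h2.exp).const_mul (√(2 * Real.pi * (1 : NNReal)))⁻¹
  rw [h1]
  refine h3.congr_deriv ?_
  simp only
  ring

lemma tendsto_gaussDensity_atTop : Tendsto gaussDensity atTop (nhds 0) := by
  have h1 : gaussDensity = fun x => (√(2 * Real.pi * (1 : NNReal)))⁻¹ *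
      Real.exp (-(x - 0) ^ 2 / (2 * (1 : NNReal))) := rfl
  suffices key : Tendsto (fun x : ℝ => -(x - 0) ^ 2 / (2 * ((1 : NNReal) : ℝ))) atTop atBot by
    have := (Real.tendsto_exp_atBot.comp key).const_mul (√(2 * Real.pi * (1 : NNReal)))⁻¹
    rw [mul_zero] at this
    rwa [h1]
  have h2 : (fun x : ℝ => -(x - 0) ^ 2 / (2 * ((1 : NNReal) : ℝ))) =
      fun x => (-(1 / 2 : ℝ)) * x ^ 2 := by
    ext x
    simp
    ring
  rw [h2]
  exact (tendsto_pow_atTop two_ne_zero).const_mul_atTop_of_neg (by norm_num)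

lemma stdGauss_eq : stdGauss = volume.withDensity (fun x => ENNReal.ofReal (gaussDensity x)) :=
  gaussianReal_of_var_ne_zero 0 one_ne_zero

lemma integrable_id_stdGauss : Integrable (fun x : ℝ => x) stdGauss :=
  (memLp_id_gaussianReal' 1 (by simp)).integrable le_rfl

lemma integrable_sq_stdGauss : Integrable (fun x : ℝ => x ^ 2) stdGauss :=
  (memLp_id_gaussianReal' 2 (by simp)).integrable_sq

/-- The truncated mean `∫_{y > s} y dγ` equals the density at `s`. -/
lemma setIntegral_Ioi_id_stdGauss (s : ℝ) : ∫ y in Ioi s, y ∂stdGauss = gaussDensity s := by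
  have hint : IntegrableOn (fun y => y * gaussDensity y) (Ioi s) := by
    have h1 := integrable_id_stdGauss
    rw [stdGauss_eq, integrable_withDensity_iff (by fun_prop) (by simp)] at h1
    refine Integrable.integrableOn (h1.congr ?_)
    refine Eventually.of_forall fun x => ?_
    simp only
    rw [ENNReal.toReal_ofReal (gaussianPDFReal_nonneg _ _ _)]
  have h2 : ∫ y in Ioi s, y ∂stdGauss = ∫ y in Ioi s, y * gaussDensity y := by
    rw [stdGauss_eq, restrict_withDensity measurableSet_Ioi,
      integral_withDensity_eq_integral_toReal_smul (by fun_prop) (by simp)]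
    refine integral_congr_ae (Eventually.of_forall fun x => ?_)
    simp only [smul_eq_mul]
    rw [ENNReal.toReal_ofReal (gaussianPDFReal_nonneg _ _ _), mul_comm]
  rw [h2]
  have h3 := integral_Ioi_of_hasDerivAt_of_tendsto' (f := fun x => -gaussDensity x)
    (f' := fun y => y * gaussDensity y) (a := s) (m := 0)
    (fun x _ => by simpa using (hasDerivAt_gaussDensity x).fun_neg) hint
    (by simpa using tendsto_gaussDensity_atTop.neg)
  rw [h3]
  ring

/-- The weight `∬_{x < s < y} (y - x) dγ(x) dγ(y)` that the Cauchy–Schwarz inequality produces in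
the proof of the Poincaré inequality is the Gaussian density itself. -/
lemma gauss_kernel (s : ℝ) :
    ∫⁻ x, ∫⁻ y, (if x < s ∧ s < y then ENNReal.ofReal (y - x) else 0) ∂stdGauss ∂stdGauss =
      ENNReal.ofReal (gaussDensity s) := by
  have hU : ∫⁻ y in Ioi s, ENNReal.ofReal (y - s) ∂stdGauss =
      ENNReal.ofReal (gaussDensity s - s * stdGauss.real (Ioi s)) := by
    rw [← ofReal_integral_eq_lintegral_ofReal
      (f := fun y => y - s) ((integrable_id_stdGauss.sub (integrable_const s)).integrableOn)
      ((ae_restrict_mem measurableSet_Ioi).mono fun y hy => sub_nonneg.2 (le_of_lt hy)),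
      integral_sub integrable_id_stdGauss.integrableOn (integrable_const s).integrableOn,
      setIntegral_Ioi_id_stdGauss]
    simp [mul_comm]
  have hmean : ∫ x in Iic s, x ∂stdGauss = -gaussDensity s := by
    have h1 := integral_add_compl (measurableSet_Ioi (a := s)) integrable_id_stdGauss
    rw [integral_id_gaussianReal, setIntegral_Ioi_id_stdGauss, compl_Ioi] at h1
    linarith
  have hV : ∫⁻ x in Iic s, ENNReal.ofReal (s - x) ∂stdGauss =
      ENNReal.ofReal (s * stdGauss.real (Iic s) + gaussDensity s) := by
    rw [← ofReal_integral_eq_lintegral_ofReal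
      (f := fun x => s - x) (((integrable_const s).sub integrable_id_stdGauss).integrableOn)
      ((ae_restrict_mem measurableSet_Iic).mono fun y hy => sub_nonneg.2 hy),
      integral_sub (integrable_const s).integrableOn integrable_id_stdGauss.integrableOn, hmean]
    simp [mul_comm]
  set P := stdGauss.real (Iic s) with hP
  set Q := stdGauss.real (Ioi s) with hQ
  have hPQ : P + Q = 1 := by
    have := measureReal_add_measureReal_compl (μ := stdGauss) (measurableSet_Iic (a := s))
    rw [compl_Iic] at this
    rw [hP, hQ, this]
    simp
  have hP0 : 0 ≤ P := measureReal_nonneg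
  have hQ0 : 0 ≤ Q := measureReal_nonneg
  have hU0 : 0 ≤ gaussDensity s - s * Q := by
    have h1 : 0 ≤ ∫ y in Ioi s, (y - s) ∂stdGauss :=
      setIntegral_nonneg measurableSet_Ioi fun y hy => sub_nonneg.2 (le_of_lt hy)
    rw [integral_sub integrable_id_stdGauss.integrableOn (integrable_const s).integrableOn,
      setIntegral_Ioi_id_stdGauss] at h1
    simpa [mul_comm] using h1
  have hV0 : 0 ≤ s * P + gaussDensity s := by
    have h1 : 0 ≤ ∫ y in Iic s, (s - y) ∂stdGauss :=
      setIntegral_nonneg measurableSet_Iic fun y hy => sub_nonneg.2 hy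
    rw [integral_sub (integrable_const s).integrableOn integrable_id_stdGauss.integrableOn,
      hmean] at h1
    simpa [mul_comm] using h1
  have hnull : stdGauss {s} = 0 := by
    have := nullSingletonClass_gaussianReal (μ := 0) (v := 1) one_ne_zero
    exact measure_singleton s
  have hinner : ∀ x, ∫⁻ y, (if x < s ∧ s < y then ENNReal.ofReal (y - x) else 0) ∂stdGauss =
      (Iio s).indicator (fun x => ENNReal.ofReal (gaussDensity s - s * Q) +
        ENNReal.ofReal (s - x) * ENNReal.ofReal Q) x := by
    intro x
    by_cases hx : x < s
    · have h1 : (fun y => if x < s ∧ s < y then ENNReal.ofReal (y - x) else 0) =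
          (Ioi s).indicator (fun y => ENNReal.ofReal (y - s) + ENNReal.ofReal (s - x)) := by
        ext y
        by_cases hy : s < y
        · simp only [hx, hy, and_self, if_true]
          rw [indicator_of_mem (show y ∈ Ioi s from hy),
            ← ENNReal.ofReal_add (by linarith) (by linarith)]
          congr 1
          ring
        · simp [hx, hy]
      rw [h1, lintegral_indicator measurableSet_Ioi,
        lintegral_add_left (by fun_prop), hU, indicator_of_mem (show x ∈ Iio s from hx)]
      congr 1
      rw [setLIntegral_const, hQ, ofReal_measureReal]
    · simp [hx]
  simp_rw [hinner]
  rw [lintegral_indicator measurableSet_Iio, lintegral_add_left (by fun_prop),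
    lintegral_mul_const _ (by fun_prop)]
  have hae : Iio s =ᵐ[stdGauss] Iic s := by
    have := nullSingletonClass_gaussianReal (μ := 0) (v := 1) one_ne_zero
    exact Iio_ae_eq_Iic
  rw [setLIntegral_congr hae, setLIntegral_congr hae, hV, setLIntegral_const, ← ofReal_measureReal,
    ← hP, ← ENNReal.ofReal_mul hU0, ← ENNReal.ofReal_mul hV0,
    ← ENNReal.ofReal_add (mul_nonneg hU0 hP0) (mul_nonneg hV0 hQ0)]
  congr 1
  have : P = 1 - Q := by linarith
  rw [this]
  ring

/-- The Cauchy–Schwarz inequality for an increment. -/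
lemma sq_increment_le {f f' : ℝ → ℝ} (hf : ∀ x, HasDerivAt f (f' x) x) (hc : Continuous f')
    {x y : ℝ} (hxy : x ≤ y) : (f y - f x) ^ 2 ≤ (y - x) * ∫ s in x..y, f' s ^ 2 := by
  have hFTC : ∫ s in x..y, f' s = f y - f x :=
    intervalIntegral.integral_eq_sub_of_hasDerivAt (fun s _ => hf s) (hc.intervalIntegrable _ _)
  set Δ := f y - f x with hΔ
  have h1 : 0 ≤ ∫ s in x..y, ((y - x) * f' s - Δ) ^ 2 :=
    intervalIntegral.integral_nonneg hxy fun s _ => sq_nonneg _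
  have h2 : ∫ s in x..y, ((y - x) * f' s - Δ) ^ 2 =
      (y - x) ^ 2 * (∫ s in x..y, f' s ^ 2) - 2 * (y - x) * Δ * (∫ s in x..y, f' s)
        + Δ ^ 2 * (y - x) := by
    have e : (fun s => ((y - x) * f' s - Δ) ^ 2) = fun s =>
        ((y - x) ^ 2 * f' s ^ 2 - 2 * (y - x) * Δ * f' s) + Δ ^ 2 := by
      ext s; ring
    rw [e, intervalIntegral.integral_add, intervalIntegral.integral_sub,
      intervalIntegral.integral_const_mul, intervalIntegral.integral_const_mul,
      intervalIntegral.integral_const, smul_eq_mul]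
    · ring
    all_goals exact Continuous.intervalIntegrable (by fun_prop) _ _
  rw [h2, hFTC] at h1
  rcases hxy.eq_or_lt with h0 | h0
  · have hz : Δ = 0 := by rw [hΔ, h0, sub_self]
    rw [hz, h0]
    simp
  · have h3 : 0 < y - x := sub_pos.2 h0
    have h4 : 0 ≤ (y - x) * ((y - x) * (∫ s in x..y, f' s ^ 2) - Δ ^ 2) := by nlinarith
    nlinarith [nonneg_of_mul_nonneg_right h4 h3]

/-- The sharp one-dimensional Gaussian Poincaré inequality, in two-copy form. -/
lemma gauss_poincare_one {f f' : ℝ → ℝ} (hf : ∀ x, HasDerivAt f (f' x) x) (hc : Continuous f') :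
    ∫⁻ x, ∫⁻ y, ENNReal.ofReal ((f x - f y) ^ 2) ∂stdGauss ∂stdGauss ≤
      2 * ∫⁻ x, ENNReal.ofReal (f' x ^ 2) ∂stdGauss := by
  set k : ℝ → ℝ → ℝ → ℝ≥0∞ := fun x y s =>
    (if x < s ∧ s < y then ENNReal.ofReal (y - x) else 0) * ENNReal.ofReal (f' s ^ 2) with hk
  have hkm : Measurable (fun p : ℝ × ℝ × ℝ => k p.1 p.2.1 p.2.2) := by
    have hc' := hc.measurable
    refine Measurable.mul (Measurable.ite ?_ (by fun_prop) measurable_const) (by fun_prop)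
    exact (measurableSet_lt measurable_fst measurable_snd.snd).inter
      (measurableSet_lt measurable_snd.snd measurable_snd.fst)
  have hle : ∀ x y, x ≤ y → ENNReal.ofReal ((f x - f y) ^ 2) ≤ ∫⁻ s, k x y s := by
    intro x y hxy
    have h1 : ∫⁻ s, k x y s = ENNReal.ofReal ((y - x) * ∫ s in x..y, f' s ^ 2) := by
      have h2 : (fun s => k x y s) =
          (Ioo x y).indicator (fun s => ENNReal.ofReal (y - x) * ENNReal.ofReal (f' s ^ 2)) := by
        ext s
        by_cases hs : x < s ∧ s < y
        · rw [indicator_of_mem (show s ∈ Ioo x y from hs)]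
          simp [hk, hs]
        · rw [indicator_of_notMem (show s ∉ Ioo x y from hs)]
          simp only [hk, hs, if_false, zero_mul]
      rw [h2, lintegral_indicator measurableSet_Ioo, lintegral_const_mul _ (by fun_prop),
        ENNReal.ofReal_mul (sub_nonneg.2 hxy), intervalIntegral.integral_of_le hxy,
        integral_Ioc_eq_integral_Ioo, ofReal_integral_eq_lintegral_ofReal]
      · exact ((hc.pow 2).integrableOn_Icc).mono_set Ioo_subset_Icc_self
      · exact Eventually.of_forall fun s => sq_nonneg _
    rw [h1]
    refine ENNReal.ofReal_le_ofReal ?_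
    have := sq_increment_le hf hc hxy
    nlinarith
  have hle2 : ∀ x y, ENNReal.ofReal ((f x - f y) ^ 2) ≤ (∫⁻ s, k x y s) + ∫⁻ s, k y x s := by
    intro x y
    rcases le_total x y with hxy | hxy
    · exact (hle x y hxy).trans le_self_add
    · have := (hle y x hxy).trans (le_add_self (b := ∫⁻ s, k x y s))
      rwa [← neg_sub, neg_sq] at this
  have hm2 : Measurable (fun p : ℝ × ℝ => ∫⁻ s, k p.1 p.2 s) :=
    Measurable.lintegral_prod_right' (f := fun q : (ℝ × ℝ) × ℝ => k q.1.1 q.1.2 q.2)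
      (hkm.comp (by fun_prop : Measurable fun q : (ℝ × ℝ) × ℝ => (q.1.1, q.1.2, q.2)))
  have hI : ∫⁻ x, ∫⁻ y, (∫⁻ s, k x y s) ∂stdGauss ∂stdGauss =
      ∫⁻ x, ENNReal.ofReal (f' x ^ 2) ∂stdGauss := by
    have h1 : ∀ x, ∫⁻ y, (∫⁻ s, k x y s) ∂stdGauss = ∫⁻ s, (∫⁻ y, k x y s ∂stdGauss) := fun x =>
      lintegral_lintegral_swap (f := fun y s => k x y s)
        (hkm.comp (by fun_prop : Measurable fun q : ℝ × ℝ => (x, q.1, q.2))).aemeasurable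
    simp_rw [h1]
    rw [lintegral_lintegral_swap]
    · have h2 : ∀ s, ∫⁻ x, ∫⁻ y, k x y s ∂stdGauss ∂stdGauss =
          ENNReal.ofReal (gaussDensity s) * ENNReal.ofReal (f' s ^ 2) := by
        intro s
        rw [← gauss_kernel s, ← lintegral_mul_const']
        · refine lintegral_congr fun x => ?_
          rw [← lintegral_mul_const' _ _ (by simp)]
        · simp
      simp_rw [h2]
      rw [stdGauss_eq, lintegral_withDensity_eq_lintegral_mul _ (by fun_prop) (by fun_prop)]
      rfl
    · refine Measurable.aemeasurable ?_
      exact Measurable.lintegral_prod_right' (f := fun q : (ℝ × ℝ) × ℝ => k q.1.1 q.2 q.1.2)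
        (hkm.comp (by fun_prop : Measurable fun q : (ℝ × ℝ) × ℝ => (q.1.1, q.2, q.1.2)))
  calc ∫⁻ x, ∫⁻ y, ENNReal.ofReal ((f x - f y) ^ 2) ∂stdGauss ∂stdGauss
      ≤ ∫⁻ x, ∫⁻ y, ((∫⁻ s, k x y s) + ∫⁻ s, k y x s) ∂stdGauss ∂stdGauss :=
        lintegral_mono fun x => lintegral_mono fun y => hle2 x y
    _ = (∫⁻ x, ∫⁻ y, (∫⁻ s, k x y s) ∂stdGauss ∂stdGauss) +
        ∫⁻ x, ∫⁻ y, (∫⁻ s, k y x s) ∂stdGauss ∂stdGauss := by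
        have h1 : ∀ x, ∫⁻ y, ((∫⁻ s, k x y s) + ∫⁻ s, k y x s) ∂stdGauss =
            (∫⁻ y, (∫⁻ s, k x y s) ∂stdGauss) + ∫⁻ y, (∫⁻ s, k y x s) ∂stdGauss := fun x =>
          lintegral_add_left (f := fun y => ∫⁻ s, k x y s)
            (hm2.comp (by fun_prop : Measurable fun y : ℝ => (x, y))) _
        simp_rw [h1]
        exact lintegral_add_left (Measurable.lintegral_prod_right' hm2) _
    _ = 2 * ∫⁻ x, ENNReal.ofReal (f' x ^ 2) ∂stdGauss := by
        have h1 := lintegral_lintegral_swap (μ := stdGauss) (ν := stdGauss)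
          (f := fun x y => ∫⁻ s, k y x s) (hm2.comp measurable_swap).aemeasurable
        rw [h1, hI, two_mul]

end Gaussian

section Tensorization

open ProbabilityTheory Filter
open scoped ENNReal

/-- The squared distance of two reals, as an extended nonnegative real. -/
def sqd (s t : ℝ) : ℝ≥0∞ := ENNReal.ofReal ((s - t) ^ 2)

lemma measurable_sqd : Measurable (fun p : ℝ × ℝ => sqd p.1 p.2) := by
  unfold sqd
  fun_prop

lemma _root_.Measurable.sqd {α : Type*} [MeasurableSpace α] {f g : α → ℝ} (hf : Measurable f)
    (hg : Measurable g) : Measurable (fun x => LiquidBridge.sqd (f x) (g x)) :=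
  measurable_sqd.comp (hf.prodMk hg)

/-- The quadrilateral inequality. -/
lemma sqd_quadrilateral (p q r s : ℝ) :
    sqd p s + sqd q r ≤ (sqd p r + sqd q s) + (sqd p q + sqd r s) := by
  unfold sqd
  rw [← ENNReal.ofReal_add (sq_nonneg _) (sq_nonneg _),
    ← ENNReal.ofReal_add (sq_nonneg _) (sq_nonneg _),
    ← ENNReal.ofReal_add (sq_nonneg _) (sq_nonneg _),
    ← ENNReal.ofReal_add (by positivity) (by positivity)]
  refine ENNReal.ofReal_le_ofReal ?_
  nlinarith [sq_nonneg (p - q - r + s)]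

/-- Subadditivity of the variance over two independent factors. -/
lemma variance_subadditive {A B : Type*} [MeasurableSpace A] [MeasurableSpace B]
    (μ : Measure A) (ν : Measure B) [IsProbabilityMeasure μ] [IsProbabilityMeasure ν]
    {G : A → B → ℝ} (hG : Measurable (fun p : A × B => G p.1 p.2)) :
    ∫⁻ a, ∫⁻ b, ∫⁻ a', ∫⁻ b', sqd (G a b) (G a' b') ∂ν ∂μ ∂ν ∂μ ≤
      (∫⁻ a, ∫⁻ b, ∫⁻ a', sqd (G a b) (G a' b) ∂μ ∂ν ∂μ) +
        ∫⁻ a, ∫⁻ b, ∫⁻ b', sqd (G a b) (G a b') ∂ν ∂ν ∂μ := by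
  set M := (μ.prod μ).prod (ν.prod ν) with hM
  have g11 : Measurable (fun w : (A × A) × (B × B) => G w.1.1 w.2.1) :=
    hG.comp (by fun_prop : Measurable fun w : (A × A) × (B × B) => (w.1.1, w.2.1))
  have g12 : Measurable (fun w : (A × A) × (B × B) => G w.1.1 w.2.2) :=
    hG.comp (by fun_prop : Measurable fun w : (A × A) × (B × B) => (w.1.1, w.2.2))
  have g21 : Measurable (fun w : (A × A) × (B × B) => G w.1.2 w.2.1) :=
    hG.comp (by fun_prop : Measurable fun w : (A × A) × (B × B) => (w.1.2, w.2.1))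
  have g22 : Measurable (fun w : (A × A) × (B × B) => G w.1.2 w.2.2) :=
    hG.comp (by fun_prop : Measurable fun w : (A × A) × (B × B) => (w.1.2, w.2.2))
  have hsB : MeasurePreserving (Prod.map id Prod.swap : (A × A) × (B × B) → _) M M :=
    (MeasurePreserving.id _).prod Measure.measurePreserving_swap
  have hsA : MeasurePreserving (Prod.map Prod.swap id : (A × A) × (B × B) → _) M M :=
    Measure.measurePreserving_swap.prod (MeasurePreserving.id _)
  have hiter : ∀ ψ : (A × A) × (B × B) → ℝ≥0∞, Measurable ψ →
      ∫⁻ w, ψ w ∂M = ∫⁻ a, ∫⁻ a', ∫⁻ b, ∫⁻ b', ψ ((a, a'), (b, b')) ∂ν ∂ν ∂μ ∂μ := by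
    intro ψ hψ
    rw [hM, lintegral_prod _ hψ.aemeasurable, lintegral_prod _
      (Measurable.lintegral_prod_right' hψ).aemeasurable]
    refine lintegral_congr fun a => lintegral_congr fun a' => ?_
    exact lintegral_prod (fun w => ψ ((a, a'), w)) (hψ.comp measurable_prodMk_left).aemeasurable
  have hL : ∫⁻ a, ∫⁻ b, ∫⁻ a', ∫⁻ b', sqd (G a b) (G a' b') ∂ν ∂μ ∂ν ∂μ =
      ∫⁻ w, sqd (G w.1.1 w.2.1) (G w.1.2 w.2.2) ∂M := by
    rw [hiter _ (g11.sqd g22)]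
    refine lintegral_congr fun a => ?_
    refine lintegral_lintegral_swap (f := fun b a' => ∫⁻ b', sqd (G a b) (G a' b') ∂ν) ?_
    refine (Measurable.lintegral_prod_right'
      (f := fun w : (B × A) × B => sqd (G a w.1.1) (G w.1.2 w.2)) ?_).aemeasurable
    exact (hG.comp (by fun_prop : Measurable fun w : (B × A) × B => (a, w.1.1))).sqd
      (hG.comp (by fun_prop : Measurable fun w : (B × A) × B => (w.1.2, w.2)))
  have hR1 : ∫⁻ a, ∫⁻ b, ∫⁻ a', sqd (G a b) (G a' b) ∂μ ∂ν ∂μ =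
      ∫⁻ w, sqd (G w.1.1 w.2.1) (G w.1.2 w.2.1) ∂M := by
    rw [hiter _ (g11.sqd g21)]
    simp only [lintegral_const, measure_univ, mul_one]
    refine lintegral_congr fun a => ?_
    refine lintegral_lintegral_swap (f := fun b a' => sqd (G a b) (G a' b)) ?_
    exact ((hG.comp (by fun_prop : Measurable fun w : B × A => (a, w.1))).sqd
      (hG.comp (by fun_prop : Measurable fun w : B × A => (w.2, w.1)))).aemeasurable
  have hR2 : ∫⁻ a, ∫⁻ b, ∫⁻ b', sqd (G a b) (G a b') ∂ν ∂ν ∂μ =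
      ∫⁻ w, sqd (G w.1.1 w.2.1) (G w.1.1 w.2.2) ∂M := by
    rw [hiter _ (g11.sqd g12)]
    simp only [lintegral_const, measure_univ, mul_one]
  have sL : ∫⁻ w, sqd (G w.1.1 w.2.2) (G w.1.2 w.2.1) ∂M =
      ∫⁻ w, sqd (G w.1.1 w.2.1) (G w.1.2 w.2.2) ∂M :=
    hsB.lintegral_comp (g11.sqd g22)
  have sR1 : ∫⁻ w, sqd (G w.1.1 w.2.2) (G w.1.2 w.2.2) ∂M =
      ∫⁻ w, sqd (G w.1.1 w.2.1) (G w.1.2 w.2.1) ∂M :=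
    hsB.lintegral_comp (g11.sqd g21)
  have sR2 : ∫⁻ w, sqd (G w.1.2 w.2.1) (G w.1.2 w.2.2) ∂M =
      ∫⁻ w, sqd (G w.1.1 w.2.1) (G w.1.1 w.2.2) ∂M :=
    hsA.lintegral_comp (g11.sqd g12)
  rw [hL, hR1, hR2]
  have key : ∫⁻ w, (sqd (G w.1.1 w.2.1) (G w.1.2 w.2.2) +
      sqd (G w.1.1 w.2.2) (G w.1.2 w.2.1)) ∂M ≤
      ∫⁻ w, ((sqd (G w.1.1 w.2.1) (G w.1.2 w.2.1) + sqd (G w.1.1 w.2.2) (G w.1.2 w.2.2)) +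
        (sqd (G w.1.1 w.2.1) (G w.1.1 w.2.2) + sqd (G w.1.2 w.2.1) (G w.1.2 w.2.2))) ∂M :=
    lintegral_mono fun w => sqd_quadrilateral _ _ _ _
  rw [lintegral_add_left (g11.sqd g22),
    lintegral_add_left (f := fun w : (A × A) × (B × B) =>
      sqd (G w.1.1 w.2.1) (G w.1.2 w.2.1) + sqd (G w.1.1 w.2.2) (G w.1.2 w.2.2))
      ((g11.sqd g21).add (g12.sqd g22)),
    lintegral_add_left (g11.sqd g21), lintegral_add_left (g11.sqd g12), sL, sR1, sR2,
    ← two_mul, ← two_mul, ← two_mul, ← mul_add] at key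
  exact (ENNReal.mul_le_mul_iff_right two_ne_zero (by simp)).1 key

/-- The standard Gaussian measure on `ℝ^N`. -/
abbrev stdGaussPi (N : ℕ) : Measure (Fin N → ℝ) := Measure.pi fun _ => stdGauss

lemma lintegral_insertNth {N : ℕ} (i : Fin (N + 1)) {H : (Fin (N + 1) → ℝ) → ℝ≥0∞}
    (hH : Measurable H) :
    ∫⁻ x, H x ∂(stdGaussPi (N + 1)) =
      ∫⁻ t, ∫⁻ x', H (i.insertNth t x') ∂(stdGaussPi N) ∂stdGauss := by
  have h1 := (measurePreserving_piFinSuccAbove (fun _ : Fin (N + 1) => stdGauss) i).symm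
  rw [← h1.lintegral_comp hH]
  exact lintegral_prod _ (hH.comp h1.measurable).aemeasurable

lemma measurable_insertNth {N : ℕ} (i : Fin (N + 1)) :
    Measurable (fun p : ℝ × (Fin N → ℝ) => (i.insertNth p.1 p.2 : Fin (N + 1) → ℝ)) :=
  (MeasurableEquiv.piFinSuccAbove (fun _ : Fin (N + 1) => ℝ) i).symm.measurable

/-- The Efron–Stein inequality, in two-copy form. -/
lemma efron_stein (N : ℕ) {F : (Fin N → ℝ) → ℝ} (hF : Measurable F) :
    ∫⁻ x, ∫⁻ y, sqd (F x) (F y) ∂(stdGaussPi N) ∂(stdGaussPi N) ≤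
      ∑ i, ∫⁻ x, ∫⁻ t, sqd (F x) (F (Function.update x i t)) ∂stdGauss ∂(stdGaussPi N) := by
  induction N with
  | zero =>
    have : ∀ x y : Fin 0 → ℝ, sqd (F x) (F y) = 0 := fun x y => by
      rw [Subsingleton.elim x y]
      simp [sqd]
    simp [this]
  | succ N ih =>
    set c : ℝ → (Fin N → ℝ) → (Fin (N + 1) → ℝ) := fun t x' => Fin.insertNth 0 t x' with hc
    have hcm : Measurable (fun p : ℝ × (Fin N → ℝ) => c p.1 p.2) := measurable_insertNth 0
    have hG : Measurable (fun p : ℝ × (Fin N → ℝ) => F (c p.1 p.2)) := hF.comp hcm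
    have hupd : ∀ i : Fin (N + 1),
        Measurable (fun x => ∫⁻ t, sqd (F x) (F (Function.update x i t)) ∂stdGauss) := fun i => by
      refine Measurable.lintegral_prod_right'
        (f := fun w : (Fin (N + 1) → ℝ) × ℝ => sqd (F w.1) (F (Function.update w.1 i w.2))) ?_
      refine (hF.comp measurable_fst).sqd (hF.comp ?_)
      rw [measurable_pi_iff]
      intro j
      by_cases hj : j = i
      · subst hj
        simpa using measurable_snd
      · simp only [Function.update_of_ne hj]
        fun_prop
    have hL : ∫⁻ x, ∫⁻ y, sqd (F x) (F y) ∂(stdGaussPi (N + 1)) ∂(stdGaussPi (N + 1)) =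
        ∫⁻ a, ∫⁻ b, ∫⁻ a', ∫⁻ b', sqd (F (c a b)) (F (c a' b')) ∂(stdGaussPi N) ∂stdGauss
          ∂(stdGaussPi N) ∂stdGauss := by
      rw [lintegral_insertNth 0]
      · refine lintegral_congr fun a => lintegral_congr fun b => ?_
        rw [lintegral_insertNth 0 (measurable_const.sqd hF)]
      · exact Measurable.lintegral_prod_right' (f := fun w : _ × _ => sqd (F w.1) (F w.2))
          ((hF.comp measurable_fst).sqd (hF.comp measurable_snd))
    rw [hL, Fin.sum_univ_succ]
    refine (variance_subadditive _ _ (G := fun a b => F (c a b)) hG).trans (add_le_add ?_ ?_)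
    · rw [lintegral_insertNth 0 (hupd 0)]
      refine le_of_eq ?_
      refine lintegral_congr fun a => lintegral_congr fun b => lintegral_congr fun a' => ?_
      simp [hc, Fin.insertNth_zero', Fin.update_cons_zero]
    · have h1 : ∀ a, ∫⁻ b, ∫⁻ b', sqd (F (c a b)) (F (c a b')) ∂(stdGaussPi N) ∂(stdGaussPi N) ≤
          ∑ i, ∫⁻ x, ∫⁻ t, sqd (F (c a x)) (F (c a (Function.update x i t)))
            ∂stdGauss ∂(stdGaussPi N) := fun a =>
        ih (F := fun x => F (c a x)) (hG.comp measurable_prodMk_left)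
      refine (lintegral_mono h1).trans (le_of_eq ?_)
      have h2 : ∀ i : Fin N, ∀ a, ∫⁻ x, ∫⁻ t, sqd (F (c a x)) (F (c a (Function.update x i t)))
            ∂stdGauss ∂(stdGaussPi N) =
          ∫⁻ x, (fun z => ∫⁻ t, sqd (F z) (F (Function.update z i.succ t)) ∂stdGauss) (c a x)
            ∂(stdGaussPi N) := fun i a => by
        refine lintegral_congr fun x => lintegral_congr fun t => ?_
        simp [hc, Fin.insertNth_zero', Fin.cons_update]
      refine (lintegral_congr fun a => Finset.sum_congr rfl fun i _ => h2 i a).trans ?_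
      refine (lintegral_finsetSum _ fun (i : Fin N) _ =>
        Measurable.lintegral_prod_right' ((hupd i.succ).comp hcm)).trans ?_
      refine Finset.sum_congr rfl fun i _ => ?_
      exact (lintegral_insertNth 0 (hupd i.succ)).symm

/-- The sharp Gaussian Poincaré inequality on `ℝ^N`. The partial derivatives only have to exist on
almost every line parallel to a coordinate axis. -/
lemma gauss_poincare {N : ℕ} {F : (Fin (N + 1) → ℝ) → ℝ} (hF : Measurable F)
    {G : Fin (N + 1) → (Fin (N + 1) → ℝ) → ℝ} (hG : ∀ i, Measurable (G i))
    (hder : ∀ i : Fin (N + 1), ∀ᵐ x' ∂(stdGaussPi N),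
      (∀ t, HasDerivAt (fun s => F (i.insertNth s x')) (G i (i.insertNth t x')) t) ∧
        Continuous fun t => G i (i.insertNth t x')) :
    ∫⁻ x, ∫⁻ y, sqd (F x) (F y) ∂(stdGaussPi (N + 1)) ∂(stdGaussPi (N + 1)) ≤
      2 * ∑ i, ∫⁻ x, ENNReal.ofReal (G i x ^ 2) ∂(stdGaussPi (N + 1)) := by
  refine (efron_stein (N + 1) hF).trans ?_
  rw [Finset.mul_sum]
  refine Finset.sum_le_sum fun i _ => ?_
  have hupd : Measurable (fun x => ∫⁻ t, sqd (F x) (F (Function.update x i t)) ∂stdGauss) := by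
    refine Measurable.lintegral_prod_right'
      (f := fun w : (Fin (N + 1) → ℝ) × ℝ => sqd (F w.1) (F (Function.update w.1 i w.2))) ?_
    refine (hF.comp measurable_fst).sqd (hF.comp ?_)
    rw [measurable_pi_iff]
    intro j
    by_cases hj : j = i
    · subst hj
      simpa using measurable_snd
    · simp only [Function.update_of_ne hj]
      fun_prop
  have hins := measurable_insertNth i
  have hG2 : Measurable (fun x => ENNReal.ofReal (G i x ^ 2)) := ((hG i).pow_const 2).ennreal_ofReal
  have s1 := lintegral_lintegral_swap (μ := stdGauss) (ν := stdGaussPi N)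
    (f := fun s x' => ∫⁻ t, sqd (F (i.insertNth s x'))
      (F (Function.update (i.insertNth s x') i t)) ∂stdGauss) (hupd.comp hins).aemeasurable
  have s2 := lintegral_lintegral_swap (μ := stdGauss) (ν := stdGaussPi N)
    (f := fun s x' => ENNReal.ofReal (G i (i.insertNth s x') ^ 2)) (hG2.comp hins).aemeasurable
  rw [lintegral_insertNth i hupd, lintegral_insertNth i hG2, s1, s2,
    ← lintegral_const_mul' _ _ (by simp)]
  refine lintegral_mono_ae ((hder i).mono fun x' hx' => ?_)
  simp only [Fin.update_insertNth]
  exact gauss_poincare_one hx'.1 hx'.2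

end Tensorization

/-! ### The Poincaré inequality on the unit sphere -/

section Sphere

open ProbabilityTheory Filter
open scoped ENNReal RealInnerProductSpace

lemma lintegral_prod_pi {N : ℕ} {φ : Fin N → ℝ → ℝ≥0∞} (hφ : ∀ i, Measurable (φ i)) :
    ∫⁻ x : Fin N → ℝ, ∏ i, φ i (x i) = ∏ i, ∫⁻ t, φ i t := by
  induction N with
  | zero => simp [volume_pi]
  | succ N ih =>
    have h1 := (volume_preserving_piFinSuccAbove (fun _ : Fin (N + 1) => ℝ) 0).symm
    have hm : Measurable (fun x : Fin (N + 1) → ℝ => ∏ i, φ i (x i)) :=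
      Finset.measurable_prod _ fun i _ => (hφ i).comp (measurable_pi_apply i)
    rw [← h1.lintegral_comp hm, Fin.prod_univ_succ, ← ih fun i => hφ i.succ]
    have hm' : Measurable (fun x : Fin N → ℝ => ∏ i, φ i.succ (x i)) :=
      Finset.measurable_prod _ fun i _ => (hφ i.succ).comp (measurable_pi_apply i)
    rw [← lintegral_prod_mul (hφ 0).aemeasurable hm'.aemeasurable]
    refine lintegral_congr fun p => ?_
    rw [Fin.prod_univ_succ]
    rfl

lemma stdGaussPi_eq (N : ℕ) : stdGaussPi N =
    volume.withDensity (fun x => ENNReal.ofReal (∏ i, gaussDensity (x i))) := by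
  refine Measure.pi_eq fun s hs => ?_
  rw [withDensity_apply _ (MeasurableSet.univ_pi hs),
    ← lintegral_indicator (MeasurableSet.univ_pi hs)]
  have h1 : ∀ x : Fin N → ℝ,
      (univ.pi s).indicator (fun x => ENNReal.ofReal (∏ i, gaussDensity (x i))) x =
        ∏ i, (s i).indicator (fun t => ENNReal.ofReal (gaussDensity t)) (x i) := by
    intro x
    by_cases hx : x ∈ univ.pi s
    · rw [indicator_of_mem hx, ENNReal.ofReal_prod_of_nonneg fun i _ => gaussianPDFReal_nonneg _ _ _]
      exact Finset.prod_congr rfl fun i _ => by rw [indicator_of_mem (hx i (mem_univ i))]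
    · rw [indicator_of_notMem hx]
      obtain ⟨i, hi⟩ : ∃ i, x i ∉ s i := by
        by_contra hcon
        push Not at hcon
        exact hx fun i _ => hcon i
      exact (Finset.prod_eq_zero (Finset.mem_univ i) (indicator_of_notMem hi _)).symm
  simp_rw [h1]
  rw [lintegral_prod_pi fun i => Measurable.indicator (by fun_prop) (hs i)]
  refine Finset.prod_congr rfl fun i _ => ?_
  rw [lintegral_indicator (hs i), stdGauss_eq, withDensity_apply _ (hs i)]

/-- The Gaussian density is radial, so that polar coordinates factor Gaussian integrals of
homogeneous functions. The constant does not depend on the angular factor. -/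
lemma integral_homogeneous (n k : ℕ) : ∃ c : ℝ, ∀ g : Cross n → ℝ,
    ∫ x, ‖WithLp.toLp 2 x‖ ^ k * g (‖WithLp.toLp 2 x‖⁻¹ • WithLp.toLp 2 x) ∂(stdGaussPi (n + 1)) =
      c * ∫ θ : UnitSphere n, g θ ∂(volume : Measure (Cross n)).toSphere := by
  set w : ℝ → ℝ := fun r => ∏ _i : Fin (n + 1), (√(2 * Real.pi * (1 : NNReal)))⁻¹ with hw
  set W : ℝ → ℝ := fun r => w r * Real.exp (-r ^ 2 / 2) with hW
  have hdens : ∀ x : Fin (n + 1) → ℝ, ∏ i, gaussDensity (x i) = W ‖WithLp.toLp 2 x‖ := by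
    intro x
    simp only [hW, hw, gaussDensity, gaussianPDFReal, Finset.prod_mul_distrib]
    congr 1
    rw [← Real.exp_sum, EuclideanSpace.real_norm_sq_eq, ← Finset.sum_neg_distrib, Finset.sum_div]
    simp
  refine ⟨∫ r : Ioi (0 : ℝ), (r : ℝ) ^ k * W r ∂(Measure.volumeIoiPow n), fun g => ?_⟩
  set Φ : Cross n → ℝ := fun y => W ‖y‖ * (‖y‖ ^ k * g (‖y‖⁻¹ • y)) with hΦ
  have h1 : ∫ x, ‖WithLp.toLp 2 x‖ ^ k * g (‖WithLp.toLp 2 x‖⁻¹ • WithLp.toLp 2 x)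
      ∂(stdGaussPi (n + 1)) = ∫ x : Fin (n + 1) → ℝ, Φ (WithLp.toLp 2 x) := by
    have hm : Measurable fun x : Fin (n + 1) → ℝ => ENNReal.ofReal (∏ i, gaussDensity (x i)) :=
      (Finset.measurable_prod _ fun i _ =>
        (measurable_gaussianPDFReal 0 1).comp (measurable_pi_apply i)).ennreal_ofReal
    rw [stdGaussPi_eq, integral_withDensity_eq_integral_toReal_smul hm (by simp)]
    refine integral_congr_ae (Eventually.of_forall fun x => ?_)
    simp only [smul_eq_mul, hΦ]
    rw [ENNReal.toReal_ofReal (Finset.prod_nonneg fun i _ => gaussianPDFReal_nonneg _ _ _), hdens]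
  have h2 : ∫ x : Fin (n + 1) → ℝ, Φ (WithLp.toLp 2 x) = ∫ y, Φ y :=
    (PiLp.volume_preserving_toLp (Fin (n + 1))).integral_comp
      (MeasurableEquiv.toLp 2 (Fin (n + 1) → ℝ)).measurableEmbedding Φ
  have hdim : Module.finrank ℝ (Cross n) - 1 = n := by simp
  have h3 := (volume : Measure (Cross n)).measurePreserving_homeomorphUnitSphereProd
  rw [hdim] at h3
  have h4 : ∫ y, Φ y = ∫ y : ({0}ᶜ : Set (Cross n)), Φ y ∂((volume : Measure (Cross n)).comap (↑)) := by
    rw [integral_subtype_comap (measurableSet_singleton _).compl Φ, restrict_compl_singleton]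
  have h5 := h3.integral_comp (Homeomorph.measurableEmbedding _)
    (fun p : UnitSphere n × Ioi (0 : ℝ) => g p.1 * ((p.2 : ℝ) ^ k * W p.2))
  rw [integral_prod_mul (fun θ : UnitSphere n => g θ)
    (fun r : Ioi (0 : ℝ) => (r : ℝ) ^ k * W r)] at h5
  rw [h1, h2, h4, mul_comm, ← h5]
  refine integral_congr_ae (Eventually.of_forall fun y => ?_)
  simp only [hΦ, homeomorphUnitSphereProd_apply_snd_coe, homeomorphUnitSphereProd_apply_fst_coe]
  ring

/-- The tangential part at `θ` of the gradient of `f`. -/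
def tangGrad (n : ℕ) (f : Cross n → ℝ) (θ : Cross n) : Cross n :=
  gradient f θ - inner ℝ (gradient f θ) θ • θ

lemma sphereGradSq_eq (n : ℕ) (f : Cross n → ℝ) (θ : Cross n) :
    sphereGradSq n f θ = ‖tangGrad n f θ‖ ^ 2 := rfl

lemma continuous_gradient {n : ℕ} {f : Cross n → ℝ} (hf : ContDiff ℝ 1 f) :
    Continuous (gradient f) := by
  have h1 : Continuous (fderiv ℝ f) := hf.continuous_fderiv one_ne_zero
  exact (InnerProductSpace.toDual ℝ (Cross n)).symm.continuous.comp h1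

lemma continuous_tangGrad {n : ℕ} {f : Cross n → ℝ} (hf : ContDiff ℝ 1 f) :
    Continuous (tangGrad n f) := by
  have := continuous_gradient hf
  unfold tangGrad
  fun_prop

lemma inner_tangGrad {n : ℕ} (f : Cross n → ℝ) {θ : Cross n} (hθ : ‖θ‖ = 1) :
    inner ℝ (tangGrad n f θ) θ = 0 := by
  unfold tangGrad
  rw [inner_sub_left, real_inner_smul_left, real_inner_self_eq_norm_sq, hθ]
  ring

lemma norm_smul_inv_norm {n : ℕ} {x : Cross n} (hx : x ≠ 0) : ‖‖x‖⁻¹ • x‖ = 1 := by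
  rw [norm_smul, norm_inv, norm_norm, inv_mul_cancel₀ (norm_ne_zero_iff.2 hx)]

/-- The gradient of the 1-homogeneous extension `x ↦ |x| f(x/|x|)`, whose radial part is `f` and
whose tangential part is the spherical gradient of `f`. -/
lemma hasFDerivAt_homogeneous {n : ℕ} {f : Cross n → ℝ} (hf : ContDiff ℝ 1 f) {x : Cross n}
    (hx : x ≠ 0) :
    HasFDerivAt (fun y : Cross n => ‖y‖ * f (‖y‖⁻¹ • y))
      (innerSL ℝ (f (‖x‖⁻¹ • x) • (‖x‖⁻¹ • x) + tangGrad n f (‖x‖⁻¹ • x))) x := by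
  have hx0 : ‖x‖ ≠ 0 := norm_ne_zero_iff.2 hx
  set θ := ‖x‖⁻¹ • x with hθ
  have hN : HasFDerivAt (fun y : Cross n => ‖y‖) (innerSL ℝ θ) x := by
    have h1 : DifferentiableAt ℝ (fun y : Cross n => ‖y‖) x :=
      (contDiffAt_norm ℝ hx).differentiableAt one_ne_zero
    have h2 := h1.hasFDerivAt
    have h3 : HasFDerivAt (fun y : Cross n => ‖y‖ ^ 2) (2 • innerSL ℝ x) x :=
      (hasStrictFDerivAt_norm_sq x).hasFDerivAt
    have h4 := (h2.pow 2).unique h3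
    refine h2.congr_fderiv ?_
    ext v
    have h5 := congrArg (fun L : Cross n →L[ℝ] ℝ => L v) h4
    simp at h5
    rw [hθ, innerSL_apply_apply, real_inner_smul_left]
    field_simp
    linarith
  have hI : HasFDerivAt (fun y : Cross n => ‖y‖⁻¹) ((-(‖x‖ ^ 2)⁻¹) • innerSL ℝ θ) x :=
    (hasDerivAt_inv hx0).comp_hasFDerivAt x hN
  have hθ' := hI.smul (hasFDerivAt_id (𝕜 := ℝ) x)
  have hfd : HasFDerivAt f (innerSL ℝ (gradient f θ)) θ := by
    have := (hf.differentiable one_ne_zero θ).hasGradientAt.hasFDerivAt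
    exact this
  have hcomp := HasFDerivAt.comp (f := fun y : Cross n => ‖y‖⁻¹ • id y) x hfd hθ'
  have hprod := hN.mul hcomp
  refine hprod.congr_fderiv ?_
  ext v
  have hin : inner ℝ θ v = ‖x‖⁻¹ * inner ℝ x v := by rw [hθ, real_inner_smul_left]
  have hin2 : inner ℝ (gradient f θ) θ = ‖x‖⁻¹ * inner ℝ (gradient f θ) x := by
    rw [hθ, real_inner_smul_right]
  simp only [add_apply, smul_apply,
    ContinuousLinearMap.comp_apply, innerSL_apply_apply, smul_eq_mul, id, tangGrad,
    Function.comp, ContinuousLinearMap.id_apply, ContinuousLinearMap.smulRight_apply,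
    inner_add_left, inner_sub_left, real_inner_smul_left, inner_add_right, real_inner_smul_right]
  rw [← hθ, hin, hin2]
  field_simp
  ring

lemma integrable_normSq_stdGaussPi (n : ℕ) :
    Integrable (fun x : Fin (n + 1) → ℝ => ‖WithLp.toLp 2 x‖ ^ 2) (stdGaussPi (n + 1)) ∧
      ∫ x : Fin (n + 1) → ℝ, ‖WithLp.toLp 2 x‖ ^ 2 ∂(stdGaussPi (n + 1)) = n + 1 := by
  have h1 : (fun x : Fin (n + 1) → ℝ => ‖WithLp.toLp 2 x‖ ^ 2) = fun x => ∑ i, x i ^ 2 := by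
    ext x
    rw [EuclideanSpace.real_norm_sq_eq]
  have hev := fun i : Fin (n + 1) => measurePreserving_eval (fun _ : Fin (n + 1) => stdGauss) i
  have hint : ∀ i : Fin (n + 1), Integrable (fun x => x i ^ 2) (stdGaussPi (n + 1)) := fun i =>
    (hev i).integrable_comp_of_integrable integrable_sq_stdGauss
  have hval : ∫ t, t ^ 2 ∂stdGauss = 1 := by
    have h2 := variance_fun_id_gaussianReal (μ := 0) (v := 1)
    rw [variance_of_integral_eq_zero (by fun_prop) (by rw [integral_id_gaussianReal])] at h2
    simpa using h2
  rw [h1]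
  refine ⟨integrable_finsetSum _ fun i _ => hint i, ?_⟩
  rw [integral_finsetSum _ fun i _ => hint i]
  have h2 : ∀ i : Fin (n + 1), ∫ x, x i ^ 2 ∂(stdGaussPi (n + 1)) = 1 := fun i => by
    rw [← hval, ← (hev i).map_eq, integral_map (hev i).aemeasurable
      (by fun_prop)]
  simp [h2]

lemma gauss_ae_line_ne_zero {n : ℕ} (hn : 1 ≤ n) (i : Fin (n + 1)) :
    ∀ᵐ x' ∂(stdGaussPi n), ∀ t : ℝ,
      WithLp.toLp 2 (i.insertNth t x' : Fin (n + 1) → ℝ) ≠ (0 : Cross n) := by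
  have : Nonempty (Fin n) := ⟨⟨0, hn⟩⟩
  have := nullSingletonClass_gaussianReal (μ := 0) (v := 1) one_ne_zero
  have h0 : ∀ᵐ x' ∂(stdGaussPi n), x' ≠ 0 := by
    rw [ae_iff]
    simp
  refine h0.mono fun x' hx' t h => hx' ?_
  ext j
  have h2 := congrArg (fun y : Cross n => y (i.succAbove j)) h
  simpa using h2

/-- The sharp Poincaré inequality on `S^n` for functions of mean zero: the Gaussian Poincaré
inequality for the 1-homogeneous extension reads `(n + 1) ∫ f² ≤ ∫ (f² + |∇f|²)`. -/
lemma sphere_poincare_of_mean_zero {n : ℕ} (hn : 1 ≤ n) {f : Cross n → ℝ} (hf : ContDiff ℝ 1 f)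
    (hmean : ∫ θ : UnitSphere n, f θ ∂(volume : Measure (Cross n)).toSphere = 0) :
    n * ∫ θ : UnitSphere n, f θ ^ 2 ∂(volume : Measure (Cross n)).toSphere ≤
      ∫ θ : UnitSphere n, sphereGradSq n f θ ∂(volume : Measure (Cross n)).toSphere := by
  set σ := (volume : Measure (Cross n)).toSphere with hσ
  set γ := stdGaussPi (n + 1) with hγ
  set T : (Fin (n + 1) → ℝ) → Cross n := fun x => WithLp.toLp 2 x with hT
  have hTm : Measurable T := by
    simp only [hT]
    fun_prop
  set Θ : (Fin (n + 1) → ℝ) → Cross n := fun x => ‖T x‖⁻¹ • T x with hΘ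
  have hΘm : Measurable Θ := by
    simp only [hΘ]
    exact (hTm.norm.inv).smul hTm
  set F : (Fin (n + 1) → ℝ) → ℝ := fun x => ‖T x‖ * f (Θ x) with hF
  have hFm : Measurable F := hTm.norm.mul (hf.continuous.measurable.comp hΘm)
  set V : (Fin (n + 1) → ℝ) → Cross n := fun x => f (Θ x) • Θ x + tangGrad n f (Θ x) with hV
  have hVc : Continuous fun θ : Cross n => f θ • θ + tangGrad n f θ :=
    (hf.continuous.smul continuous_id).add (continuous_tangGrad hf)
  have hVm : Measurable V := hVc.measurable.comp hΘm
  have hGm : ∀ i : Fin (n + 1), Measurable fun x => V x i := fun i => by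
    have : Measurable fun y : Cross n => y i := by fun_prop
    exact this.comp hVm
  -- the Gaussian Poincaré inequality for the homogeneous extension
  have hP := gauss_poincare (N := n) hFm (G := fun i x => V x i) hGm (fun i => by
    refine (gauss_ae_line_ne_zero hn i).mono fun x' hx' => ⟨fun t => ?_, ?_⟩
    · have hline : HasDerivAt (fun s : ℝ => T (i.insertNth s x')) (EuclideanSpace.single i 1) t := by
        have h1 : (fun s : ℝ => T (i.insertNth s x')) =
            fun s => T (i.insertNth 0 x') + s • EuclideanSpace.single i (1 : ℝ) := by
          ext s j
          refine Fin.succAboveCases i ?_ (fun j => ?_) j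
          · simp [hT]
          · simp [hT, Fin.succAbove_ne]
        rw [h1]
        simpa using ((hasDerivAt_id t).smul_const (EuclideanSpace.single i (1 : ℝ))).const_add
          (T (i.insertNth 0 x'))
      have h2 := (hasFDerivAt_homogeneous hf (hx' t)).comp_hasDerivAt t hline
      refine h2.congr_deriv ?_
      rw [innerSL_apply_apply, EuclideanSpace.inner_single_right]
      simp [hV, hΘ, hT]
    · have h1 : Continuous fun t : ℝ => T (i.insertNth t x') := by
        simp only [hT]
        fun_prop
      have h2 : Continuous fun t : ℝ => Θ (i.insertNth t x') :=
        (h1.norm.inv₀ fun t => norm_ne_zero_iff.2 (hx' t)).smul h1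
      have h3 : Continuous fun y : Cross n => y i := by fun_prop
      exact h3.comp (hVc.comp h2))
  -- integrability
  obtain ⟨hsq, hsqv⟩ := integrable_normSq_stdGaussPi n
  obtain ⟨A, hA⟩ := (isCompact_closedBall (0 : Cross n) 1).exists_bound_of_continuousOn
    hf.continuous.continuousOn
  obtain ⟨B, hB⟩ := (isCompact_closedBall (0 : Cross n) 1).exists_bound_of_continuousOn
    hVc.continuousOn
  have hΘ1 : ∀ x, Θ x ∈ Metric.closedBall (0 : Cross n) 1 := fun x => by
    rw [mem_closedBall_zero_iff]
    by_cases h0 : T x = 0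
    · simp [hΘ, h0]
    · exact (norm_smul_inv_norm h0).le
  have hFsq : Integrable (fun x => F x ^ 2) γ := by
    refine (hsq.const_mul (A ^ 2)).mono' (hFm.pow_const 2).aestronglyMeasurable
      (Eventually.of_forall fun x => ?_)
    have h1 : F x ^ 2 = ‖T x‖ ^ 2 * f (Θ x) ^ 2 := by rw [hF]; ring
    have h2 : f (Θ x) ^ 2 ≤ A ^ 2 := by
      rw [← sq_abs]
      exact pow_le_pow_left₀ (abs_nonneg _) (hA _ (hΘ1 x)) 2
    rw [Real.norm_of_nonneg (sq_nonneg _), h1, mul_comm]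
    exact mul_le_mul_of_nonneg_right h2 (sq_nonneg _)
  have hFL2 : MemLp F 2 γ := (memLp_two_iff_integrable_sq hFm.aestronglyMeasurable).2 hFsq
  have hFint : Integrable F γ := hFL2.integrable (by norm_num)
  have hVsq : Integrable (fun x => ‖V x‖ ^ 2) γ := by
    refine (integrable_const (B ^ 2)).mono' (hVm.norm.pow_const 2).aestronglyMeasurable
      (Eventually.of_forall fun x => ?_)
    rw [Real.norm_of_nonneg (sq_nonneg _)]
    exact pow_le_pow_left₀ (norm_nonneg _) (hB _ (hΘ1 x)) 2
  -- polar coordinates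
  obtain ⟨c₀, hc₀⟩ := integral_homogeneous n 0
  obtain ⟨c₁, hc₁⟩ := integral_homogeneous n 1
  obtain ⟨c₂, hc₂⟩ := integral_homogeneous n 2
  have hEF : ∫ x, F x ∂γ = 0 := by
    have := hc₁ f
    rw [hmean, mul_zero] at this
    simpa [hF, pow_one] using this
  have hEF2 : ∫ x, F x ^ 2 ∂γ = c₂ * ∫ θ : UnitSphere n, f θ ^ 2 ∂σ := by
    rw [← hc₂ fun θ => f θ ^ 2]
    refine integral_congr_ae (Eventually.of_forall fun x => ?_)
    simp only [hF, hΘ, hT]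
    ring
  have hEV : ∫ x, ‖V x‖ ^ 2 ∂γ = c₀ * ∫ θ : UnitSphere n, (f θ ^ 2 + sphereGradSq n f θ) ∂σ := by
    have h1 := hc₀ fun θ => ‖f θ • θ + tangGrad n f θ‖ ^ 2
    have h2 : ∫ θ : UnitSphere n, ‖f θ • (θ : Cross n) + tangGrad n f θ‖ ^ 2 ∂σ =
        ∫ θ : UnitSphere n, (f θ ^ 2 + sphereGradSq n f θ) ∂σ := by
      refine integral_congr_ae (Eventually.of_forall fun θ => ?_)
      have hθ : ‖(θ : Cross n)‖ = 1 := by simp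
      simp only
      rw [norm_add_sq_real, real_inner_smul_left, real_inner_comm, inner_tangGrad f hθ, norm_smul,
        hθ, sphereGradSq_eq, Real.norm_eq_abs]
      simp
    rw [← h2, ← h1]
    refine integral_congr_ae (Eventually.of_forall fun x => ?_)
    simp [hV, hΘ, hT]
  have hS0 : c₀ * σ.real univ = 1 := by
    have h1 := hc₀ fun _ => 1
    rw [integral_const, smul_eq_mul, mul_one] at h1
    simp at h1
    rw [hσ]; simp; linarith
  have hS2 : c₂ * σ.real univ = n + 1 := by
    have h1 := hc₂ fun _ => 1
    simp only [mul_one] at h1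
    rw [hsqv] at h1
    rw [integral_const, smul_eq_mul, mul_one] at h1
    simp at h1
    rw [hσ]; simp; linarith
  have hc0pos : 0 < c₀ := by
    have h1 : 0 ≤ σ.real univ := measureReal_nonneg
    by_contra! hle
    nlinarith
  have hc2 : c₂ = (n + 1) * c₀ := by
    have h1 : σ.real univ ≠ 0 := fun h0 => by rw [h0, mul_zero] at hS0; exact zero_ne_one hS0
    apply mul_right_cancel₀ h1
    rw [hS2, mul_assoc, hS0, mul_one]
  -- the two-copy form of the variance
  have hL : ∫⁻ x, ∫⁻ y, sqd (F x) (F y) ∂γ ∂γ = ENNReal.ofReal (2 * ∫ x, F x ^ 2 ∂γ) := by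
    have h1 : ∀ x, ∫⁻ y, sqd (F x) (F y) ∂γ = ENNReal.ofReal (F x ^ 2 + ∫ y, F y ^ 2 ∂γ) := by
      intro x
      have e : (fun y => (F x - F y) ^ 2) = fun y => (F x ^ 2 - 2 * F x * F y) + F y ^ 2 := by
        ext y; ring
      have hi : Integrable (fun y => F x ^ 2 - 2 * F x * F y) γ :=
        (integrable_const _).sub (hFint.const_mul _)
      have hi2 : Integrable (fun y => (F x - F y) ^ 2) γ := by
        rw [e]
        exact hi.add hFsq
      have h2 : ∫ y, (F x - F y) ^ 2 ∂γ = F x ^ 2 + ∫ y, F y ^ 2 ∂γ := by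
        rw [e, integral_add hi hFsq, integral_sub (integrable_const _) (hFint.const_mul _),
          integral_const_mul, hEF]
        simp
      rw [← h2, ofReal_integral_eq_lintegral_ofReal hi2 (Eventually.of_forall fun y => sq_nonneg _)]
      rfl
    simp_rw [h1]
    have hI0 : 0 ≤ ∫ y, F y ^ 2 ∂γ := integral_nonneg fun y => sq_nonneg _
    rw [← ofReal_integral_eq_lintegral_ofReal
      (f := fun x => F x ^ 2 + ∫ y, F y ^ 2 ∂γ) (hFsq.add (integrable_const _))
      (Eventually.of_forall fun x => add_nonneg (sq_nonneg _) hI0)]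
    congr 1
    have := integral_add hFsq (integrable_const (μ := γ) (∫ y, F y ^ 2 ∂γ))
    rw [integral_const] at this
    simp at this
    rw [this]
    ring
  have hR : ∑ i, ∫⁻ x, ENNReal.ofReal (V x i ^ 2) ∂γ = ENNReal.ofReal (∫ x, ‖V x‖ ^ 2 ∂γ) := by
    rw [ofReal_integral_eq_lintegral_ofReal hVsq (Eventually.of_forall fun x => sq_nonneg _),
      ← lintegral_finsetSum _ fun i _ => ((hGm i).pow_const 2).ennreal_ofReal]
    refine lintegral_congr fun x => ?_
    rw [EuclideanSpace.real_norm_sq_eq, ENNReal.ofReal_sum_of_nonneg fun i _ => sq_nonneg _]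
  have h22 : (2 : ℝ≥0∞) * ENNReal.ofReal (∫ x, ‖V x‖ ^ 2 ∂γ) =
      ENNReal.ofReal (2 * ∫ x, ‖V x‖ ^ 2 ∂γ) := by
    rw [ENNReal.ofReal_mul zero_le_two, ENNReal.ofReal_ofNat]
  rw [hL, hR, h22] at hP
  have hI1 : 0 ≤ ∫ x, ‖V x‖ ^ 2 ∂γ := integral_nonneg fun y => sq_nonneg _
  have hP' := (ENNReal.ofReal_le_ofReal_iff (by positivity)).1 hP
  have hP2 : ∫ x, F x ^ 2 ∂γ ≤ ∫ x, ‖V x‖ ^ 2 ∂γ := by linarith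
  have hi1 : Integrable (fun θ : UnitSphere n => f θ ^ 2) σ :=
    ((hf.continuous.comp continuous_subtype_val).pow 2).integrable_of_hasCompactSupport
      (HasCompactSupport.of_compactSpace _)
  have hi2 : Integrable (fun θ : UnitSphere n => sphereGradSq n f θ) σ :=
    (((continuous_tangGrad hf).comp continuous_subtype_val).norm.pow 2).integrable_of_hasCompactSupport
      (HasCompactSupport.of_compactSpace _)
  rw [hEF2, hEV, integral_add hi1 hi2, hc2, mul_assoc, mul_left_comm] at hP2
  have := le_of_mul_le_mul_left hP2 hc0pos
  linarith

/-- The sharp Poincaré inequality on `S^n`: the first nonzero eigenvalue of the Laplacian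
is `n`. -/
lemma sphere_poincare {n : ℕ} (hn : 1 ≤ n) {f : Cross n → ℝ} (hf : ContDiff ℝ 1 f) {m : ℝ}
    (hm : ∫ θ : UnitSphere n, f θ ∂(volume : Measure (Cross n)).toSphere =
      m * (volume : Measure (Cross n)).toSphere.real univ) :
    n * (∫ θ : UnitSphere n, f θ ^ 2 ∂(volume : Measure (Cross n)).toSphere -
        m ^ 2 * (volume : Measure (Cross n)).toSphere.real univ) ≤
      ∫ θ : UnitSphere n, sphereGradSq n f θ ∂(volume : Measure (Cross n)).toSphere := by
  set σ := (volume : Measure (Cross n)).toSphere with hσ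
  have hi1 : Integrable (fun θ : UnitSphere n => f θ) σ :=
    (hf.continuous.comp continuous_subtype_val).integrable_of_hasCompactSupport
      (HasCompactSupport.of_compactSpace _)
  have hi2 : Integrable (fun θ : UnitSphere n => f θ ^ 2) σ :=
    ((hf.continuous.comp continuous_subtype_val).pow 2).integrable_of_hasCompactSupport
      (HasCompactSupport.of_compactSpace _)
  have h1 := sphere_poincare_of_mean_zero hn (f := fun θ => f θ - m) (hf.sub contDiff_const) (by
    rw [integral_sub hi1 (integrable_const _), hm]
    simp [mul_comm])
  have h2 : ∀ θ, sphereGradSq n (fun θ => f θ - m) θ = sphereGradSq n f θ := fun θ => by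
    unfold sphereGradSq gradient
    simp only [fderiv_sub_const]
  simp_rw [h2] at h1
  refine le_trans (le_of_eq ?_) h1
  congr 1
  have e : (fun θ : UnitSphere n => (f θ - m) ^ 2) = fun θ : UnitSphere n =>
      (f θ ^ 2 - 2 * m * f θ) + m ^ 2 := by
    ext θ; ring
  have hi3 : Integrable (fun θ : UnitSphere n => f θ ^ 2 - 2 * m * f θ) σ :=
    hi2.sub (hi1.const_mul _)
  rw [e, ← hσ, integral_add hi3 (integrable_const _),
    integral_sub hi2 (hi1.const_mul _), integral_const_mul, hm, integral_const, smul_eq_mul]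
  ring

end Sphere

/-! ### Directional derivatives and integrals depending on a parameter -/

section Directional

variable {E : Type*} [NormedAddCommGroup E] [NormedSpace ℝ E] {S : Set E} {g : E → ℝ}

/-- The derivative of `g` along `v`, relative to the set `S`. -/
def pd (S : Set E) (v : E) (g : E → ℝ) (p : E) : ℝ := fderivWithin ℝ g S p v

lemma pd_smooth (hS : UniqueDiffOn ℝ S) (v : E) (hg : ContDiffOn ℝ ∞ g S) :
    ContDiffOn ℝ ∞ (pd S v g) S :=
  (hg.fderivWithin hS (m := ∞) (by simp)).clm_apply contDiffOn_const

lemma pd_comm (hS : UniqueDiffOn ℝ S) (hcl : S ⊆ closure (interior S)) (v w : E)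
    (hg : ContDiffOn ℝ ∞ g S) {p : E} (hp : p ∈ S) :
    pd S v (pd S w g) p = pd S w (pd S v g) p := by
  have hd : DifferentiableWithinAt ℝ (fderivWithin ℝ g S) S p :=
    (hg.fderivWithin hS (m := ∞) (by simp)).differentiableOn (by simp) p hp
  have key : ∀ v w : E, pd S v (pd S w g) p = fderivWithin ℝ (fderivWithin ℝ g S) S p v w := by
    intro v w
    have h1 : HasFDerivWithinAt (pd S w g) _ S p := hd.hasFDerivWithinAt.clm_apply
      (hasFDerivWithinAt_const w p S)
    unfold pd at h1 ⊢
    rw [h1.fderivWithin (hS p hp)]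
    simp
  rw [key, key]
  exact (hg p hp).isSymmSndFDerivWithinAt
    (by rw [minSmoothness_of_isRCLikeNormedField]; exact ENat.LEInfty.out) hS (hcl hp) hp v w

lemma pd_hasDerivWithinAt (hg : ContDiffOn ℝ ∞ g S) {c : ℝ → E} {v : E} {I : Set ℝ} {t : ℝ}
    (hc : HasDerivWithinAt c v I t) (hI : MapsTo c I S) (ht : c t ∈ S) :
    HasDerivWithinAt (fun s => g (c s)) (pd S v g (c t)) I t :=
  ((hg.differentiableOn (by simp) _ ht).hasFDerivWithinAt).comp_hasDerivWithinAt t hc hI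

end Directional

section Parametric

variable {n : ℕ} {a b : ℝ}

/-- The surface measure of `S^n`. -/
abbrev sph (n : ℕ) : Measure (UnitSphere n) := (volume : Measure (Cross n)).toSphere

lemma sph_real_pos (n : ℕ) : 0 < (sph n).real univ := by
  rw [measureReal_def]
  refine ENNReal.toReal_pos ?_ (measure_ne_top _ _)
  rw [Measure.measure_univ_ne_zero]
  exact Measure.toSphere_ne_zero _

lemma continuousOn_sphere {α : Type*} [TopologicalSpace α] {s : Set α} {g : α → Cross n → ℝ}
    (hg : ContinuousOn (fun q : α × Cross n => g q.1 q.2) (s ×ˢ univ)) :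
    ContinuousOn (fun q : α × UnitSphere n => g q.1 q.2) (s ×ˢ univ) :=
  hg.comp (f := fun q : α × UnitSphere n => (q.1, (q.2 : Cross n)))
    (by fun_prop) fun q hq => ⟨hq.1, trivial⟩

lemma continuous_extend (hab : a ≤ b) {g : ℝ → UnitSphere n → ℝ}
    (hg : ContinuousOn (fun q : ℝ × UnitSphere n => g q.1 q.2) (Icc a b ×ˢ univ)) :
    Continuous (fun q : ℝ × UnitSphere n => g (projIcc a b hab q.1) q.2) :=
  hg.comp_continuous (f := fun q : ℝ × UnitSphere n => (((projIcc a b hab q.1 : Icc a b) : ℝ), q.2))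
    (by
      have : Continuous (projIcc a b hab) := continuous_projIcc
      fun_prop) fun q => ⟨(projIcc a b hab q.1).2, trivial⟩

lemma sphere_integrable {g : UnitSphere n → ℝ} (hg : Continuous g) : Integrable g (sph n) :=
  hg.integrable_of_hasCompactSupport (HasCompactSupport.of_compactSpace _)

lemma slice_continuous {g : ℝ → UnitSphere n → ℝ}
    (hg : ContinuousOn (fun q : ℝ × UnitSphere n => g q.1 q.2) (Icc a b ×ˢ univ)) {z : ℝ}
    (hz : z ∈ Icc a b) : Continuous (g z) :=
  hg.comp_continuous (f := fun θ : UnitSphere n => (z, θ)) (by fun_prop) fun _ => ⟨hz, trivial⟩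

lemma continuousOn_integral_sphere (hab : a ≤ b) {g : ℝ → UnitSphere n → ℝ}
    (hg : ContinuousOn (fun q : ℝ × UnitSphere n => g q.1 q.2) (Icc a b ×ˢ univ)) :
    ContinuousOn (fun z => ∫ θ, g z θ ∂(sph n)) (Icc a b) := by
  have h1 := continuous_parametric_integral_of_continuous (μ := sph n)
    (f := fun (z : ℝ) (θ : UnitSphere n) => g (projIcc a b hab z) θ) (continuous_extend hab hg)
    isCompact_univ
  simp only [Measure.restrict_univ] at h1
  refine h1.continuousOn.congr fun z hz => ?_
  simp only [projIcc_of_mem hab hz]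

/-- An iterated integral over `[a, b] × S^n` as an integral for the product measure. -/
lemma integral_prod_sphere (hab : a ≤ b) {g : ℝ → UnitSphere n → ℝ}
    (hg : ContinuousOn (fun q : ℝ × UnitSphere n => g q.1 q.2) (Icc a b ×ˢ univ)) :
    ∫ z in a..b, ∫ θ, g z θ ∂(sph n) =
      ∫ q : ℝ × UnitSphere n, g (projIcc a b hab q.1) q.2
        ∂((volume.restrict (Ioc a b)).prod (sph n)) := by
  have hc := continuous_extend hab hg
  obtain ⟨C, hC⟩ := (isCompact_Icc.prod (isCompact_univ (X := UnitSphere n))).exists_bound_of_continuousOn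
    hg
  have hint : Integrable (fun q : ℝ × UnitSphere n => g (projIcc a b hab q.1) q.2)
      ((volume.restrict (Ioc a b)).prod (sph n)) :=
    (integrable_const C).mono' hc.aestronglyMeasurable
      (Filter.Eventually.of_forall fun q => hC (_, q.2) ⟨(projIcc a b hab q.1).2, trivial⟩)
  rw [integral_prod _ hint, intervalIntegral.integral_of_le hab]
  refine setIntegral_congr_fun measurableSet_Ioc fun z hz => ?_
  simp only [projIcc_of_mem hab (Ioc_subset_Icc_self hz)]

/-- Differentiation of an integral over `[a, b] × S^n` with respect to a parameter. -/
lemma hasDerivAt_integral_sphere (hab : a ≤ b) {δ : ℝ} {g g' : ℝ → ℝ → UnitSphere n → ℝ}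
    (hg : ContinuousOn (fun p : ℝ × ℝ × UnitSphere n => g p.1 p.2.1 p.2.2)
      (Ioo (-δ) δ ×ˢ Icc a b ×ˢ univ))
    (hg' : ContinuousOn (fun p : ℝ × ℝ × UnitSphere n => g' p.1 p.2.1 p.2.2)
      (Ioo (-δ) δ ×ˢ Icc a b ×ˢ univ))
    (hd : ∀ ε ∈ Ioo (-δ) δ, ∀ z ∈ Icc a b, ∀ θ, HasDerivAt (fun e => g e z θ) (g' ε z θ) ε)
    {ε : ℝ} (hε : ε ∈ Ioo (-δ) δ) :
    HasDerivAt (fun e => ∫ z in a..b, ∫ θ, g e z θ ∂(sph n))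
      (∫ z in a..b, ∫ θ, g' ε z θ ∂(sph n)) ε := by
  have slice : ∀ {k : ℝ → ℝ → UnitSphere n → ℝ}, ContinuousOn
      (fun p : ℝ × ℝ × UnitSphere n => k p.1 p.2.1 p.2.2) (Ioo (-δ) δ ×ˢ Icc a b ×ˢ univ) →
      ∀ e ∈ Ioo (-δ) δ, ContinuousOn (fun q : ℝ × UnitSphere n => k e q.1 q.2)
        (Icc a b ×ˢ univ) := fun hk e he =>
    hk.comp (f := fun q : ℝ × UnitSphere n => (e, q)) (by fun_prop) fun q hq => ⟨he, hq⟩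
  obtain ⟨r, hr, hball⟩ := Metric.nhds_basis_closedBall.mem_iff.1 (isOpen_Ioo.mem_nhds hε)
  obtain ⟨C, hC⟩ := ((isCompact_closedBall ε r).prod
    (isCompact_Icc.prod (isCompact_univ (X := UnitSphere n)))).exists_bound_of_continuousOn
    (hg'.mono (prod_mono hball subset_rfl))
  have hev : ∀ᶠ e in nhds ε, e ∈ Ioo (-δ) δ := isOpen_Ioo.mem_nhds hε
  obtain ⟨B, hB⟩ := (isCompact_Icc.prod (isCompact_univ (X := UnitSphere n))).exists_bound_of_continuousOn
    (slice hg ε hε)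
  have key := (hasDerivAt_integral_of_dominated_loc_of_deriv_le (𝕜 := ℝ)
    (μ := (volume.restrict (Ioc a b)).prod (sph n))
    (F := fun e (q : ℝ × UnitSphere n) => g e (projIcc a b hab q.1) q.2)
    (F' := fun e (q : ℝ × UnitSphere n) => g' e (projIcc a b hab q.1) q.2)
    (bound := fun _ => C)
    (Metric.closedBall_mem_nhds ε hr)
    (hev.mono fun e he => (continuous_extend hab (slice hg e he)).aestronglyMeasurable)
    ((integrable_const B).mono' (continuous_extend hab (slice hg ε hε)).aestronglyMeasurable
      (Filter.Eventually.of_forall fun q => hB (_, q.2) ⟨(projIcc a b hab q.1).2, trivial⟩))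
    (continuous_extend hab (slice hg' ε hε)).aestronglyMeasurable
    (Filter.Eventually.of_forall fun q e he =>
      hC (e, _, q.2) ⟨he, (projIcc a b hab q.1).2, trivial⟩)
    (integrable_const C)
    (Filter.Eventually.of_forall fun q e he =>
      hd e (hball he) _ (projIcc a b hab q.1).2 q.2)).2
  rw [integral_prod_sphere hab (slice hg' ε hε)]
  refine key.congr_of_eventuallyEq (hev.mono fun e he => ?_)
  exact integral_prod_sphere hab (slice hg e he)

lemma uniqueDiffOn_cyl (hab : a < b) : UniqueDiffOn ℝ (Icc a b ×ˢ (univ : Set (Cross n))) :=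
  (uniqueDiffOn_Icc hab).prod uniqueDiffOn_univ

lemma cyl_hasDeriv {g : ℝ × Cross n → ℝ} (hg : ContDiffOn ℝ ∞ g (Icc a b ×ˢ univ)) (θ : Cross n)
    {z : ℝ} (hz : z ∈ Icc a b) :
    HasDerivWithinAt (fun s => g (s, θ)) (pd (Icc a b ×ˢ univ) (1, 0) g (z, θ)) (Icc a b) z :=
  pd_hasDerivWithinAt hg (((hasDerivAt_id z).prodMk (hasDerivAt_const z θ)).hasDerivWithinAt)
    (fun _ hs => ⟨hs, trivial⟩) ⟨hz, trivial⟩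

lemma cyl_D (hab : a < b) {g : ℝ × Cross n → ℝ} (hg : ContDiffOn ℝ ∞ g (Icc a b ×ˢ univ))
    (θ : Cross n) {z : ℝ} (hz : z ∈ Icc a b) :
    D a b (fun s => g (s, θ)) z = pd (Icc a b ×ˢ univ) (1, 0) g (z, θ) :=
  D_eq hab hz (cyl_hasDeriv hg θ hz)

lemma cyl_continuousOn {g : ℝ × Cross n → ℝ} (hg : ContDiffOn ℝ ∞ g (Icc a b ×ˢ univ)) :
    ContinuousOn (fun q : ℝ × UnitSphere n => g (q.1, q.2)) (Icc a b ×ˢ univ) :=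
  continuousOn_sphere (g := fun z θ => g (z, θ)) hg.continuousOn

/-- The mean over the sphere is differentiated under the integral, up to the end points: the
fundamental theorem of calculus reduces this to exchanging two integrals. -/
lemma hasDerivWithinAt_sphere_integral (hab : a < b) {g : ℝ × Cross n → ℝ}
    (hg : ContDiffOn ℝ ∞ g (Icc a b ×ˢ univ)) {z : ℝ} (hz : z ∈ Icc a b) :
    HasDerivWithinAt (fun s => ∫ θ : UnitSphere n, g (s, θ) ∂(sph n))
      (∫ θ : UnitSphere n, pd (Icc a b ×ˢ univ) (1, 0) g (z, θ) ∂(sph n)) (Icc a b) z := by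
  set g' := pd (Icc a b ×ˢ (univ : Set (Cross n))) (1, 0) g with hg'def
  have hg' : ContDiffOn ℝ ∞ g' (Icc a b ×ˢ univ) := pd_smooth (uniqueDiffOn_cyl hab) _ hg
  have hc' := cyl_continuousOn hg'
  set m : ℝ → ℝ := fun s => ∫ θ : UnitSphere n, g' (projIcc a b hab.le s, θ) ∂(sph n) with hm
  have hmc : Continuous m := by
    have h1 := continuous_parametric_integral_of_continuous (μ := sph n)
      (f := fun (z : ℝ) (θ : UnitSphere n) => g' (projIcc a b hab.le z, θ))
      (continuous_extend hab.le (g := fun z (θ : UnitSphere n) => g' (z, θ)) hc') isCompact_univ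
    simpa only [Measure.restrict_univ] using h1
  have hftc : ∀ s ∈ Icc a b, ∫ θ : UnitSphere n, g (s, θ) ∂(sph n) =
      ∫ θ : UnitSphere n, g (a, θ) ∂(sph n) + ∫ t in a..s, m t := by
    intro s hs
    have hsub : Icc a s ⊆ Icc a b := Icc_subset_Icc_right hs.2
    have h1 : ∀ θ : UnitSphere n, g (s, θ) = g (a, θ) + ∫ t in a..s, g' (projIcc a b hab.le t, θ) := by
      intro θ
      have h2 : ∫ t in a..s, g' (projIcc a b hab.le t, θ) = g (s, θ) - g (a, θ) := by
        refine intervalIntegral.integral_eq_sub_of_hasDerivAt_of_le hs.1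
          (f := fun t => g (t, θ)) ?_ ?_ ?_
        · exact (fun t ht => (cyl_hasDeriv hg θ (hsub ht)).continuousWithinAt.mono hsub)
        · intro t ht
          have ht' : t ∈ Ioo a b := ⟨ht.1, ht.2.trans_le hs.2⟩
          rw [projIcc_of_mem hab.le (Ioo_subset_Icc_self ht')]
          exact (cyl_hasDeriv hg θ (Ioo_subset_Icc_self ht')).hasDerivAt (Icc_mem_nhds ht'.1 ht'.2)
        · apply Continuous.intervalIntegrable
          exact (continuous_extend hab.le (g := fun z (θ : UnitSphere n) => g' (z, θ)) hc').comp
            (f := fun t : ℝ => (t, θ)) (by fun_prop)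
      rw [h2]; ring
    have hga : Continuous fun θ : UnitSphere n => g (a, θ) :=
      slice_continuous (g := fun z (θ : UnitSphere n) => g (z, θ)) (cyl_continuousOn hg)
        (left_mem_Icc.2 hab.le)
    have hgs : Continuous fun θ : UnitSphere n => g (s, θ) :=
      slice_continuous (g := fun z (θ : UnitSphere n) => g (z, θ)) (cyl_continuousOn hg) hs
    have hint2 : Integrable (fun θ : UnitSphere n => ∫ t in a..s, g' (projIcc a b hab.le t, θ))
        (sph n) := by
      have : (fun θ : UnitSphere n => ∫ t in a..s, g' (projIcc a b hab.le t, θ)) =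
          fun θ : UnitSphere n => g (s, θ) - g (a, θ) := by
        ext θ; rw [h1 θ]; ring
      rw [this]
      exact sphere_integrable (hgs.sub hga)
    rw [integral_congr_ae (Filter.Eventually.of_forall h1),
      integral_add (sphere_integrable hga) hint2]
    congr 1
    obtain ⟨C, hC⟩ := (isCompact_Icc.prod (isCompact_univ (X := UnitSphere n))).exists_bound_of_continuousOn
      hc'
    have hswap : Integrable (fun q : ℝ × UnitSphere n => g' (projIcc a b hab.le q.1, q.2))
        ((volume.restrict (Ioc a s)).prod (sph n)) :=
      (integrable_const C).mono'
        (continuous_extend hab.le (g := fun z (θ : UnitSphere n) => g' (z, θ)) hc').aestronglyMeasurable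
        (Filter.Eventually.of_forall fun q => hC (_, q.2) ⟨(projIcc a b hab.le q.1).2, trivial⟩)
    simp only [intervalIntegral.integral_of_le hs.1, hm]
    exact (integral_integral_swap (f := fun (t : ℝ) (θ : UnitSphere n) =>
      g' (projIcc a b hab.le t, θ)) hswap).symm
  have h3 : HasDerivAt (fun s => ∫ θ : UnitSphere n, g (a, θ) ∂(sph n) + ∫ t in a..s, m t) (m z) z :=
    (intervalIntegral.integral_hasDerivAt_right (hmc.intervalIntegrable _ _)
      (hmc.stronglyMeasurableAtFilter _ _) hmc.continuousAt).const_add _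
  have h4 := h3.hasDerivWithinAt (s := Icc a b)
  simp only [hm] at h4
  rw [projIcc_of_mem hab.le hz] at h4
  exact h4.congr (fun s hs => hftc s hs) (hftc z hz)

lemma D_sphere_integral (hab : a < b) {g : ℝ × Cross n → ℝ}
    (hg : ContDiffOn ℝ ∞ g (Icc a b ×ˢ univ)) {z : ℝ} (hz : z ∈ Icc a b) :
    D a b (fun s => ∫ θ : UnitSphere n, g (s, θ) ∂(sph n)) z =
      ∫ θ : UnitSphere n, pd (Icc a b ×ˢ univ) (1, 0) g (z, θ) ∂(sph n) :=
  D_eq hab hz (hasDerivWithinAt_sphere_integral hab hg hz)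

lemma sphere_integral_smooth (hab : a < b) {g : ℝ × Cross n → ℝ}
    (hg : ContDiffOn ℝ ∞ g (Icc a b ×ˢ univ)) :
    ContDiffOn ℝ ∞ (fun z => ∫ θ : UnitSphere n, g (z, θ) ∂(sph n)) (Icc a b) := by
  refine contDiffOn_infty.2 fun k => ?_
  induction k generalizing g with
  | zero =>
    exact contDiffOn_zero.2 (fun z hz => (hasDerivWithinAt_sphere_integral hab hg hz).continuousWithinAt)
  | succ k ih =>
    rw [Nat.cast_add, Nat.cast_one, contDiffOn_succ_iff_derivWithin (uniqueDiffOn_Icc hab)]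
    refine ⟨fun z hz => (hasDerivWithinAt_sphere_integral hab hg hz).differentiableWithinAt,
      by simp, ?_⟩
    exact (ih (pd_smooth (uniqueDiffOn_cyl hab) (1, 0) hg)).congr fun z hz =>
      D_sphere_integral hab hg hz

end Parametric

/-! ### The area element to second order -/

section AreaElement

open Filter
open scoped Topology

lemma hasDerivWithinAt_pow_div {n : ℕ} {r : ℝ → ℝ} {r' t : ℝ} {s : Set ℝ}
    (hr : HasDerivWithinAt r r' s t) (h0 : r t ≠ 0) :
    HasDerivWithinAt (fun e => r e ^ n) (n * (r t ^ n / r t) * r') s t := by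
  refine (hr.fun_pow n).congr_deriv ?_
  cases n with
  | zero => simp
  | succ n => rw [Nat.add_sub_cancel, pow_succ, mul_div_cancel_right₀ _ h0]

lemma hasDerivAt_pow_div {n : ℕ} {r : ℝ → ℝ} {r' t : ℝ} (hr : HasDerivAt r r' t) (h0 : r t ≠ 0) :
    HasDerivAt (fun e => r e ^ n) (n * (r t ^ n / r t) * r') t := by
  rw [← hasDerivWithinAt_univ] at hr ⊢
  exact hasDerivWithinAt_pow_div hr h0

/-- The second derivative at `0` of an area element `r ^ n * √(1 + p ^ 2 + Q / r ^ 2)`. In the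
application `Q` is the squared spherical gradient of the radius, which vanishes together with its
first derivative when the surface at `0` is axially symmetric. -/
lemma second_deriv_area_element (n : ℕ) {r r1 p p1 Q Q1 G1 : ℝ → ℝ} {r2 p2 q2 G2 : ℝ}
    (hr : ∀ᶠ e in 𝓝 0, HasDerivAt r (r1 e) e) (hp : ∀ᶠ e in 𝓝 0, HasDerivAt p (p1 e) e)
    (hQ : ∀ᶠ e in 𝓝 0, HasDerivAt Q (Q1 e) e) (hr2 : HasDerivAt r1 r2 0)
    (hp2 : HasDerivAt p1 p2 0) (hq2 : HasDerivAt Q1 q2 0) (hpos : 0 < r 0)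
    (hQ0 : Q 0 = 0) (hQ10 : Q1 0 = 0) (hQnn : ∀ e, 0 ≤ Q e)
    (hG : ∀ᶠ e in 𝓝 0, HasDerivAt (fun e => r e ^ n * √(1 + p e ^ 2 + Q e / r e ^ 2)) (G1 e) e)
    (hG2 : HasDerivAt G1 G2 0) {w : ℝ} (hw : w = √(1 + p 0 ^ 2)) :
    G2 = n * (n - 1) * (r 0 ^ n / r 0 ^ 2) * w * r1 0 ^ 2 + n * (r 0 ^ n / r 0) * w * r2
      + 2 * n * (r 0 ^ n / r 0) * (p 0 / w) * r1 0 * p1 0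
      + r 0 ^ n * ((p1 0 ^ 2 + p 0 * p2) / w - p 0 ^ 2 * p1 0 ^ 2 / w ^ 3)
      + r 0 ^ n / r 0 ^ 2 * q2 / (2 * w) := by
  have hr0 := hr.self_of_nhds
  have hp0 := hp.self_of_nhds
  have hq0 := hQ.self_of_nhds
  have hne : r 0 ≠ 0 := hpos.ne'
  have hposev : ∀ᶠ e in 𝓝 0, 0 < r e := hr0.continuousAt.eventually (lt_mem_nhds hpos)
  have hw0 : 0 < w := by rw [hw]; positivity
  have hw2 : w ^ 2 = 1 + p 0 ^ 2 := by rw [hw, Real.sq_sqrt (by positivity)]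
  set W : ℝ → ℝ := fun e => 1 + p e ^ 2 + Q e / r e ^ 2 with hW
  have hWpos : ∀ e, 0 < W e := fun e => by
    have h1 := div_nonneg (hQnn e) (sq_nonneg (r e))
    have h2 := sq_nonneg (p e)
    simp only [hW]
    linarith
  have hW0 : √(W 0) = w := by simp [hW, hQ0, hw]
  set W1 : ℝ → ℝ := fun e => 2 * p e * p1 e + (Q1 e * r e ^ 2 - Q e * (2 * r e * r1 e)) / (r e ^ 2) ^ 2
    with hW1
  have dW : ∀ᶠ e in 𝓝 0, HasDerivAt W (W1 e) e := by
    filter_upwards [hr, hp, hQ, hposev] with e h1 h2 h3 h4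
    have h5 := (((h2.fun_pow 2).const_add 1).add (h3.div (h1.fun_pow 2) (by positivity)))
    refine h5.congr_deriv ?_
    simp [hW1]
  set G1' : ℝ → ℝ := fun e => n * (r e ^ n / r e) * r1 e * √(W e) + r e ^ n * (W1 e / (2 * √(W e)))
    with hG1'
  have dG : G1 =ᶠ[𝓝 0] G1' := by
    filter_upwards [hr, dW, hposev, hG] with e h1 h2 h3 h4
    exact h4.unique ((hasDerivAt_pow_div h1 h3.ne').mul (h2.sqrt (hWpos e).ne'))
  have dW2 : HasDerivAt W1 (2 * (p1 0 ^ 2 + p 0 * p2) + q2 / r 0 ^ 2) 0 := by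
    have h5 := ((hp0.const_mul 2).mul hp2).add (((hq2.mul (hr0.fun_pow 2)).sub
      (hq0.mul ((hr0.const_mul 2).mul hr2))).div ((hr0.fun_pow 2).fun_pow 2) (by positivity))
    refine h5.congr_deriv ?_
    simp only [hQ0, hQ10, Pi.mul_apply, Pi.sub_apply]
    field_simp
    ring
  have ds : HasDerivAt (fun e => √(W e)) (p 0 * p1 0 / w) 0 := by
    refine (dW.self_of_nhds.sqrt (hWpos 0).ne').congr_deriv ?_
    rw [hW0]
    simp only [hW1, hQ0, hQ10]
    field_simp
    ring
  have hs0 : √(W 0) ≠ 0 := by rw [hW0]; exact hw0.ne'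
  have dpow := hasDerivAt_pow_div (n := n) hr0 hne
  have h6 := ((((dpow.div hr0 hne).const_mul (n : ℝ)).mul hr2).mul ds).add
    (dpow.mul (dW2.div (ds.const_mul 2) (mul_ne_zero two_ne_zero hs0)))
  have h7 := hG2.unique (HasDerivAt.congr_of_eventuallyEq (f := G1') h6 dG)
  rw [h7]
  simp only [Pi.mul_apply, Pi.div_apply, hW0]
  simp only [hW1, hQ0, hQ10]
  field_simp
  ring

end AreaElement

/-- The algebra behind the second variation: for a surface of constant mean curvature, the second
variation of the area element is the Jacobi integrand, up to a multiple of the second variation of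
the volume element and an exact derivative. -/
lemma second_variation_algebra {n h p q H w f f' g g' s : ℝ} (hh : h ≠ 0) (hw : w ≠ 0)
    (hw2 : w ^ 2 = 1 + p ^ 2) :
    n * (n - 1) * (H / h ^ 2) * w * f ^ 2 + n * (H / h) * w * g
      + 2 * n * (H / h) * (p / w) * f * f' + H * ((f' ^ 2 + p * g') / w - p ^ 2 * f' ^ 2 / w ^ 3)
      + H / h ^ 2 * (2 * s) / (2 * w) =
    H / w ^ 3 * f' ^ 2 + H / h ^ 2 / w * s - n * (H / h ^ 2) / w * f ^ 2
      + (n / (h * w) - q / w ^ 3) * (n * (H / h) * f ^ 2 + H * g)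
      + (n * (n - 1) * (H / h ^ 2) * (p ^ 2 / w) * f ^ 2 + n * (H / h) * (q / w ^ 3) * f ^ 2
        + 2 * n * (H / h) * (p / w) * f * f' + n * (H / h) * (p ^ 2 / w) * g + H * (q / w ^ 3) * g
        + H * (p / w) * g') := by
  have hp : p ^ 2 = w ^ 2 - 1 := by linarith
  field_simp
  rw [hp]
  ring

/-! ### Variations: derivatives of a family of radial graphs -/

section Box

open Filter
open scoped Topology

variable {n : ℕ} {a b δ : ℝ}

/-- The domain `(-δ, δ) × [a, b] × ℝ^{n+1}` of a variation. -/
def box (n : ℕ) (δ a b : ℝ) : Set (ℝ × ℝ × Cross n) := Ioo (-δ) δ ×ˢ Icc a b ×ˢ univ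

lemma mem_box {ε z : ℝ} (hε : ε ∈ Ioo (-δ) δ) (hz : z ∈ Icc a b) (θ : Cross n) :
    (ε, z, θ) ∈ box n δ a b := ⟨hε, hz, trivial⟩

lemma box_uniqueDiffOn (hab : a < b) : UniqueDiffOn ℝ (box n δ a b) :=
  isOpen_Ioo.uniqueDiffOn.prod ((uniqueDiffOn_Icc hab).prod uniqueDiffOn_univ)

lemma box_subset_closure (hab : a < b) :
    box n δ a b ⊆ closure (interior (box n δ a b)) := by
  unfold box
  rw [interior_prod_eq, interior_prod_eq, interior_Ioo, interior_Icc, interior_univ,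
    closure_prod_eq, closure_prod_eq, closure_Ioo hab.ne, closure_univ]
  exact prod_mono subset_closure subset_rfl

lemma hasDerivAt_fst {S : Set (ℝ × ℝ × Cross n)} {g : ℝ × ℝ × Cross n → ℝ}
    (hg : ContDiffOn ℝ ∞ g S) {ε z : ℝ} {θ : Cross n} (hS : ∀ᶠ e in 𝓝 ε, (e, z, θ) ∈ S) :
    HasDerivAt (fun e => g (e, z, θ)) (pd S (1, 0, 0) g (ε, z, θ)) ε := by
  have hc : HasDerivAt (fun e : ℝ => (e, z, θ)) ((1, 0, 0) : ℝ × ℝ × Cross n) ε :=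
    (hasDerivAt_id ε).prodMk (hasDerivAt_const ε (z, θ))
  exact (pd_hasDerivWithinAt hg (I := {e | (e, z, θ) ∈ S}) hc.hasDerivWithinAt (fun _ h => h)
    hS.self_of_nhds).hasDerivAt hS

lemma eventually_mem_box {ε z : ℝ} (hε : ε ∈ Ioo (-δ) δ) (hz : z ∈ Icc a b) (θ : Cross n) :
    ∀ᶠ e in 𝓝 ε, (e, z, θ) ∈ box n δ a b :=
  (isOpen_Ioo.eventually_mem hε).mono fun _ he => mem_box he hz θ

lemma eventually_mem_box_inter {u : Set (ℝ × ℝ × Cross n)} (hu : IsOpen u) {ε z : ℝ}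
    {θ : Cross n} (h : (ε, z, θ) ∈ box n δ a b ∩ u) :
    ∀ᶠ e in 𝓝 ε, (e, z, θ) ∈ box n δ a b ∩ u := by
  have hc : Continuous fun e : ℝ => (e, z, θ) := by fun_prop
  exact (eventually_mem_box h.1.1 h.1.2.1 θ).and (hc.continuousAt.eventually (hu.mem_nhds h.2))

lemma box_D (hab : a < b) {g : ℝ × ℝ × Cross n → ℝ} (hg : ContDiffOn ℝ ∞ g (box n δ a b))
    {ε z : ℝ} (hε : ε ∈ Ioo (-δ) δ) (hz : z ∈ Icc a b) (θ : Cross n) :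
    D a b (fun s => g (ε, s, θ)) z = pd (box n δ a b) (0, 1, 0) g (ε, z, θ) := by
  have hc : HasDerivAt (fun s : ℝ => (ε, s, θ)) ((0, 1, 0) : ℝ × ℝ × Cross n) z :=
    (hasDerivAt_const z ε).prodMk ((hasDerivAt_id z).prodMk (hasDerivAt_const z θ))
  exact D_eq hab hz (pd_hasDerivWithinAt hg hc.hasDerivWithinAt (fun s hs => mem_box hε hs θ)
    (mem_box hε hz θ))

/-- Directional derivatives commute with the derivative in the parameter of the variation. -/
lemma hasDerivAt_pd (hab : a < b) {g : ℝ × ℝ × Cross n → ℝ}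
    (hg : ContDiffOn ℝ ∞ g (box n δ a b)) (v : ℝ × ℝ × Cross n) {ε z : ℝ}
    (hε : ε ∈ Ioo (-δ) δ) (hz : z ∈ Icc a b) (θ : Cross n) :
    HasDerivAt (fun e => pd (box n δ a b) v g (e, z, θ))
      (pd (box n δ a b) v (pd (box n δ a b) (1, 0, 0) g) (ε, z, θ)) ε := by
  rw [pd_comm (box_uniqueDiffOn hab) (box_subset_closure hab) _ _ hg (mem_box hε hz θ)]
  exact hasDerivAt_fst (pd_smooth (box_uniqueDiffOn hab) v hg) (eventually_mem_box hε hz θ)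

/-- The tangential gradient in the angular variable, in coordinates: `e_i - θ_i θ` is the
projection of the basis vector `e_i` to the tangent space of the sphere at `θ`. -/
def boxTangGrad (n : ℕ) (δ a b : ℝ) (g : ℝ × ℝ × Cross n → ℝ) (p : ℝ × ℝ × Cross n) : Cross n :=
  ∑ i, pd (box n δ a b) (0, 0, EuclideanSpace.single i 1) g p •
    (EuclideanSpace.single i 1 - p.2.2 i • p.2.2)

lemma tangGrad_eq_sum (f : Cross n → ℝ) (θ : Cross n) :
    tangGrad n f θ = ∑ i, fderiv ℝ f θ (EuclideanSpace.single i 1) •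
      (EuclideanSpace.single i 1 - θ i • θ) := by
  have h1 : ∀ v, inner ℝ (gradient f θ) v = fderiv ℝ f θ v := fun v => by
    simp [gradient]
  have h2 : ∀ i, gradient f θ i = fderiv ℝ f θ (EuclideanSpace.single i 1) := fun i => by
    rw [← h1, EuclideanSpace.inner_single_right]
    simp
  have h3 : inner ℝ (gradient f θ) θ = ∑ i, fderiv ℝ f θ (EuclideanSpace.single i 1) * θ i := by
    rw [PiLp.inner_apply]
    refine Finset.sum_congr rfl fun i _ => ?_
    rw [← h2]
    simp [mul_comm]
  ext j
  simp only [tangGrad, h3, PiLp.sub_apply, PiLp.smul_apply, smul_eq_mul, h2, smul_sub,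
    Finset.sum_sub_distrib, WithLp.ofLp_sum, Finset.sum_apply]
  rw [Finset.sum_mul]
  congr 1
  · simp
  · exact Finset.sum_congr rfl fun i _ => by ring

lemma tangGrad_slice {g : ℝ × ℝ × Cross n → ℝ} (hg : ContDiffOn ℝ ∞ g (box n δ a b)) {ε z : ℝ}
    (hε : ε ∈ Ioo (-δ) δ) (hz : z ∈ Icc a b) (θ : Cross n) :
    tangGrad n (fun y => g (ε, z, y)) θ = boxTangGrad n δ a b g (ε, z, θ) := by
  have hd : HasFDerivWithinAt g (fderivWithin ℝ g (box n δ a b) (ε, z, θ)) (box n δ a b) (ε, z, θ) :=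
    (hg.differentiableOn (by simp) _ (mem_box hε hz θ)).hasFDerivWithinAt
  have hc : HasFDerivAt (fun y : Cross n => (ε, z, y)) _ θ :=
    (hasFDerivAt_const ε θ).prodMk ((hasFDerivAt_const z θ).prodMk (hasFDerivAt_id (𝕜 := ℝ) θ))
  have h1 := hd.comp (s := univ) θ hc.hasFDerivWithinAt (fun y _ => mem_box hε hz y)
  rw [hasFDerivWithinAt_univ] at h1
  rw [tangGrad_eq_sum, boxTangGrad]
  refine Finset.sum_congr rfl fun i _ => ?_
  have h2 : fderiv ℝ (fun y => g (ε, z, y)) θ = _ := h1.fderiv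
  rw [h2]
  simp [pd]

lemma hasDerivAt_boxTangGrad (hab : a < b) {g : ℝ × ℝ × Cross n → ℝ}
    (hg : ContDiffOn ℝ ∞ g (box n δ a b)) {ε z : ℝ} (hε : ε ∈ Ioo (-δ) δ) (hz : z ∈ Icc a b)
    (θ : Cross n) :
    HasDerivAt (fun e => boxTangGrad n δ a b g (e, z, θ))
      (boxTangGrad n δ a b (pd (box n δ a b) (1, 0, 0) g) (ε, z, θ)) ε :=
  HasDerivAt.fun_sum fun i _ => (hasDerivAt_pd hab hg _ hε hz θ).smul_const
    (EuclideanSpace.single i (1 : ℝ) - θ i • θ)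

lemma boxTangGrad_smooth (hab : a < b) {g : ℝ × ℝ × Cross n → ℝ}
    (hg : ContDiffOn ℝ ∞ g (box n δ a b)) :
    ContDiffOn ℝ ∞ (boxTangGrad n δ a b g) (box n δ a b) := by
  refine ContDiffOn.sum fun i _ => (pd_smooth (box_uniqueDiffOn hab) _ hg).smul ?_
  have h1 : ContDiff ℝ ∞ fun p : ℝ × ℝ × Cross n => p.2.2 := by fun_prop
  have h2 : ContDiff ℝ ∞ fun y : Cross n => y i := by fun_prop
  exact (contDiff_const.sub ((h2.comp h1).smul h1)).contDiffOn

/-- A function that is constant on the sphere has no tangential gradient: differentiate it along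
great circles. -/
lemma tangGrad_eq_zero {f : Cross n → ℝ} {c : ℝ} (hc : ∀ θ : UnitSphere n, f θ = c)
    (hf : Differentiable ℝ f) (θ : UnitSphere n) : tangGrad n f θ = 0 := by
  set v := tangGrad n f θ with hv
  have hθ : ‖(θ : Cross n)‖ = 1 := by simp
  have horth : inner ℝ v (θ : Cross n) = 0 := inner_tangGrad f hθ
  by_contra hne
  have hvn : ‖v‖ ≠ 0 := norm_ne_zero_iff.2 hne
  set γ : ℝ → Cross n := fun t => Real.cos t • (θ : Cross n) + Real.sin t • (‖v‖⁻¹ • v) with hγ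
  have hγn : ∀ t, ‖γ t‖ = 1 := fun t => by
    have h1 : ‖γ t‖ ^ 2 = 1 := by
      simp only [hγ]
      rw [norm_add_sq_real, real_inner_smul_left, real_inner_smul_right, real_inner_smul_right,
        real_inner_comm, horth, norm_smul, norm_smul, norm_smul, hθ, norm_inv, norm_norm,
        inv_mul_cancel₀ hvn, Real.norm_eq_abs, Real.norm_eq_abs]
      simp
    exact (pow_eq_one_iff_of_nonneg (norm_nonneg _) two_ne_zero).1 h1
  have hγ' : HasDerivAt γ (‖v‖⁻¹ • v) 0 := by
    have h1 := ((Real.hasDerivAt_cos 0).smul_const (θ : Cross n)).add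
      ((Real.hasDerivAt_sin 0).smul_const (‖v‖⁻¹ • v))
    exact h1.congr_deriv (by simp)
  have h0 : γ 0 = θ := by simp [hγ]
  have hfd : HasFDerivAt f (fderiv ℝ f θ) (γ 0) := by
    rw [h0]
    exact (hf _).hasFDerivAt
  have h1 := hfd.comp_hasDerivAt (0 : ℝ) hγ'
  have h2 : f ∘ γ = fun _ => c := by
    ext t
    exact hc ⟨γ t, by simp [hγn t]⟩
  rw [h2] at h1
  have h3 := h1.unique (hasDerivAt_const 0 c)
  rw [map_smul, smul_eq_mul] at h3
  have h4 : fderiv ℝ f θ v = inner ℝ (gradient f θ) v := by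
    simp [gradient]
  have h5 : inner ℝ (gradient f (θ : Cross n)) v = ‖v‖ ^ 2 := by
    have : gradient f (θ : Cross n) = v + inner ℝ (gradient f (θ : Cross n)) θ • (θ : Cross n) := by
      simp [hv, tangGrad]
    rw [this, inner_add_left, real_inner_smul_left, real_inner_comm v (θ : Cross n), horth,
      real_inner_self_eq_norm_sq]
    simp
  rw [h4, h5] at h3
  field_simp at h3
  exact hvn h3

/-- The first two derivatives of a functional given by a smooth density. -/
lemma deriv_two_integral (hab : a < b) (hδ : 0 < δ) {u : Set (ℝ × ℝ × Cross n)} (hu : IsOpen u)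
    (hsub : ∀ ε ∈ Ioo (-δ) δ, ∀ z ∈ Icc a b, ∀ θ : UnitSphere n, (ε, z, (θ : Cross n)) ∈ u)
    {G : ℝ × ℝ × Cross n → ℝ} (hG : ContDiffOn ℝ ∞ G (box n δ a b ∩ u)) {A : ℝ → ℝ}
    (hA : ∀ ε ∈ Ioo (-δ) δ, A ε = ∫ z in a..b, ∫ θ : UnitSphere n, G (ε, z, θ) ∂(sph n)) :
    deriv A 0 = ∫ z in a..b, ∫ θ : UnitSphere n,
        pd (box n δ a b ∩ u) (1, 0, 0) G (0, z, θ) ∂(sph n) ∧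
      iteratedDeriv 2 A 0 = ∫ z in a..b, ∫ θ : UnitSphere n,
        pd (box n δ a b ∩ u) (1, 0, 0) (pd (box n δ a b ∩ u) (1, 0, 0) G) (0, z, θ) ∂(sph n) := by
  set S := box n δ a b ∩ u with hS
  have hmem : ∀ ε ∈ Ioo (-δ) δ, ∀ z ∈ Icc a b, ∀ θ : UnitSphere n, (ε, z, (θ : Cross n)) ∈ S :=
    fun ε hε z hz θ => ⟨mem_box hε hz _, hsub ε hε z hz θ⟩
  have hSu : UniqueDiffOn ℝ S := (box_uniqueDiffOn hab).inter hu
  have hcont : ∀ {K : ℝ × ℝ × Cross n → ℝ}, ContDiffOn ℝ ∞ K S → ContinuousOn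
      (fun p : ℝ × ℝ × UnitSphere n => K (p.1, p.2.1, p.2.2)) (Ioo (-δ) δ ×ˢ Icc a b ×ˢ univ) :=
    fun hK => hK.continuousOn.comp
      (f := fun p : ℝ × ℝ × UnitSphere n => (p.1, p.2.1, (p.2.2 : Cross n))) (by fun_prop)
      fun p hp => hmem _ hp.1 _ hp.2.1 _
  have hder : ∀ {K : ℝ × ℝ × Cross n → ℝ}, ContDiffOn ℝ ∞ K S → ∀ ε ∈ Ioo (-δ) δ,
      HasDerivAt (fun e => ∫ z in a..b, ∫ θ : UnitSphere n, K (e, z, θ) ∂(sph n))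
        (∫ z in a..b, ∫ θ : UnitSphere n, pd S (1, 0, 0) K (ε, z, θ) ∂(sph n)) ε :=
    fun {K} hK ε hε => hasDerivAt_integral_sphere hab.le
      (g := fun e z (θ : UnitSphere n) => K (e, z, θ)) (hcont hK)
      (hcont (pd_smooth hSu (1, 0, 0) hK))
      (fun e he z hz θ => hasDerivAt_fst hK (eventually_mem_box_inter hu (hmem e he z hz θ))) hε
  have h0 : (0 : ℝ) ∈ Ioo (-δ) δ := ⟨by linarith, hδ⟩
  have hder1 : ∀ ε ∈ Ioo (-δ) δ, deriv A ε =
      ∫ z in a..b, ∫ θ : UnitSphere n, pd S (1, 0, 0) G (ε, z, θ) ∂(sph n) := fun ε hε => by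
    have hev : A =ᶠ[𝓝 ε] _ := (isOpen_Ioo.eventually_mem hε).mono hA
    exact ((hder hG ε hε).congr_of_eventuallyEq hev).deriv
  refine ⟨hder1 0 h0, ?_⟩
  rw [iteratedDeriv_succ, iteratedDeriv_one]
  have hev : deriv A =ᶠ[𝓝 0] _ :=
    (isOpen_Ioo.eventually_mem h0).mono hder1
  exact ((hder (pd_smooth hSu (1, 0, 0) hG) 0 h0).congr_of_eventuallyEq hev).deriv

end Box

/-! ### The second variation of area -/

section SecondVariation

open Filter
open scoped Topology

variable {n : ℕ} {a b δ : ℝ}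

lemma rpow_three_halves {x : ℝ} (hx : 0 ≤ x) : x ^ (3 / 2 : ℝ) = √x ^ 3 := by
  rw [Real.rpow_div_two_eq_sqrt _ hx]
  exact_mod_cast Real.rpow_natCast (√x) 3

lemma zpow_sub_two {x : ℝ} (hx : x ≠ 0) (n : ℕ) : x ^ ((n : ℤ) - 2) = x ^ n / x ^ 2 := by
  rw [zpow_sub₀ hx, zpow_natCast]
  norm_cast

/-- The area element of a family of radial graphs, as a function on the domain of the family. -/
def areaDensity (n : ℕ) (δ a b : ℝ) (R : ℝ × ℝ × Cross n → ℝ) (q : ℝ × ℝ × Cross n) : ℝ :=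
  R q ^ n * √(1 + pd (box n δ a b) (0, 1, 0) R q ^ 2 + ‖boxTangGrad n δ a b R q‖ ^ 2 / R q ^ 2)

lemma areaDensity_smooth (hab : a < b) {R : ℝ × ℝ × Cross n → ℝ}
    (hR : ContDiffOn ℝ ∞ R (box n δ a b)) {S : Set (ℝ × ℝ × Cross n)} (hS : S ⊆ box n δ a b)
    (hpos : ∀ q ∈ S, 0 < R q) : ContDiffOn ℝ ∞ (areaDensity n δ a b R) S := by
  have h1 := hR.mono hS
  have h2 := (pd_smooth (box_uniqueDiffOn hab) (0, 1, 0) hR).mono hS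
  have h3 := (boxTangGrad_smooth hab hR).mono hS
  refine (h1.pow n).mul (ContDiffOn.sqrt ((contDiffOn_const.add (h2.pow 2)).add
    ((h3.norm_sq ℝ).div (h1.pow 2) fun q hq => (pow_pos (hpos q hq) 2).ne')) fun q _ => ?_)
  positivity

/-- The second derivative of the area element at a surface of revolution. -/
lemma second_deriv_areaDensity (hab : a < b) (hδ : 0 < δ) {R : ℝ × ℝ × Cross n → ℝ}
    (hR : ContDiffOn ℝ ∞ R (box n δ a b)) {u : Set (ℝ × ℝ × Cross n)} (hu : IsOpen u)
    (hpos : ∀ q ∈ box n δ a b ∩ u, 0 < R q) {h : ℝ → ℝ}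
    (hstart : ∀ z ∈ Icc a b, ∀ θ : UnitSphere n, R (0, z, θ) = h z) {z : ℝ} (hz : z ∈ Icc a b)
    (θ : UnitSphere n) (hθu : ((0 : ℝ), z, (θ : Cross n)) ∈ u) {f f' g g' w : ℝ}
    (hf : f = pd (box n δ a b) (1, 0, 0) R (0, z, θ))
    (hf' : f' = pd (box n δ a b) (0, 1, 0) (pd (box n δ a b) (1, 0, 0) R) (0, z, θ))
    (hg : g = pd (box n δ a b) (1, 0, 0) (pd (box n δ a b) (1, 0, 0) R) (0, z, θ))
    (hg' : g' = pd (box n δ a b) (0, 1, 0)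
      (pd (box n δ a b) (1, 0, 0) (pd (box n δ a b) (1, 0, 0) R)) (0, z, θ))
    (hw : w = √(1 + D a b h z ^ 2)) :
    pd (box n δ a b ∩ u) (1, 0, 0) (pd (box n δ a b ∩ u) (1, 0, 0) (areaDensity n δ a b R))
        (0, z, θ) =
      n * (n - 1) * (h z ^ n / h z ^ 2) * w * f ^ 2 + n * (h z ^ n / h z) * w * g
      + 2 * n * (h z ^ n / h z) * (D a b h z / w) * f * f'
      + h z ^ n * ((f' ^ 2 + D a b h z * g') / w - D a b h z ^ 2 * f' ^ 2 / w ^ 3)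
      + h z ^ n / h z ^ 2 * (2 * ‖boxTangGrad n δ a b (pd (box n δ a b) (1, 0, 0) R) (0, z, θ)‖ ^ 2)
        / (2 * w) := by
  have h0 : (0 : ℝ) ∈ Ioo (-δ) δ := ⟨by linarith, hδ⟩
  set B := box n δ a b with hB
  have hBu : UniqueDiffOn ℝ B := box_uniqueDiffOn hab
  have hSu : UniqueDiffOn ℝ (B ∩ u) := hBu.inter hu
  set R1 := pd B (1, 0, 0) R with hR1
  have sR1 : ContDiffOn ℝ ∞ R1 B := pd_smooth hBu _ hR
  set R2 := pd B (1, 0, 0) R1 with hR2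
  have sG : ContDiffOn ℝ ∞ (areaDensity n δ a b R) (B ∩ u) :=
    areaDensity_smooth hab hR inter_subset_left hpos
  have hmem : ((0 : ℝ), z, (θ : Cross n)) ∈ B ∩ u := ⟨mem_box h0 hz _, hθu⟩
  have hev : ∀ᶠ e in 𝓝 (0 : ℝ), e ∈ Ioo (-δ) δ := isOpen_Ioo.eventually_mem h0
  have hevS : ∀ᶠ e in 𝓝 (0 : ℝ), ∀ᶠ e' in 𝓝 e, (e', z, (θ : Cross n)) ∈ B ∩ u :=
    (eventually_mem_box_inter hu hmem).eventually_nhds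
  have hp0 : pd B (0, 1, 0) R (0, z, θ) = D a b h z := by
    rw [← box_D hab hR h0 hz]
    exact D_congr (fun s hs => hstart s hs θ) hz
  have hT0 : boxTangGrad n δ a b R (0, z, θ) = 0 := by
    rw [← tangGrad_slice hR h0 hz]
    refine tangGrad_eq_zero (c := h z) (fun θ => hstart z hz θ) ?_ θ
    have h1 : ContDiffOn ℝ ∞ (fun y : Cross n => R (0, z, y)) univ :=
      hR.comp (f := fun y : Cross n => ((0 : ℝ), z, y)) (by fun_prop) fun y _ => mem_box h0 hz y
    exact (contDiffOn_univ.1 h1).differentiable (by simp)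
  have hT : ∀ {K : ℝ × ℝ × Cross n → ℝ}, ContDiffOn ℝ ∞ K B → ∀ e ∈ Ioo (-δ) δ,
      HasDerivAt (fun e => boxTangGrad n δ a b K (e, z, θ))
        (boxTangGrad n δ a b (pd B (1, 0, 0) K) (e, z, θ)) e :=
    fun hK e he => hasDerivAt_boxTangGrad hab hK he hz θ
  have key := second_deriv_area_element n
    (r := fun e => R (e, z, θ)) (r1 := fun e => R1 (e, z, θ)) (r2 := g)
    (p := fun e => pd B (0, 1, 0) R (e, z, θ)) (p1 := fun e => pd B (0, 1, 0) R1 (e, z, θ))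
    (p2 := g') (Q := fun e => ‖boxTangGrad n δ a b R (e, z, θ)‖ ^ 2)
    (Q1 := fun e => 2 * inner ℝ (boxTangGrad n δ a b R (e, z, θ))
      (boxTangGrad n δ a b R1 (e, z, θ)))
    (q2 := 2 * ‖boxTangGrad n δ a b R1 (0, z, θ)‖ ^ 2)
    (G1 := fun e => pd (B ∩ u) (1, 0, 0) (areaDensity n δ a b R) (e, z, θ))
    (hev.mono fun e he => hasDerivAt_fst hR (eventually_mem_box he hz _))
    (hev.mono fun e he => hasDerivAt_pd hab hR _ he hz _)
    (hev.mono fun e he => (hT hR e he).norm_sq)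
    (by rw [hg]; exact hasDerivAt_fst sR1 (eventually_mem_box h0 hz _))
    (by rw [hg']; exact hasDerivAt_pd hab sR1 _ h0 hz _)
    (by
      refine (((hT hR 0 h0).inner ℝ (hT sR1 0 h0)).const_mul 2).congr_deriv ?_
      rw [hT0, inner_zero_left, real_inner_self_eq_norm_sq, zero_add])
    (hpos _ hmem) (by simp only [hT0]; simp) (by simp only [hT0]; simp)
    (fun e => sq_nonneg _)
    (hevS.mono fun e he => hasDerivAt_fst sG he)
    (hasDerivAt_fst (pd_smooth hSu _ sG) (eventually_mem_box_inter hu hmem))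
    (w := w) (by rw [hw]; simp only [hp0])
  rw [key]
  simp only [hp0, hstart z hz θ, hf, hf']

/-- The first two derivatives of the volume element. -/
lemma deriv_volumeDensity (hab : a < b) (hδ : 0 < δ) {R : ℝ × ℝ × Cross n → ℝ}
    (hR : ContDiffOn ℝ ∞ R (box n δ a b)) {u : Set (ℝ × ℝ × Cross n)} (hu : IsOpen u)
    (hpos : ∀ q ∈ box n δ a b ∩ u, 0 < R q) {z : ℝ} (hz : z ∈ Icc a b)
    (θ : UnitSphere n) (hθu : ((0 : ℝ), z, (θ : Cross n)) ∈ u) :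
    pd (box n δ a b ∩ u) (1, 0, 0) (fun q => R q ^ (n + 1) / ((n : ℝ) + 1)) (0, z, θ) =
        R (0, z, θ) ^ n * pd (box n δ a b) (1, 0, 0) R (0, z, θ) ∧
    pd (box n δ a b ∩ u) (1, 0, 0) (pd (box n δ a b ∩ u) (1, 0, 0)
        (fun q => R q ^ (n + 1) / ((n : ℝ) + 1))) (0, z, θ) =
      n * (R (0, z, θ) ^ n / R (0, z, θ)) * pd (box n δ a b) (1, 0, 0) R (0, z, θ) ^ 2
      + R (0, z, θ) ^ n
        * pd (box n δ a b) (1, 0, 0) (pd (box n δ a b) (1, 0, 0) R) (0, z, θ) := by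
  have h0 : (0 : ℝ) ∈ Ioo (-δ) δ := ⟨by linarith, hδ⟩
  set B := box n δ a b with hB
  have hBu : UniqueDiffOn ℝ B := box_uniqueDiffOn hab
  have hSu : UniqueDiffOn ℝ (B ∩ u) := hBu.inter hu
  set R1 := pd B (1, 0, 0) R with hR1
  have sR1 : ContDiffOn ℝ ∞ R1 B := pd_smooth hBu _ hR
  have hmem : ((0 : ℝ), z, (θ : Cross n)) ∈ B ∩ u := ⟨mem_box h0 hz _, hθu⟩
  have sV : ContDiffOn ℝ ∞ (fun q => R q ^ (n + 1) / ((n : ℝ) + 1)) (B ∩ u) :=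
    ((hR.mono inter_subset_left).pow (n + 1)).div_const _
  have hn1 : (n : ℝ) + 1 ≠ 0 := by positivity
  have hdR : ∀ e ∈ Ioo (-δ) δ, HasDerivAt (fun e => R (e, z, θ)) (R1 (e, z, θ)) e :=
    fun e he => hasDerivAt_fst hR (eventually_mem_box he hz _)
  have hdV : ∀ e, (∀ᶠ e' in 𝓝 e, (e', z, (θ : Cross n)) ∈ B ∩ u) →
      pd (B ∩ u) (1, 0, 0) (fun q => R q ^ (n + 1) / ((n : ℝ) + 1)) (e, z, θ) =
        R (e, z, θ) ^ n * R1 (e, z, θ) := fun e he => by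
    have h1 := hasDerivAt_fst sV he
    have h2 := (((hdR e he.self_of_nhds.1.1).fun_pow (n + 1)).div_const ((n : ℝ) + 1))
    rw [h1.unique h2]
    push_cast
    field_simp
  have hevS := eventually_mem_box_inter hu hmem
  refine ⟨hdV 0 hevS, ?_⟩
  have h1 := hasDerivAt_fst (pd_smooth hSu (1, 0, 0) sV) hevS
  have h2 := (hasDerivAt_pow_div (n := n) (hdR 0 h0) (hpos _ hmem).ne').mul
    (hasDerivAt_fst sR1 (eventually_mem_box h0 hz (θ : Cross n)))
  have h3 : (fun e => pd (B ∩ u) (1, 0, 0) (fun q => R q ^ (n + 1) / ((n : ℝ) + 1)) (e, z, θ))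
      =ᶠ[𝓝 0] _ := hevS.eventually_nhds.mono hdV
  rw [h1.unique (h2.congr_of_eventuallyEq h3)]
  ring

end SecondVariation

section SecondVariationFormula

open Filter
open scoped Topology

variable {n : ℕ} {a b δ : ℝ}

lemma integral_sphere_add (hab : a ≤ b) {g₁ g₂ : ℝ → UnitSphere n → ℝ}
    (h₁ : ContinuousOn (fun q : ℝ × UnitSphere n => g₁ q.1 q.2) (Icc a b ×ˢ univ))
    (h₂ : ContinuousOn (fun q : ℝ × UnitSphere n => g₂ q.1 q.2) (Icc a b ×ˢ univ)) :
    ∫ z in a..b, ∫ θ, (g₁ z θ + g₂ z θ) ∂(sph n) =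
      (∫ z in a..b, ∫ θ, g₁ z θ ∂(sph n)) + ∫ z in a..b, ∫ θ, g₂ z θ ∂(sph n) := by
  rw [← intervalIntegral.integral_add
    (intervalIntegrable_of_contOn hab (continuousOn_integral_sphere hab h₁))
    (intervalIntegrable_of_contOn hab (continuousOn_integral_sphere hab h₂))]
  exact integral_congr_Icc hab fun z hz =>
    integral_add (sphere_integrable (slice_continuous h₁ hz))
      (sphere_integrable (slice_continuous h₂ hz))

lemma integral_sphere_const_mul (c : ℝ) (g : ℝ → UnitSphere n → ℝ) :
    ∫ z in a..b, ∫ θ, c * g z θ ∂(sph n) = c * ∫ z in a..b, ∫ θ, g z θ ∂(sph n) := by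
  simp_rw [integral_const_mul]
  exact intervalIntegral.integral_const_mul _ _

/-- An exact `z`-derivative that vanishes at the two ends integrates to zero. -/
lemma integral_flux (hab : a < b) {B : ℝ × Cross n → ℝ}
    (hB : ContDiffOn ℝ ∞ B (Icc a b ×ˢ univ)) (ha : ∀ θ, B (a, θ) = 0) (hb : ∀ θ, B (b, θ) = 0) :
    ∫ z in a..b, ∫ θ : UnitSphere n, pd (Icc a b ×ˢ univ) (1, 0) B (z, θ) ∂(sph n) = 0 := by
  rw [integral_congr_Icc hab.le fun z hz => (D_sphere_integral hab hB hz).symm,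
    integral_D hab (sphere_integral_smooth hab hB)]
  simp [ha, hb]

/-- The initial normal velocity of a family of radial graphs. -/
def velocity (ρ : ℝ → ℝ → Cross n → ℝ) (z : ℝ) (θ : Cross n) : ℝ := deriv (fun ε => ρ ε z θ) 0

/-- The integrand of the second variation of area on `[a, b] × S^n`. -/
def jacobiDensity (n : ℕ) (a b : ℝ) (h : ℝ → ℝ) (f : ℝ → Cross n → ℝ) (z : ℝ) (θ : Cross n) : ℝ :=
  sigma n a b h z * D a b (fun s => f s θ) z ^ 2
    + h z ^ ((n : ℤ) - 2) / √(1 + D a b h z ^ 2) * sphereGradSq n (f z) θ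
    - n * h z ^ ((n : ℤ) - 2) / √(1 + D a b h z ^ 2) * f z θ ^ 2

lemma IsEquilibrium.multiplier {h : ℝ → ℝ} (hX : IsEquilibrium n a b h) :
    ∃ μ : ℝ, ∀ z ∈ Icc a b, n / (h z * √(1 + D a b h z ^ 2))
      - D a b (D a b h) z / √(1 + D a b h z ^ 2) ^ 3 = μ := by
  obtain ⟨H₀, hH⟩ := hX.cmc
  refine ⟨-((n : ℝ) + 1) * H₀, fun z hz => ?_⟩
  have hn1 : (n : ℝ) + 1 ≠ 0 := by positivity
  have := hH z hz
  unfold meanCurvature at this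
  rw [rpow_three_halves (by positivity)] at this
  rw [← this]
  field_simp
  ring

/-- The second variation formula. The constant mean curvature acts as a Lagrange multiplier for
the volume constraint, which removes the second-order part of the variation. -/
theorem second_variation (hab : a < b) {h : ℝ → ℝ} (hX : IsEquilibrium n a b h) (hδ : 0 < δ)
    {ρ : ℝ → ℝ → Cross n → ℝ} (hV : IsVolumePreservingVariation n a b h δ ρ) :
    ContDiffOn ℝ ∞ (fun q : ℝ × Cross n => velocity ρ q.1 q.2) (Icc a b ×ˢ univ) ∧
      ∫ z in a..b, ∫ θ : UnitSphere n, h z ^ n * velocity ρ z θ ∂(sph n) = 0 ∧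
      iteratedDeriv 2 (fun ε => area n a b (ρ ε)) 0 =
        ∫ z in a..b, ∫ θ : UnitSphere n, jacobiDensity n a b h (velocity ρ) z θ ∂(sph n) := by
  have h0 : (0 : ℝ) ∈ Ioo (-δ) δ := ⟨by linarith, hδ⟩
  set R : ℝ × ℝ × Cross n → ℝ := fun p => ρ p.1 p.2.1 p.2.2 with hRdef
  set B := box n δ a b with hB
  have hR : ContDiffOn ℝ ∞ R B := hV.smooth
  have hBu : UniqueDiffOn ℝ B := box_uniqueDiffOn hab
  set R1 := pd B (1, 0, 0) R with hR1
  have sR1 : ContDiffOn ℝ ∞ R1 B := pd_smooth hBu _ hR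
  set R2 := pd B (1, 0, 0) R1 with hR2
  have sR2 : ContDiffOn ℝ ∞ R2 B := pd_smooth hBu _ sR1
  -- a neighbourhood of the sphere on which the radius is positive
  obtain ⟨u, hu, huR⟩ := continuousOn_iff'.1 hR.continuousOn (Ioi 0) isOpen_Ioi
  have hpos : ∀ q ∈ B ∩ u, 0 < R q := fun q hq => by
    have : q ∈ R ⁻¹' Ioi 0 ∩ B := by rw [huR]; exact ⟨hq.2, hq.1⟩
    exact this.1
  have hsub : ∀ ε ∈ Ioo (-δ) δ, ∀ z ∈ Icc a b, ∀ θ : UnitSphere n, (ε, z, (θ : Cross n)) ∈ u := by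
    intro ε hε z hz θ
    have : (ε, z, (θ : Cross n)) ∈ R ⁻¹' Ioi 0 ∩ B := ⟨hV.pos ε hε z hz θ, mem_box hε hz _⟩
    rw [huR] at this
    exact this.1
  have hSu : UniqueDiffOn ℝ (B ∩ u) := hBu.inter hu
  have sG : ContDiffOn ℝ ∞ (areaDensity n δ a b R) (B ∩ u) :=
    areaDensity_smooth hab hR inter_subset_left hpos
  have sV : ContDiffOn ℝ ∞ (fun q => R q ^ (n + 1) / ((n : ℝ) + 1)) (B ∩ u) :=
    ((hR.mono inter_subset_left).pow (n + 1)).div_const _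
  obtain ⟨-, hA2⟩ := deriv_two_integral hab hδ hu hsub sG (A := fun ε => area n a b (ρ ε))
    (fun ε hε => by
      refine integral_congr_Icc hab.le fun z hz =>
        integral_congr_ae (Eventually.of_forall fun θ => ?_)
      have h1 := box_D hab hR hε hz (θ : Cross n)
      have h2 := tangGrad_slice hR hε hz (θ : Cross n)
      simp only [hRdef] at h1 h2
      simp only [areaDensity, sphereGradSq_eq, ← hB]
      rw [h1, h2])
  obtain ⟨hV1, hV2⟩ := deriv_two_integral hab hδ hu hsub sV
    (A := fun ε => enclosedVolume n a b (ρ ε)) (fun ε hε => rfl)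
  have hVc : (fun ε => enclosedVolume n a b (ρ ε)) =ᶠ[𝓝 0] fun _ => enclosedVolume n a b (ρ 0) :=
    (isOpen_Ioo.eventually_mem h0).mono hV.volume_eq
  rw [hVc.deriv_eq, deriv_const] at hV1
  rw [iteratedDeriv_succ, iteratedDeriv_one, hVc.deriv.deriv_eq] at hV2
  simp only [deriv_const', deriv_const] at hV2
  have hstart : ∀ z ∈ Icc a b, ∀ θ : UnitSphere n, R (0, z, θ) = h z := hV.start
  have hvel : ∀ z ∈ Icc a b, ∀ θ, velocity ρ z θ = R1 (0, z, θ) := fun z hz θ =>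
    (hasDerivAt_fst hR (eventually_mem_box h0 hz θ)).deriv
  have hcyl : ∀ {K : ℝ × ℝ × Cross n → ℝ}, ContDiffOn ℝ ∞ K B →
      ContDiffOn ℝ ∞ (fun q : ℝ × Cross n => K (0, q)) (Icc a b ×ˢ univ) := fun hK =>
    hK.comp (f := fun q : ℝ × Cross n => ((0 : ℝ), q)) (by fun_prop) fun q hq => ⟨h0, hq⟩
  have hdv := fun z (hz : z ∈ Icc a b) (θ : UnitSphere n) =>
    deriv_volumeDensity hab hδ hR hu hpos hz θ (hsub 0 h0 z hz θ)
  refine ⟨(hcyl sR1).congr fun q hq => hvel q.1 hq.1 q.2, ?_, ?_⟩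
  · rw [hV1]
    refine integral_congr_Icc hab.le fun z hz =>
      integral_congr_ae (Eventually.of_forall fun θ => ?_)
    simp only
    rw [(hdv z hz θ).1, hstart z hz θ, hvel z hz]
  -- the flux whose derivative appears in the second variation
  have hDh := D_smooth hab hX.smooth
  set F : ℝ × Cross n → ℝ := fun q =>
    n * (h q.1 ^ n / h q.1) * (D a b h q.1 / √(1 + D a b h q.1 ^ 2)) * R1 (0, q) ^ 2
      + h q.1 ^ n * (D a b h q.1 / √(1 + D a b h q.1 ^ 2)) * R2 (0, q) with hF
  have c1 : ContDiffOn ℝ ∞ (fun q : ℝ × Cross n => h q.1) (Icc a b ×ˢ univ) :=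
    hX.smooth.comp contDiffOn_fst fun q hq => hq.1
  have c2 : ContDiffOn ℝ ∞ (fun q : ℝ × Cross n => D a b h q.1) (Icc a b ×ˢ univ) :=
    hDh.comp contDiffOn_fst fun q hq => hq.1
  have c3 : ContDiffOn ℝ ∞ (fun q : ℝ × Cross n => D a b h q.1 / √(1 + D a b h q.1 ^ 2))
      (Icc a b ×ˢ univ) :=
    c2.div ((contDiffOn_const.add (c2.pow 2)).sqrt fun q _ => by positivity)
      fun q _ => by positivity
  have sF : ContDiffOn ℝ ∞ F (Icc a b ×ˢ univ) :=
    (((contDiffOn_const.mul ((c1.pow n).div c1 fun q hq => (hX.pos _ hq.1).ne')).mul c3).mul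
      ((hcyl sR1).pow 2)).add (((c1.pow n).mul c3).mul (hcyl sR2))
  have hflux := integral_flux hab sF (fun θ => by simp [hF, hX.perp_left])
    (fun θ => by simp [hF, hX.perp_right])
  have dF : ∀ z ∈ Icc a b, ∀ θ : Cross n, ∀ w, w = √(1 + D a b h z ^ 2) →
      pd (Icc a b ×ˢ univ) (1, 0) F (z, θ) =
      n * (n - 1) * (h z ^ n / h z ^ 2) * (D a b h z ^ 2 / w) * R1 (0, z, θ) ^ 2
        + n * (h z ^ n / h z) * (D a b (D a b h) z / w ^ 3) * R1 (0, z, θ) ^ 2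
        + 2 * n * (h z ^ n / h z) * (D a b h z / w) * R1 (0, z, θ)
          * pd B (0, 1, 0) R1 (0, z, θ)
        + n * (h z ^ n / h z) * (D a b h z ^ 2 / w) * R2 (0, z, θ)
        + h z ^ n * (D a b (D a b h) z / w ^ 3) * R2 (0, z, θ)
        + h z ^ n * (D a b h z / w) * pd B (0, 1, 0) R2 (0, z, θ) := by
    intro z hz θ w hw
    have hw0 : 0 < w := by rw [hw]; positivity
    have hw2 : D a b h z ^ 2 = w ^ 2 - 1 := by
      rw [hw, Real.sq_sqrt (by positivity)]; ring
    have hh0 := (hX.pos z hz).ne'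
    rw [← cyl_D hab sF θ hz]
    have dh := D_hasDeriv hX.smooth hz
    have dp := D_hasDeriv hDh hz
    have slice : ∀ {K : ℝ × ℝ × Cross n → ℝ}, ContDiffOn ℝ ∞ K B →
        HasDerivWithinAt (fun s => K (0, s, θ)) (pd B (0, 1, 0) K (0, z, θ)) (Icc a b) z := by
      intro K hK
      have h1 := cyl_hasDeriv (hcyl hK) θ hz
      rw [← cyl_D hab (hcyl hK) θ hz, box_D hab hK h0 hz] at h1
      exact h1
    have d1 := slice sR1
    have d2 := slice sR2
    have dpow := hasDerivWithinAt_pow_div (n := n) dh hh0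
    have dw : HasDerivWithinAt (fun s => √(1 + D a b h s ^ 2)) (D a b h z * D a b (D a b h) z / w)
        (Icc a b) z := by
      refine ((dp.fun_pow 2).const_add 1).sqrt (by positivity) |>.congr_deriv ?_
      rw [← hw]
      field_simp
      simp
      ring
    have dq := dp.div dw (by rw [← hw]; exact hw0.ne')
    refine D_eq hab hz (((((dpow.div dh hh0).const_mul (n : ℝ)).mul dq).mul (d1.fun_pow 2)).add
      ((dpow.mul dq).mul d2) |>.congr_deriv ?_)
    simp only [Pi.mul_apply, Pi.div_apply, ← hw]
    field_simp
    simp only [hw2]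
    ring
  obtain ⟨μ, hμ⟩ := hX.multiplier
  -- continuity of the three parts
  have hcont : ∀ {K : ℝ × ℝ × Cross n → ℝ}, ContDiffOn ℝ ∞ K (B ∩ u) →
      ContinuousOn (fun q : ℝ × UnitSphere n => K (0, q.1, q.2)) (Icc a b ×ˢ univ) := fun hK =>
    hK.continuousOn.comp (f := fun q : ℝ × UnitSphere n => ((0 : ℝ), q.1, (q.2 : Cross n)))
      (by fun_prop) fun q hq => ⟨mem_box h0 hq.1 _, hsub 0 h0 _ hq.1 _⟩
  have k1 := hcont (pd_smooth hSu (1, 0, 0) (pd_smooth hSu (1, 0, 0) sG))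
  have k2 := hcont (pd_smooth hSu (1, 0, 0) (pd_smooth hSu (1, 0, 0) sV))
  have k3 := cyl_continuousOn (pd_smooth (uniqueDiffOn_cyl hab) (1, 0) sF)
  have hJ : ∀ z ∈ Icc a b, ∀ θ : UnitSphere n, jacobiDensity n a b h (velocity ρ) z θ =
      pd (B ∩ u) (1, 0, 0) (pd (B ∩ u) (1, 0, 0) (areaDensity n δ a b R)) (0, z, θ)
      + (-μ * pd (B ∩ u) (1, 0, 0) (pd (B ∩ u) (1, 0, 0)
          (fun q => R q ^ (n + 1) / ((n : ℝ) + 1))) (0, z, θ)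
        + -1 * pd (Icc a b ×ˢ univ) (1, 0) F (z, θ)) := by
    intro z hz θ
    set w := √(1 + D a b h z ^ 2) with hw
    have hw0 : 0 < w := by rw [hw]; positivity
    have hw2 : w ^ 2 = 1 + D a b h z ^ 2 := by rw [hw, Real.sq_sqrt (by positivity)]
    rw [second_deriv_areaDensity hab hδ hR hu hpos hstart hz θ (hsub 0 h0 z hz θ) rfl rfl rfl rfl hw,
      (hdv z hz θ).2, hstart z hz θ, dF z hz θ w hw, ← hμ z hz, ← hw]
    rw [second_variation_algebra (q := D a b (D a b h) z) (hX.pos z hz).ne' hw0.ne' hw2]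
    have e1 : D a b (fun s => velocity ρ s θ) z = pd B (0, 1, 0) R1 (0, z, θ) := by
      rw [← box_D hab sR1 h0 hz]
      exact D_congr (fun s hs => hvel s hs θ) hz
    have e2 : sphereGradSq n (velocity ρ z) θ =
        ‖boxTangGrad n δ a b R1 (0, z, θ)‖ ^ 2 := by
      rw [sphereGradSq_eq, ← tangGrad_slice sR1 h0 hz]
      have : velocity ρ z = fun y => R1 (0, z, y) := funext fun y => hvel z hz y
      rw [this]
    unfold jacobiDensity sigma
    rw [e1, e2, hvel z hz, zpow_sub_two (hX.pos z hz).ne', rpow_three_halves (by positivity), ← hw]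
    ring
  have h1 : ∫ z in a..b, ∫ θ : UnitSphere n, jacobiDensity n a b h (velocity ρ) z θ ∂(sph n) =
      ∫ z in a..b, ∫ θ : UnitSphere n, _ ∂(sph n) :=
    integral_congr_Icc hab.le fun z hz => integral_congr_ae (Eventually.of_forall fun θ => hJ z hz θ)
  rw [h1, integral_sphere_add hab.le k1 ((continuousOn_const.mul k2).add
      (continuousOn_const.mul k3)),
    integral_sphere_add hab.le (continuousOn_const.mul k2) (continuousOn_const.mul k3),
    integral_sphere_const_mul (-μ) fun z (θ : UnitSphere n) =>
      pd (B ∩ u) (1, 0, 0) (pd (B ∩ u) (1, 0, 0)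
          (fun q => R q ^ (n + 1) / ((n : ℝ) + 1))) (0, z, θ),
    integral_sphere_const_mul (-1) fun z (θ : UnitSphere n) =>
      pd (Icc a b ×ˢ univ) (1, 0) F (z, θ), hflux, ← hV2, hA2]
  ring

end SecondVariationFormula

/-! ### Reduction of stability to axially symmetric variations -/

section Reduction

open Filter
open scoped Topology

variable {n : ℕ} {a b : ℝ} {h : ℝ → ℝ}

/-- The zeroth-order coefficient of `jacobiOp`. -/
def jacobiPot (n : ℕ) (a b : ℝ) (h : ℝ → ℝ) (z : ℝ) : ℝ :=
  n * h z ^ ((n : ℤ) - 2) / √(1 + D a b h z ^ 2)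

lemma IsEquilibrium.isRegular (hX : IsEquilibrium n a b h) (hab : a < b) :
    IsRegular a b (sigma n a b h) (jacobiPot n a b h) := by
  have hD := D_smooth hab hX.smooth
  have hs : ContDiffOn ℝ ∞ (fun z => √(1 + D a b h z ^ 2)) (Icc a b) :=
    (contDiffOn_const.add (hD.pow 2)).sqrt fun z _ => by positivity
  refine ⟨hab, ?_, ?_, fun z hz => div_pos (pow_pos (hX.pos z hz) n) (by positivity)⟩
  · refine ((hX.smooth.pow n).div (hs.pow 3) fun z _ => by positivity).congr fun z _ => ?_
    rw [sigma, rpow_three_halves (by positivity)]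
    rfl
  · refine (((contDiffOn_const (c := (n : ℝ))).mul ((hX.smooth.pow n).div (hX.smooth.pow 2)
      fun z hz => (pow_pos (hX.pos z hz) 2).ne')).div hs fun z _ => by positivity).congr
      fun z hz => ?_
    rw [jacobiPot, zpow_sub_two (hX.pos z hz).ne']
    rfl

/-- The function `h^n`, which expresses the volume constraint to first order. -/
def IsEquilibrium.constraint (hX : IsEquilibrium n a b h) : Smooth a b :=
  ⟨fun z => h z ^ n, hX.smooth.pow n⟩

lemma continuousOn_jacobiDensity (hX : IsEquilibrium n a b h) (hab : a < b) {f : ℝ → Cross n → ℝ}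
    (hf : ContDiffOn ℝ ∞ (fun q : ℝ × Cross n => f q.1 q.2) (Icc a b ×ˢ univ)) :
    ContinuousOn (fun q : ℝ × UnitSphere n => jacobiDensity n a b h f q.1 q.2)
      (Icc a b ×ˢ univ) := by
  have hreg := hX.isRegular hab
  have h0 : (0 : ℝ) ∈ Ioo (-1 : ℝ) 1 := by norm_num
  set K : ℝ × ℝ × Cross n → ℝ := fun p => f p.2.1 p.2.2 with hK
  have sK : ContDiffOn ℝ ∞ K (box n 1 a b) := hf.comp contDiffOn_snd fun p hp => hp.2
  have hfst : MapsTo (Prod.fst : ℝ × UnitSphere n → ℝ) (Icc a b ×ˢ univ) (Icc a b) :=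
    fun q hq => hq.1
  have hD : ContinuousOn (D a b h) (Icc a b) := (D_smooth hab hX.smooth).continuousOn
  have hk : ContinuousOn (fun z => h z ^ ((n : ℤ) - 2) / √(1 + D a b h z ^ 2)) (Icc a b) :=
    (hX.smooth.continuousOn.zpow₀ _ fun z hz => Or.inl (hX.pos z hz).ne').div
      (continuousOn_const.add (hD.pow 2)).sqrt fun z _ => by positivity
  have c1 := hreg.smooth_p.continuousOn.comp continuousOn_fst hfst
  have c2 := hk.comp continuousOn_fst hfst
  have c3 := hreg.smooth_q.continuousOn.comp continuousOn_fst hfst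
  have c4 := cyl_continuousOn (pd_smooth (uniqueDiffOn_cyl hab) (1, 0) hf)
  have c5 := cyl_continuousOn hf
  have c6 : ContinuousOn (fun q : ℝ × UnitSphere n => boxTangGrad n 1 a b K (0, q.1, q.2))
      (Icc a b ×ˢ univ) :=
    (boxTangGrad_smooth hab sK).continuousOn.comp
      (f := fun q : ℝ × UnitSphere n => ((0 : ℝ), q.1, (q.2 : Cross n))) (by fun_prop)
      fun q hq => mem_box h0 hq.1 _
  refine (((c1.mul (c4.pow 2)).add (c2.mul (c6.norm.pow 2))).sub (c3.mul (c5.pow 2))).congr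
    fun q hq => ?_
  have e1 := cyl_D hab hf (q.2 : Cross n) hq.1
  have e2 := tangGrad_slice sK h0 hq.1 (q.2 : Cross n)
  simp only [hK] at e1 e2
  simp only [jacobiDensity, sphereGradSq_eq]
  rw [e1, e2]
  rfl

/-- Passing to the spherical mean does not increase the second variation: the gradient term
dominates the negative term on the part of mean zero, because the lowest nonzero eigenvalue of the
sphere is `n`. -/
lemma form_mean_le (hn : 1 ≤ n) (hX : IsEquilibrium n a b h) (hab : a < b) {f : ℝ → Cross n → ℝ}
    (hf : ContDiffOn ℝ ∞ (fun q : ℝ × Cross n => f q.1 q.2) (Icc a b ×ˢ univ)) :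
    ∃ f₀ : Smooth a b,
      (∀ z, ∫ θ : UnitSphere n, f z θ ∂(sph n) = (f₀ : ℝ → ℝ) z * (sph n).real univ) ∧
      (sph n).real univ * form (hX.isRegular hab) f₀ f₀ ≤
        ∫ z in a..b, ∫ θ : UnitSphere n, jacobiDensity n a b h f z θ ∂(sph n) := by
  have hreg := hX.isRegular hab
  set s := (sph n).real univ with hs
  have hs0 : 0 < s := sph_real_pos n
  have smean := sphere_integral_smooth hab hf
  set f₀ : Smooth a b := ⟨fun z => s⁻¹ * ∫ θ : UnitSphere n, f z θ ∂(sph n),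
    contDiffOn_const.mul smean⟩ with hf₀
  have hf₀z : ∀ z, (f₀ : ℝ → ℝ) z = s⁻¹ * ∫ θ : UnitSphere n, f z θ ∂(sph n) := fun z => rfl
  have hmean : ∀ z, ∫ θ : UnitSphere n, f z θ ∂(sph n) = (f₀ : ℝ → ℝ) z * s := fun z => by
    rw [hf₀z]
    field_simp
  refine ⟨f₀, hmean, ?_⟩
  set fz := pd (Icc a b ×ˢ univ) (1, 0) (fun q : ℝ × Cross n => f q.1 q.2) with hfz
  have sfz : ContDiffOn ℝ ∞ fz (Icc a b ×ˢ univ) := pd_smooth (uniqueDiffOn_cyl hab) (1, 0) hf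
  have hDf₀ : ∀ z ∈ Icc a b, ∫ θ : UnitSphere n, fz (z, θ) ∂(sph n) = D a b f₀ z * s := by
    intro z hz
    have h1 : D a b f₀ z = s⁻¹ * D a b (fun z => ∫ θ : UnitSphere n, f z θ ∂(sph n)) z :=
      D_const_mul hab _ smean hz
    rw [h1, D_sphere_integral hab hf hz]
    field_simp
    rfl
  clear_value fz
  rw [form_apply, ← intervalIntegral.integral_const_mul]
  refine intervalIntegral.integral_mono_on hab.le ?_ ?_ fun z hz => ?_
  · exact intervalIntegrable_of_contOn hab.le (continuousOn_const.mul
      (((hreg.smooth_p.continuousOn.mul (Smooth.D_contOn hab f₀)).mul (Smooth.D_contOn hab f₀)).sub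
        ((hreg.smooth_q.continuousOn.mul (Smooth.contOn f₀)).mul (Smooth.contOn f₀))))
  · exact intervalIntegrable_of_contOn hab.le
      (continuousOn_integral_sphere (g := fun z (θ : UnitSphere n) => jacobiDensity n a b h f z θ)
        hab.le (continuousOn_jacobiDensity hX hab hf))
  have cf : Continuous fun θ : UnitSphere n => f z θ :=
    slice_continuous (g := fun z (θ : UnitSphere n) => f z θ) (cyl_continuousOn hf) hz
  have cfz : Continuous fun θ : UnitSphere n => fz (z, θ) :=
    slice_continuous (g := fun z (θ : UnitSphere n) => fz (z, θ)) (cyl_continuousOn sfz) hz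
  have sfs : ContDiff ℝ ∞ (f z) := by
    rw [← contDiffOn_univ]
    exact hf.comp (f := fun y : Cross n => (z, y)) (by fun_prop) fun y _ => ⟨hz, trivial⟩
  have cg : Continuous fun θ : UnitSphere n => sphereGradSq n (f z) θ :=
    ((continuous_tangGrad (sfs.of_le (by simp))).comp continuous_subtype_val).norm.pow 2
  set k := h z ^ ((n : ℤ) - 2) / √(1 + D a b h z ^ 2) with hk
  have hk0 : 0 ≤ k := div_nonneg (zpow_nonneg (hX.pos z hz).le _) (Real.sqrt_nonneg _)
  have hq : jacobiPot n a b h z = n * k := by rw [jacobiPot, hk, mul_div_assoc]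
  have hJ : ∫ θ : UnitSphere n, jacobiDensity n a b h f z θ ∂(sph n) =
      sigma n a b h z * (∫ θ : UnitSphere n, fz (z, θ) ^ 2 ∂(sph n))
        + k * (∫ θ : UnitSphere n, sphereGradSq n (f z) θ ∂(sph n))
        - n * k * ∫ θ : UnitSphere n, f z θ ^ 2 ∂(sph n) := by
    have t1 : Continuous fun θ : UnitSphere n => sigma n a b h z * fz (z, θ) ^ 2 :=
      continuous_const.mul (cfz.pow 2)
    have t2 : Continuous fun θ : UnitSphere n => k * sphereGradSq n (f z) θ :=
      continuous_const.mul cg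
    have t3 : Continuous fun θ : UnitSphere n => n * k * f z θ ^ 2 :=
      continuous_const.mul (cf.pow 2)
    have t4 : Continuous fun θ : UnitSphere n =>
        sigma n a b h z * fz (z, θ) ^ 2 + k * sphereGradSq n (f z) θ := t1.add t2
    rw [← integral_const_mul, ← integral_const_mul, ← integral_const_mul,
      ← integral_add (sphere_integrable t1) (sphere_integrable t2),
      ← integral_sub (sphere_integrable t4) (sphere_integrable t3)]
    refine integral_congr_ae (Eventually.of_forall fun θ => ?_)
    simp only [jacobiDensity]
    rw [cyl_D hab hf (θ : Cross n) hz, ← hfz, ← hk, mul_div_assoc, ← hk]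
  have hP := sphere_poincare hn (sfs.of_le (by simp)) (hmean z)
  have hJen : s * D a b f₀ z ^ 2 ≤ ∫ θ : UnitSphere n, fz (z, θ) ^ 2 ∂(sph n) := by
    set m := D a b f₀ z with hm
    have h1 : 0 ≤ ∫ θ : UnitSphere n, (fz (z, θ) - m) ^ 2 ∂(sph n) :=
      integral_nonneg fun θ => sq_nonneg _
    have e : (fun θ : UnitSphere n => (fz (z, θ) - m) ^ 2) = fun θ : UnitSphere n =>
        (fz (z, θ) ^ 2 - 2 * m * fz (z, θ)) + m ^ 2 := by
      ext θ; ring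
    have t1 : Continuous fun θ : UnitSphere n => fz (z, θ) ^ 2 := cfz.pow 2
    have t2 : Continuous fun θ : UnitSphere n => 2 * m * fz (z, θ) := continuous_const.mul cfz
    have t3 : Continuous fun θ : UnitSphere n => fz (z, θ) ^ 2 - 2 * m * fz (z, θ) := t1.sub t2
    rw [e, integral_add (sphere_integrable t3) (integrable_const _),
      integral_sub (sphere_integrable t1) (sphere_integrable t2),
      integral_const_mul, hDf₀ z hz, integral_const, smul_eq_mul, ← hs] at h1
    nlinarith
  have h1 := mul_le_mul_of_nonneg_left hJen (hreg.pos z hz).le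
  have h2 := mul_le_mul_of_nonneg_left hP hk0
  rw [hJ, hq]
  rw [← hs] at h2
  nlinarith

/-- Stability follows from nonnegativity of the quadratic form under the linearized volume
constraint. -/
theorem stable_of_form_nonneg (hn : 1 ≤ n) (hX : IsEquilibrium n a b h) (hab : a < b)
    (hform : ∀ f : Smooth a b, ip hab hX.constraint f = 0 → 0 ≤ form (hX.isRegular hab) f f) :
    Stable n a b h := by
  intro δ ρ hδ hV
  obtain ⟨hsm, hcon, hsec⟩ := second_variation hab hX hδ hV
  obtain ⟨f₀, hmean, hle⟩ := form_mean_le hn hX hab hsm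
  have hs0 : 0 < (sph n).real univ := sph_real_pos n
  rw [hsec]
  refine le_trans (mul_nonneg hs0.le (hform f₀ ?_)) hle
  have h1 : ∫ z in a..b, ∫ θ : UnitSphere n, h z ^ n * velocity ρ z θ ∂(sph n) =
      ip hab hX.constraint f₀ * (sph n).real univ := by
    rw [ip_apply, ← intervalIntegral.integral_mul_const]
    refine integral_congr_Icc hab.le fun z _ => ?_
    rw [integral_const_mul, hmean, mul_assoc]
    rfl
  rw [hcon] at h1
  exact (mul_eq_zero.1 h1.symm).resolve_right hs0.ne'

/-- A direction in which the quadratic form is negative, and which satisfies the linearized volume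
constraint, gives an axially symmetric volume-preserving variation that decreases area: let the
`(n + 1)`-st power of the radius depend linearly on the parameter. -/
theorem unstable_of_form_neg (hX : IsEquilibrium n a b h) (hab : a < b) {f : Smooth a b}
    (hf : ip hab hX.constraint f = 0) (hneg : form (hX.isRegular hab) f f < 0) :
    Unstable n a b h := by
  have hreg := hX.isRegular hab
  have hn1 : (0 : ℝ) < n + 1 := by positivity
  obtain ⟨z₀, hz₀, hmin⟩ := isCompact_Icc.exists_isMinOn (nonempty_Icc.2 hab.le)
    hX.smooth.continuousOn
  obtain ⟨M, hM⟩ := isCompact_Icc.exists_bound_of_continuousOn (Smooth.contOn f)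
  have hM0 : 0 ≤ M := (norm_nonneg _).trans (hM z₀ hz₀)
  set m := h z₀ with hm
  have hm0 : 0 < m := hX.pos z₀ hz₀
  -- small enough for the power `h ^ (n + 1) + ε (n + 1) h ^ n f` of the radius to stay positive
  set δ := m / ((n + 1) * (M + 1)) with hδ
  have hδ0 : 0 < δ := by positivity
  set P : ℝ → ℝ → ℝ := fun ε z => h z ^ (n + 1) + ε * ((n + 1) * h z ^ n * (f : ℝ → ℝ) z) with hP
  have hPpos : ∀ ε ∈ Ioo (-δ) δ, ∀ z ∈ Icc a b, 0 < P ε z := by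
    intro ε hε z hz
    have h1 : P ε z = h z ^ n * (h z + ε * ((n + 1) * (f : ℝ → ℝ) z)) := by
      simp only [hP]
      ring
    rw [h1]
    refine mul_pos (pow_pos (hX.pos z hz) n) ?_
    have h2 : |ε * ((n + 1) * (f : ℝ → ℝ) z)| ≤ |ε| * ((n + 1) * M) := by
      rw [abs_mul, abs_mul, abs_of_pos hn1]
      exact mul_le_mul_of_nonneg_left (mul_le_mul_of_nonneg_left (hM z hz) hn1.le) (abs_nonneg _)
    have h3 : |ε| < δ := abs_lt.2 hε
    have h4 : |ε| * ((n + 1) * M) ≤ δ * ((n + 1) * M) :=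
      mul_le_mul_of_nonneg_right h3.le (by positivity)
    have h5 : δ * ((n + 1) * M) < m := by
      have h6 : δ * ((n + 1) * (M + 1)) = m := div_mul_cancel₀ _ (by positivity)
      nlinarith
    have h7 : m ≤ h z := hmin hz
    have := neg_abs_le (ε * ((n + 1) * (f : ℝ → ℝ) z))
    linarith
  set ρ : ℝ → ℝ → Cross n → ℝ := fun ε z _ => P ε z ^ (((n + 1 : ℕ) : ℝ)⁻¹) with hρ
  have hρpow : ∀ ε ∈ Ioo (-δ) δ, ∀ z ∈ Icc a b, ∀ θ, ρ ε z θ ^ (n + 1) = P ε z :=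
    fun ε hε z hz θ => Real.rpow_inv_natCast_pow (hPpos ε hε z hz).le (Nat.succ_ne_zero n)
  have h0 : (0 : ℝ) ∈ Ioo (-δ) δ := ⟨by linarith, hδ0⟩
  have hρ0 : ∀ z ∈ Icc a b, ∀ θ, ρ 0 z θ = h z := fun z hz θ => by
    simp only [hρ, hP, zero_mul, add_zero]
    exact Real.pow_rpow_inv_natCast (hX.pos z hz).le (Nat.succ_ne_zero n)
  have sP : ContDiffOn ℝ ∞ (fun p : ℝ × ℝ × Cross n => P p.1 p.2.1) (box n δ a b) := by
    have c1 : ContDiffOn ℝ ∞ (fun p : ℝ × ℝ × Cross n => h p.2.1) (box n δ a b) :=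
      hX.smooth.comp (f := fun p : ℝ × ℝ × Cross n => p.2.1) (by fun_prop) fun p hp => hp.2.1
    have c2 : ContDiffOn ℝ ∞ (fun p : ℝ × ℝ × Cross n => (f : ℝ → ℝ) p.2.1) (box n δ a b) :=
      f.2.comp (f := fun p : ℝ × ℝ × Cross n => p.2.1) (by fun_prop) fun p hp => hp.2.1
    exact (c1.pow (n + 1)).add (contDiffOn_fst.mul ((contDiffOn_const.mul (c1.pow n)).mul c2))
  have hV : IsVolumePreservingVariation n a b h δ ρ := by
    refine ⟨sP.rpow_const_of_ne fun p hp => (hPpos _ hp.1 _ hp.2.1).ne',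
      fun ε hε z hz θ => Real.rpow_pos_of_pos (hPpos ε hε z hz) _, fun z hz θ => hρ0 z hz θ, ?_⟩
    have hvol : ∀ ε ∈ Ioo (-δ) δ, enclosedVolume n a b (ρ ε) =
        ∫ z in a..b, (h z ^ (n + 1) / (n + 1) * (sph n).real univ
          + ε * (sph n).real univ * (h z ^ n * (f : ℝ → ℝ) z)) := by
      intro ε hε
      refine integral_congr_Icc hab.le fun z hz => ?_
      simp only [hρpow ε hε z hz, integral_const, smul_eq_mul, hP]
      field_simp
    have hc : ContinuousOn h (Icc a b) := hX.smooth.continuousOn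
    have hzero : ∀ ε ∈ Ioo (-δ) δ, enclosedVolume n a b (ρ ε) =
        ∫ z in a..b, h z ^ (n + 1) / (n + 1) * (sph n).real univ := by
      intro ε hε
      rw [hvol ε hε, intervalIntegral.integral_add, intervalIntegral.integral_const_mul]
      · have : ∫ z in a..b, h z ^ n * (f : ℝ → ℝ) z = 0 := hf
        rw [this, mul_zero, add_zero]
      · exact intervalIntegrable_of_contOn hab.le
          (((hc.pow _).div_const _).mul continuousOn_const)
      · exact intervalIntegrable_of_contOn hab.le
          (continuousOn_const.mul ((hc.pow n).mul (Smooth.contOn f)))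
    intro ε hε
    rw [hzero ε hε, hzero 0 h0]
  refine ⟨δ, ρ, hδ0, hV, ?_⟩
  obtain ⟨-, -, hsec⟩ := second_variation hab hX hδ0 hV
  have hvel : ∀ z ∈ Icc a b, ∀ θ, velocity ρ z θ = (f : ℝ → ℝ) z := by
    intro z hz θ
    have hPd : HasDerivAt (fun ε => P ε z) ((n + 1) * h z ^ n * (f : ℝ → ℝ) z) 0 := by
      exact (((hasDerivAt_id (0 : ℝ)).mul_const
        ((n + 1) * h z ^ n * (f : ℝ → ℝ) z)).const_add (h z ^ (n + 1))).congr_deriv (one_mul _)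
    have hd : DifferentiableAt ℝ (fun ε => ρ ε z θ) 0 :=
      hPd.differentiableAt.rpow_const (Or.inl (hPpos 0 h0 z hz).ne')
    have h1 := hd.hasDerivAt.fun_pow (n + 1)
    have h2 : (fun ε => ρ ε z θ ^ (n + 1)) =ᶠ[𝓝 0] fun ε => P ε z :=
      (isOpen_Ioo.eventually_mem h0).mono fun ε hε => hρpow ε hε z hz θ
    have h3 := h1.unique (hPd.congr_of_eventuallyEq h2)
    rw [hρ0 z hz θ, Nat.add_sub_cancel] at h3
    push_cast at h3
    exact mul_left_cancel₀ (mul_pos hn1 (pow_pos (hX.pos z hz) n)).ne' h3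
  have hJ : ∫ z in a..b, ∫ θ : UnitSphere n, jacobiDensity n a b h (velocity ρ) z θ ∂(sph n) =
      (sph n).real univ * form hreg f f := by
    rw [form_apply, ← intervalIntegral.integral_const_mul]
    refine integral_congr_Icc hab.le fun z hz => ?_
    have e1 : ∀ θ, D a b (fun s => velocity ρ s θ) z = D a b f z := fun θ =>
      D_congr (fun s hs => hvel s hs θ) hz
    have e2 : velocity ρ z = fun _ => (f : ℝ → ℝ) z := funext fun θ => hvel z hz θ
    have e3 : ∀ θ, sphereGradSq n (velocity ρ z) θ = 0 := fun θ => by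
      rw [e2]
      simp [sphereGradSq, gradient]
    simp only [jacobiDensity, e1, e3, hvel z hz, integral_const, smul_eq_mul, jacobiPot]
    ring
  rw [hsec, hJ]
  exact mul_neg_of_pos_of_neg (sph_real_pos n) hneg

end Reduction

/-! ### The stability criterion -/

section Criterion

variable {n : ℕ} {a b : ℝ} {h : ℝ → ℝ}

lemma IsEigenfunction.isNull {l : ℝ} {φ : ℝ → ℝ} (hφ : IsEigenfunction n a b h l φ) :
    IsNull a b (sigma n a b h) (fun z => jacobiPot n a b h z + l) φ := by
  refine ⟨⟨hφ.neumann_left, hφ.neumann_right⟩, fun z hz => ?_⟩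
  have h1 : slOp a b (sigma n a b h) (jacobiPot n a b h) φ z = -l * φ z := hφ.eqn z hz
  unfold slOp at h1 ⊢
  linarith

lemma isEigenfunction_of_isNull {l : ℝ} {φ : Smooth a b}
    (hφ : IsNull a b (sigma n a b h) (fun z => jacobiPot n a b h z + l) φ)
    (hne : ∃ z ∈ Icc a b, (φ : ℝ → ℝ) z ≠ 0) : IsEigenfunction n a b h l φ := by
  refine ⟨φ.2, hne, fun z hz => ?_, hφ.1.1, hφ.1.2⟩
  have h1 := hφ.2 z hz
  change slOp a b (sigma n a b h) (jacobiPot n a b h) φ z = -l * (φ : ℝ → ℝ) z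
  unfold slOp at h1 ⊢
  linarith

/-- The two lowest eigenvalues exist and have their variational characterizations. -/
lemma exists_lambda (hX : IsEquilibrium n a b h) (hab : a < b) : ∃ φ₁ φ₂ : Smooth a b,
    IsEigenfunction n a b h (lambda₁ n a b h) φ₁ ∧
    IsEigenfunction n a b h (lambda₂ n a b h) φ₂ ∧
    lambda₁ n a b h < lambda₂ n a b h ∧
    (∀ f : Smooth a b, lambda₁ n a b h * ip hab f f ≤ form (hX.isRegular hab) f f) ∧
    (∀ f : Smooth a b, ip hab φ₁ f = 0 →
      lambda₂ n a b h * ip hab f f ≤ form (hX.isRegular hab) f f) ∧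
    (∀ l ∈ eigenvalues n a b h, l = lambda₁ n a b h ∨ lambda₂ n a b h ≤ l) := by
  obtain ⟨m₁, m₂, φ₁, φ₂, hφ₁, hne₁, hφ₂, hne₂, hlt, hb₁, hb₂, hall⟩ :=
    exists_two_eigenvalues (hX.isRegular hab)
  have e₁ := isEigenfunction_of_isNull hφ₁ hne₁
  have e₂ := isEigenfunction_of_isNull hφ₂ hne₂
  have hall' : ∀ l ∈ eigenvalues n a b h, l = m₁ ∨ m₂ ≤ l := fun l ⟨ψ, hψ⟩ =>
    hall l ⟨ψ, hψ.smooth⟩ hψ.isNull hψ.ne_zero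
  have h₁ : lambda₁ n a b h = m₁ := by
    refine IsLeast.csInf_eq ⟨⟨φ₁, e₁⟩, fun l hl => ?_⟩
    rcases hall' l hl with h | h
    · exact h.ge
    · exact hlt.le.trans h
  have h₂ : lambda₂ n a b h = m₂ := by
    refine IsLeast.csInf_eq ⟨⟨⟨φ₂, e₂⟩, by rw [h₁]; exact hlt⟩, fun l hl => ?_⟩
    have h3 : m₁ < l := h₁ ▸ hl.2
    exact (hall' l hl.1).resolve_left h3.ne'
  rw [h₁, h₂]
  exact ⟨φ₁, φ₂, e₁, e₂, hlt, hb₁, hb₂, hall'⟩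

lemma IsEquilibrium.constraint_pos (hX : IsEquilibrium n a b h) (hab : a < b) :
    0 < ip hab hX.constraint hX.constraint :=
  ip_self_pos hab (left_mem_Icc.2 hab.le) (pow_pos (hX.pos a (left_mem_Icc.2 hab.le)) n).ne'

lemma isNull_add_zero {p q f : ℝ → ℝ} : IsNull a b p (fun z => q z + 0) f ↔ IsNull a b p q f := by
  simp

/-- The difference of two Neumann solutions is a solution of the homogeneous problem. -/
lemma IsNeumannSolution.isNull_sub (hX : IsEquilibrium n a b h) (hab : a < b) {u v : Smooth a b}
    (hu : IsNeumannSolution n a b h u) (hv : IsNeumannSolution n a b h v) :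
    IsNull a b (sigma n a b h) (jacobiPot n a b h) (v + (-1 : ℝ) • u : Smooth a b) := by
  have hreg := hX.isRegular hab
  refine ⟨IsNeumann.add hab (f := v) (g := (-1 : ℝ) • u) ⟨hv.neumann_left, hv.neumann_right⟩
    (IsNeumann.smul hab (-1) ⟨hu.neumann_left, hu.neumann_right⟩), fun z hz => ?_⟩
  have h1 : slOp a b (sigma n a b h) (jacobiPot n a b h) u z = h z ^ n := hu.eqn z hz
  have h2 : slOp a b (sigma n a b h) (jacobiPot n a b h) v z = h z ^ n := hv.eqn z hz
  rw [slOp_add hreg v _ hz, slOp_smul hreg _ u hz, h1, h2]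
  ring

lemma IsNeumannSolution.add_null (hX : IsEquilibrium n a b h) (hab : a < b) {u e : Smooth a b}
    (hu : IsNeumannSolution n a b h u)
    (he : IsNull a b (sigma n a b h) (jacobiPot n a b h) e) (c : ℝ) :
    IsNeumannSolution n a b h (u + c • e : Smooth a b) := by
  have hreg := hX.isRegular hab
  have hN := IsNeumann.add hab (f := u) (g := c • e) ⟨hu.neumann_left, hu.neumann_right⟩
    (IsNeumann.smul hab c he.1)
  refine ⟨(u + c • e : Smooth a b).2, fun z hz => ?_, hN.1, hN.2⟩
  have h1 : slOp a b (sigma n a b h) (jacobiPot n a b h) u z = h z ^ n := hu.eqn z hz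
  change slOp a b (sigma n a b h) (jacobiPot n a b h) (u + c • e : Smooth a b) z = _
  rw [slOp_add hreg u _ hz, slOp_smul hreg _ e hz, h1, he.2 z hz]
  ring

/-- The Fredholm alternative for the equation `𝓛 u = h^n`. -/
lemma exists_isNeumannSolution (hX : IsEquilibrium n a b h) (hab : a < b)
    (horth : ∀ e : Smooth a b, IsNull a b (sigma n a b h) (jacobiPot n a b h) e →
      ip hab hX.constraint e = 0) :
    ∃ u : Smooth a b, IsNeumannSolution n a b h u := by
  obtain ⟨C, -, hC⟩ := exists_neumann_solution (hX.isRegular hab)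
  obtain ⟨w, hwN, hw, -, -⟩ := hC hX.constraint horth
  exact ⟨w, w.2, hw, hwN.1, hwN.2⟩

theorem stable_of_isNeumannSolution (hn : 1 ≤ n) (hX : IsEquilibrium n a b h) (hab : a < b)
    (h₂ : 0 ≤ lambda₂ n a b h) {u : Smooth a b} (hu : IsNeumannSolution n a b h u)
    (hint : 0 ≤ ∫ z in a..b, (u : ℝ → ℝ) z * h z ^ n) : Stable n a b h := by
  obtain ⟨φ₁, φ₂, e₁, e₂, hlt, hb₁, hb₂, hall⟩ := exists_lambda hX hab
  exact stable_of_form_nonneg hn hX hab (form_nonneg_of_solution (hX.isRegular hab) e₁.isNull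
    (fun f hf => (mul_nonneg h₂ (ip_self_nonneg hab f)).trans (hb₂ f hf))
    ⟨hu.neumann_left, hu.neumann_right⟩ hu.eqn (hX.constraint_pos hab) hint)

theorem unstable_of_isNeumannSolution (hX : IsEquilibrium n a b h) (hab : a < b)
    (h₁ : lambda₁ n a b h < 0) {u : Smooth a b} (hu : IsNeumannSolution n a b h u)
    (hint : ∫ z in a..b, (u : ℝ → ℝ) z * h z ^ n < 0) : Unstable n a b h := by
  obtain ⟨φ₁, φ₂, e₁, e₂, hlt, hb₁, hb₂, hall⟩ := exists_lambda hX hab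
  obtain ⟨z, hz, hne⟩ := e₁.ne_zero
  obtain ⟨f, hf, hneg⟩ := exists_neg_of_solution (hX.isRegular hab) (κ := hX.constraint) e₁.isNull
    (ip_self_pos hab hz hne) h₁ ⟨hu.neumann_left, hu.neumann_right⟩ hu.eqn hint
  exact unstable_of_form_neg hX hab hf hneg

theorem stable_of_lambda₁_nonneg (hn : 1 ≤ n) (hX : IsEquilibrium n a b h) (hab : a < b)
    (h₁ : 0 ≤ lambda₁ n a b h) : Stable n a b h := by
  obtain ⟨φ₁, φ₂, e₁, e₂, hlt, hb₁, hb₂, hall⟩ := exists_lambda hX hab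
  exact stable_of_form_nonneg hn hX hab fun f _ =>
    (mul_nonneg h₁ (ip_self_nonneg hab f)).trans (hb₁ f)

theorem unstable_of_lambda₂_neg (hX : IsEquilibrium n a b h) (hab : a < b)
    (h₂ : lambda₂ n a b h < 0) : Unstable n a b h := by
  obtain ⟨φ₁, φ₂, e₁, e₂, hlt, hb₁, hb₂, hall⟩ := exists_lambda hX hab
  obtain ⟨z₁, hz₁, hne₁⟩ := e₁.ne_zero
  obtain ⟨z₂, hz₂, hne₂⟩ := e₂.ne_zero
  obtain ⟨f, hf, hneg⟩ := exists_neg_of_two (hX.isRegular hab) hX.constraint e₁.isNull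
    (ip_self_pos hab hz₁ hne₁) e₂.isNull (ip_self_pos hab hz₂ hne₂) hlt h₂
  exact unstable_of_form_neg hX hab hf hneg

theorem unstable_of_eigenfunction (hX : IsEquilibrium n a b h) (hab : a < b)
    (h₁ : lambda₁ n a b h < 0) {e : ℝ → ℝ} (he : IsEigenfunction n a b h 0 e)
    (hint : ∫ z in a..b, e z * h z ^ n ≠ 0) : Unstable n a b h := by
  obtain ⟨φ₁, φ₂, e₁, e₂, hlt, hb₁, hb₂, hall⟩ := exists_lambda hX hab
  obtain ⟨z, hz, hne⟩ := e₁.ne_zero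
  obtain ⟨f, hf, hneg⟩ := exists_neg_of_null (hX.isRegular hab) (κ := hX.constraint)
    (e := ⟨e, he.smooth⟩) e₁.isNull (ip_self_pos hab hz hne) h₁ he.isNull hint
  exact unstable_of_form_neg hX hab hf hneg

/-- When `0` is not an eigenvalue, the equation `𝓛 u = h^n` has exactly one solution. -/
lemma existsUnique_isNeumannSolution (hX : IsEquilibrium n a b h) (hab : a < b)
    (h₁ : lambda₁ n a b h < 0) (h₂ : 0 < lambda₂ n a b h) :
    ∃ u : Smooth a b, IsNeumannSolution n a b h u ∧
      ∀ v : ℝ → ℝ, IsNeumannSolution n a b h v → EqOn v u (Icc a b) := by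
  obtain ⟨φ₁, φ₂, e₁, e₂, hlt, hb₁, hb₂, hall⟩ := exists_lambda hX hab
  have hnull : ∀ e : Smooth a b, IsNull a b (sigma n a b h) (jacobiPot n a b h) e →
      ∀ z ∈ Icc a b, (e : ℝ → ℝ) z = 0 := by
    intro e he
    by_contra! hne
    rcases hall 0 ⟨e, isEigenfunction_of_isNull (isNull_add_zero.2 he) hne⟩ with h | h
    · exact h₁.ne h.symm
    · exact absurd h₂ h.not_gt
  obtain ⟨u, hu⟩ := exists_isNeumannSolution hX hab fun e he => by
    rw [ip_comm, ip_congr_left hab (f' := 0) (hnull e he), map_zero, LinearMap.zero_apply]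
  refine ⟨u, hu, fun v hv z hz => ?_⟩
  have h3 := hnull _ (IsNeumannSolution.isNull_sub hX hab (v := ⟨v, hv.smooth⟩) hu hv) z hz
  have h4 : v z + (-1 : ℝ) * (u : ℝ → ℝ) z = 0 := h3
  linarith

/-- When `0` is the second eigenvalue and `h^n` is orthogonal to its eigenfunctions, the equation
`𝓛 u = h^n` has exactly one solution orthogonal to them for the weight `h^n`. -/
lemma existsUnique_isNeumannSolution_orthogonal (hX : IsEquilibrium n a b h) (hab : a < b)
    (h₂ : lambda₂ n a b h = 0)
    (horth : ∀ e : ℝ → ℝ, IsEigenfunction n a b h 0 e → ∫ z in a..b, e z * h z ^ n = 0) :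
    ∃ u : Smooth a b, (IsNeumannSolution n a b h u ∧ ∀ e : ℝ → ℝ, IsEigenfunction n a b h 0 e →
        ∫ z in a..b, e z * (u : ℝ → ℝ) z * h z ^ n = 0) ∧
      ∀ v : ℝ → ℝ, (IsNeumannSolution n a b h v ∧ ∀ e : ℝ → ℝ, IsEigenfunction n a b h 0 e →
        ∫ z in a..b, e z * v z * h z ^ n = 0) → EqOn v u (Icc a b) := by
  have hreg := hX.isRegular hab
  obtain ⟨φ₁, φ, e₁, hφ, hlt, hb₁, hb₂, hall⟩ := exists_lambda hX hab
  rw [h₂] at hφ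
  have hφN := isNull_add_zero.1 hφ.isNull
  have hprop : ∀ e : Smooth a b, IsNull a b (sigma n a b h) (jacobiPot n a b h) e →
      ∃ c : ℝ, ∀ z ∈ Icc a b, (e : ℝ → ℝ) z = (c • φ : Smooth a b).1 z := fun e he =>
    he.proportional hreg hφN hφ.ne_zero
  obtain ⟨w, hw⟩ := exists_isNeumannSolution hX hab fun e he => by
    obtain ⟨c, hc⟩ := hprop e he
    have h1 : ip hab φ hX.constraint = 0 := horth φ hφ
    rw [ip_comm, ip_congr_left hab hc, map_smul, LinearMap.smul_apply, h1, smul_zero]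
  -- the weight `h^n` is moved into the second factor
  set ψ : Smooth a b := ⟨fun z => (φ : ℝ → ℝ) z * h z ^ n, φ.2.mul (hX.smooth.pow n)⟩ with hψ
  have hweight : ∀ v : Smooth a b, ∫ z in a..b, (φ : ℝ → ℝ) z * (v : ℝ → ℝ) z * h z ^ n =
      ip hab v ψ := fun v => by
    rw [ip_apply]
    refine integral_congr_Icc hab.le fun z _ => ?_
    simp only [hψ]
    ring
  have hpos : 0 < ip hab φ ψ := by
    have hsq : ContDiffOn ℝ ∞ (fun z => (φ : ℝ → ℝ) z * √(h z ^ n)) (Icc a b) :=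
      φ.2.mul ((hX.smooth.pow n).sqrt fun z hz => (pow_pos (hX.pos z hz) n).ne')
    obtain ⟨z, hz, hne⟩ := hφ.ne_zero
    have h1 := ip_self_pos hab (f := ⟨_, hsq⟩) hz
      (mul_ne_zero hne (Real.sqrt_pos.2 (pow_pos (hX.pos z hz) n)).ne')
    refine h1.trans_eq (integral_congr_Icc hab.le fun z hz => ?_)
    simp only [hψ]
    rw [mul_mul_mul_comm, Real.mul_self_sqrt (pow_pos (hX.pos z hz) n).le]
    ring
  set c := -(ip hab w ψ / ip hab φ ψ) with hc
  have hcφ : c * ip hab φ ψ = - ip hab w ψ := by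
    rw [hc, neg_mul, div_mul_cancel₀ _ hpos.ne']
  refine ⟨w + c • φ, ⟨hw.add_null hX hab hφN c, fun e he => ?_⟩, fun v hv z hz => ?_⟩
  · obtain ⟨d, hd⟩ := hprop ⟨e, he.smooth⟩ (isNull_add_zero.1 he.isNull)
    have h1 : ∫ z in a..b, e z * (w + c • φ : Smooth a b).1 z * h z ^ n =
        d * ip hab (w + c • φ) ψ := by
      rw [← hweight, ← intervalIntegral.integral_const_mul]
      refine integral_congr_Icc hab.le fun z hz => ?_
      have h2 : e z = d * (φ : ℝ → ℝ) z := hd z hz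
      rw [h2]
      ring
    rw [h1, map_add, map_smul, LinearMap.add_apply, LinearMap.smul_apply, smul_eq_mul, hcφ,
      add_neg_cancel, mul_zero]
  · obtain ⟨d, hd⟩ := hprop _ (IsNeumannSolution.isNull_sub hX hab (v := ⟨v, hv.1.smooth⟩)
      (hw.add_null hX hab hφN c) hv.1)
    have h1 : ip hab ⟨v, hv.1.smooth⟩ ψ = 0 := by
      rw [← hweight]
      exact hv.2 φ hφ
    have h2 := ip_congr_left hab hd ψ
    simp only [map_add, map_smul, LinearMap.add_apply, LinearMap.smul_apply, smul_eq_mul, hcφ, h1,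
      add_neg_cancel, mul_zero, zero_add] at h2
    have hd0 : d = 0 := (mul_eq_zero.1 h2.symm).resolve_right hpos.ne'
    have h3 := hd z hz
    rw [hd0, zero_smul] at h3
    have h4 : v z + (-1 : ℝ) * (w + c • φ : Smooth a b).1 z = 0 := h3
    linarith

end Criterion

end LiquidBridge

end

theorem mainTheorem2 (n : ℕ) (hn : 1 ≤ n) (z₁ z₂ : ℝ) (hz : z₁ < z₂) (h : ℝ → ℝ)
    (hX : LiquidBridge.IsEquilibrium n z₁ z₂ h) :
    -- (I)
    (0 ≤ LiquidBridge.lambda₁ n z₁ z₂ h → LiquidBridge.Stable n z₁ z₂ h) ∧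
    -- (II)
    (LiquidBridge.lambda₁ n z₁ z₂ h < 0 → 0 < LiquidBridge.lambda₂ n z₁ z₂ h →
      ∃ u : ℝ → ℝ, LiquidBridge.IsNeumannSolution n z₁ z₂ h u ∧
        (∀ v : ℝ → ℝ, LiquidBridge.IsNeumannSolution n z₁ z₂ h v → Set.EqOn v u (Set.Icc z₁ z₂)) ∧
        (0 ≤ (∫ z in z₁..z₂, u z * h z ^ n) → LiquidBridge.Stable n z₁ z₂ h) ∧
        ((∫ z in z₁..z₂, u z * h z ^ n) < 0 → LiquidBridge.Unstable n z₁ z₂ h)) ∧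
    -- (III)
    (LiquidBridge.lambda₁ n z₁ z₂ h < 0 → LiquidBridge.lambda₂ n z₁ z₂ h = 0 →
      -- (III-A)
      ((∃ e : ℝ → ℝ,
          LiquidBridge.IsEigenfunction n z₁ z₂ h (LiquidBridge.lambda₂ n z₁ z₂ h) e ∧
          (∫ z in z₁..z₂, e z * h z ^ n) ≠ 0) →
        LiquidBridge.Unstable n z₁ z₂ h) ∧
      -- (III-B)
      ((∀ e : ℝ → ℝ,
          LiquidBridge.IsEigenfunction n z₁ z₂ h (LiquidBridge.lambda₂ n z₁ z₂ h) e →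
          (∫ z in z₁..z₂, e z * h z ^ n) = 0) →
        ∃ u : ℝ → ℝ,
          (LiquidBridge.IsNeumannSolution n z₁ z₂ h u ∧
            ∀ e : ℝ → ℝ,
              LiquidBridge.IsEigenfunction n z₁ z₂ h (LiquidBridge.lambda₂ n z₁ z₂ h) e →
              (∫ z in z₁..z₂, e z * u z * h z ^ n) = 0) ∧
          (∀ v : ℝ → ℝ,
            (LiquidBridge.IsNeumannSolution n z₁ z₂ h v ∧
              ∀ e : ℝ → ℝ,
                LiquidBridge.IsEigenfunction n z₁ z₂ h (LiquidBridge.lambda₂ n z₁ z₂ h) e →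
                (∫ z in z₁..z₂, e z * v z * h z ^ n) = 0) →
            Set.EqOn v u (Set.Icc z₁ z₂)) ∧
          (0 ≤ (∫ z in z₁..z₂, u z * h z ^ n) → LiquidBridge.Stable n z₁ z₂ h) ∧
          ((∫ z in z₁..z₂, u z * h z ^ n) < 0 → LiquidBridge.Unstable n z₁ z₂ h))) ∧
    -- (IV)
    (LiquidBridge.lambda₂ n z₁ z₂ h < 0 → LiquidBridge.Unstable n z₁ z₂ h) := by
  refine ⟨LiquidBridge.stable_of_lambda₁_nonneg hn hX hz, fun h₁ h₂ => ?_, fun h₁ h₂ => ?_,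
    LiquidBridge.unstable_of_lambda₂_neg hX hz⟩
  · obtain ⟨u, hu, huniq⟩ := LiquidBridge.existsUnique_isNeumannSolution hX hz h₁ h₂
    exact ⟨u, hu, huniq, LiquidBridge.stable_of_isNeumannSolution hn hX hz h₂.le hu,
      LiquidBridge.unstable_of_isNeumannSolution hX hz h₁ hu⟩
  · simp only [h₂]
    refine ⟨fun ⟨e, he, hint⟩ => LiquidBridge.unstable_of_eigenfunction hX hz h₁ he hint,
      fun horth => ?_⟩
    obtain ⟨u, hu, huniq⟩ :=
      LiquidBridge.existsUnique_isNeumannSolution_orthogonal hX hz h₂ horth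
    exact ⟨u, hu, huniq, LiquidBridge.stable_of_isNeumannSolution hn hX hz h₂.ge hu.1,
      LiquidBridge.unstable_of_isNeumannSolution hX hz h₁ hu.1⟩
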